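/- Let $G=\mathrm{Isom}^+(\mathbb H^{n+1})\cong \mathrm{SO}^+(n+1,1)$ with Lie algebra $\mathfrak g$, let $O\in\mathbb H^{n+1}$ be a base point with stabilizer $K$, and let $\Gamma<G$ be a torsion-free discrete subgroup with critical exponent $\delta(\Gamma)=\inf\{s:\sum_{\gamma\in\Gamma}e^{-s\,d(O,\gamma O)}<\infty\}$; $\Gamma$ is of convergence type if this infimum is achieved. Let $\xi\in\partial_\infty\mathbb H^{n+1}$ be a full rank parabolic fixed point of $\Gamma$: $\xi$ is fixed by a parabolic element of $\Gamma$, and $\Gamma_\xi=\Gamma\cap P_\xi$, $P_\xi=\mathrm{Stab}_G(\xi)$, acts cocompactly on the horosphere $\mathcal H_\xi(1)\cong\mathbb R^n$ at $\xi$ through $O$. Let $A_\xi=\exp(\mathbb R T)$ be the group of translations along the geodesic from $O$ to $\xi$, with $T$ translating towards $\xi$ at speed $2$; let $\mathfrak g=\mathfrak g_2\oplus\mathfrak g_0\oplus\mathfrak g_{-2}$ be the eigenspace decomposition of $\operatorname{ad}T$, $N_\xi=\exp\mathfrak g_2$, and $t_a=e^{\tau}$ for $a=\exp(\tau T)\in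 A_\xi$. Let $u_1,\dots,u_n\in\mathfrak g_2$ be the elements that exponentiate to the unit translations of $\mathcal H_\xi(1)$ along the axes of Cartesian coordinates centred at $O$, and let $u_i^*$ be the dual basis, extended by zero to $\operatorname{Lie}(K)\oplus\mathbb RT$. Let $(\rho,V)$ be either the adjoint representation of $G$ on $V=\mathfrak g$, with a vector $v_\xi\in\mathfrak g_{-2}$, or the trivial representation on $V=\mathbb R$, with $v_\xi=1$. For $s\in\mathbb R$ define $\phi_{\xi,s}:G\to\operatorname{Hom}(\Lambda^n\mathfrak g,V)$ by $$\phi_{\xi,s}(\nu ak)=t_a^{\,s}\cdot \mathrm{Ad}_{\mathfrak g}^*(k^{-1})\otimes\rho(k^{-1})\big((u_1^*\wedge\dots\wedge u_n^*)\otimes v_\xi\big),\qquad \nu\in N_\xi,\ a\in A_\xi,\ k\in K,$$ and, when $\phi_{\xi,s}$ is left $\Gamma_\xi$-invariant (which is automatic for the trivial representation), let $$E(\phi_\xi,g,s)=\sum_{\gamma\in\Gamma_\xi\backslash\Gamma}\phi_{\xi,s}(\gamma g),\qquad g\in G.$$ 1. Let $V=\mathfrak g$ be the adjoint representation, and let $v_\xi\in\mathfrak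 g_{-2}$ be such that $\phi_{\xi,2n+2}$ is left $\Gamma_\xi$-invariant. Then $E(\phi_\xi,g,2n+2)$ is always an absolutely convergent closed form. 2. Let $V=\mathbb R$ be the trivial representation. If $\Gamma$ is of convergence type or $\delta(\Gamma)<n$, then $E(\phi_\xi,g,2n)$ is an absolutely convergent closed form. Here "absolutely convergent closed form" means: the series converges absolutely for every $g\in G$; its sum $E:G\to\operatorname{Hom}(\Lambda^n\mathfrak g,V)$ is smooth, satisfies $E(\gamma g)=E(g)$ for $\gamma\in\Gamma$ and $E(gk)=\mathrm{Ad}_{\mathfrak g}^*(k^{-1})\otimes\rho(k^{-1})E(g)$ for $k\in K$, and is annihilated by contraction with $\operatorname{Lie}(K)$, so that it represents a $\Gamma$-invariant $V$-valued $n$-form on $\mathbb H^{n+1}=G/K$; and $dE=0$, where, with left-invariant vector fields $X_i\in\mathfrak g$, $$df(X_1,\dots,X_{n+1})=\sum_i(-1)^{i+1}(X_i+\rho(X_i))f(\dots,\widehat{X_i},\dots)+\sum_{i<j}(-1)^{i+j}f([X_i,X_j],\dots,\widehat{X_i},\dots,\widehat{X_j},\dots).$$ -/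

import Mathlib

open scoped Matrix ContDiff

-- The commutator bracket on square matrices.
attribute [local instance 100] LieRing.ofAssociativeRing

namespace HypEis

/-! ### Hyperbolic space `ℍⁿ⁺¹` (hyperboloid model), its isometries and its boundary -/

/-- Coordinates of `ℝ^{n+1,1}`: `n + 1` spatial ones and one time coordinate. -/
abbrev Idx (n : ℕ) : Type := Fin (n + 1) ⊕ Unit

/-- The matrix `diag(1, …, 1, -1)` of the Lorentz form. -/
abbrev J (n : ℕ) : Matrix (Idx n) (Idx n) ℝ :=
  LieAlgebra.Orthogonal.indefiniteDiagonal (Fin (n + 1)) Unit ℝ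

/-- The Lorentz form `x₀y₀ + ⋯ + xₙyₙ - x_t y_t`. -/
def lorentz {n : ℕ} (x y : Idx n → ℝ) : ℝ := x ⬝ᵥ (J n *ᵥ y)

/-- Hyperbolic space: the upper sheet of the hyperboloid. -/
def hyperboloid (n : ℕ) : Set (Idx n → ℝ) :=
  {x | lorentz x x = -1 ∧ 0 < x (Sum.inr ())}

/-- The base point `O`. -/
def basePt (n : ℕ) : Idx n → ℝ := Sum.elim 0 1

/-- The hyperbolic distance (curvature `-1`). -/
noncomputable def hypDist {n : ℕ} (x y : Idx n → ℝ) : ℝ := Real.arcosh (-lorentz x y)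

/-- `G = SO⁺(n+1,1) ≅ Isom⁺(ℍⁿ⁺¹)`: the linear maps of determinant one that preserve the Lorentz
form and the upper sheet of the hyperboloid. -/
def SOPlus (n : ℕ) : Subgroup (Matrix.GeneralLinearGroup (Idx n) ℝ) where
  carrier := {A | (A : Matrix (Idx n) (Idx n) ℝ)ᵀ * J n * (A : Matrix (Idx n) (Idx n) ℝ) = J n ∧
    (A : Matrix (Idx n) (Idx n) ℝ).det = 1 ∧
    ∀ x, (A : Matrix (Idx n) (Idx n) ℝ) *ᵥ x ∈ hyperboloid n ↔ x ∈ hyperboloid n}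
  one_mem' := by simp
  mul_mem' := by
    rintro A B ⟨hA, hA', hA''⟩ ⟨hB, hB', hB''⟩
    refine ⟨?_, ?_, fun x => ?_⟩
    · simp only [Units.val_mul, Matrix.transpose_mul]
      calc _ = (B : Matrix (Idx n) (Idx n) ℝ)ᵀ *
            ((A : Matrix (Idx n) (Idx n) ℝ)ᵀ * J n * (A : Matrix (Idx n) (Idx n) ℝ)) *
              (B : Matrix (Idx n) (Idx n) ℝ) := by simp only [Matrix.mul_assoc]
        _ = _ := by rw [hA, hB]
    · simp [hA', hB']
    · rw [Units.val_mul, ← Matrix.mulVec_mulVec, hA'', hB'']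
  inv_mem' := by
    rintro A ⟨hA, hA', hA''⟩
    have h1 : (A : Matrix (Idx n) (Idx n) ℝ) * ((A⁻¹ : Matrix.GeneralLinearGroup (Idx n) ℝ) :
        Matrix (Idx n) (Idx n) ℝ) = 1 := by rw [← Units.val_mul]; simp
    have h2 := congrArg Matrix.transpose h1
    rw [Matrix.transpose_mul, Matrix.transpose_one] at h2
    refine ⟨?_, ?_, fun x => ?_⟩
    · conv_lhs => rw [← hA]
      simp only [← Matrix.mul_assoc]
      rw [h2, Matrix.one_mul, Matrix.mul_assoc, h1, Matrix.mul_one]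
    · have := congrArg Matrix.det h1
      rwa [Matrix.det_mul, hA', one_mul, Matrix.det_one] at this
    · rw [← hA'', Matrix.mulVec_mulVec, h1, Matrix.one_mulVec]

/-- The underlying matrix of an element of `G`. -/
def mat {n : ℕ} (g : SOPlus n) : Matrix (Idx n) (Idx n) ℝ :=
  ((g : Matrix.GeneralLinearGroup (Idx n) ℝ) : Matrix (Idx n) (Idx n) ℝ)

/-- The boundary at infinity: each null ray is represented by its point of time coordinate `1`. -/
def boundary (n : ℕ) : Set (Idx n → ℝ) := {ξ | lorentz ξ ξ = 0 ∧ ξ (Sum.inr ()) = 1}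

/-- `P_ξ`, the stabilizer in `G` of the boundary point (that is, of the null ray) `ξ`. -/
def parabolicSubgroup {n : ℕ} (ξ : Idx n → ℝ) : Subgroup (SOPlus n) where
  carrier := {g | ∃ c : ℝ, 0 < c ∧ mat g *ᵥ ξ = c • ξ}
  one_mem' := ⟨1, one_pos, by simp [mat]⟩
  mul_mem' := by
    rintro a b ⟨c, hc, ha⟩ ⟨d, hd, hb⟩
    refine ⟨c * d, mul_pos hc hd, ?_⟩
    have : mat (a * b) = mat a * mat b := rfl
    rw [this, ← Matrix.mulVec_mulVec, hb, Matrix.mulVec_smul, ha, smul_smul, mul_comm]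
  inv_mem' := by
    rintro a ⟨c, hc, ha⟩
    refine ⟨c⁻¹, inv_pos.2 hc, ?_⟩
    have h : mat a⁻¹ * mat a = 1 := by
      have : mat a⁻¹ * mat a = mat (a⁻¹ * a) := rfl
      rw [this]; simp [mat]
    have h2 := congrArg (fun w => mat a⁻¹ *ᵥ w) ha
    simp only [Matrix.mulVec_mulVec, h, Matrix.one_mulVec, Matrix.mulVec_smul] at h2
    conv_rhs => rw [h2]
    rw [smul_smul, inv_mul_cancel₀ hc.ne', one_smul]

/-- `K`, the stabilizer in `G` of the base point. -/
def maxCompact (n : ℕ) : Subgroup (SOPlus n) where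
  carrier := {g | mat g *ᵥ basePt n = basePt n}
  one_mem' := by simp [mat]
  mul_mem' := by
    rintro a b ha hb
    have : mat (a * b) = mat a * mat b := rfl
    simp only [Set.mem_ofPred_eq] at *
    rw [this, ← Matrix.mulVec_mulVec, hb, ha]
  inv_mem' := by
    rintro a ha
    have h : mat a⁻¹ * mat a = 1 := by
      have : mat a⁻¹ * mat a = mat (a⁻¹ * a) := rfl
      rw [this]; simp [mat]
    simp only [Set.mem_ofPred_eq] at *
    conv_lhs => rw [← ha]
    rw [Matrix.mulVec_mulVec, h, Matrix.one_mulVec]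

/-- The horosphere `𝓗_ξ(1)` centred at `ξ` through the base point. -/
def horosphere {n : ℕ} (ξ : Idx n → ℝ) : Set (Idx n → ℝ) :=
  {x | x ∈ hyperboloid n ∧ lorentz x ξ = lorentz (basePt n) ξ}

/-- Parabolic isometries: no fixed point inside, exactly one on the boundary. -/
def IsParabolic {n : ℕ} (g : SOPlus n) : Prop :=
  (∀ x ∈ hyperboloid n, mat g *ᵥ x ≠ x) ∧ ∃! ξ, ξ ∈ boundary n ∧ g ∈ parabolicSubgroup ξ

/-- `ξ` is a parabolic fixed point of `Γ` of full rank: it is fixed by a parabolic element of `Γ`,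
and `Γ_ξ = Γ ∩ P_ξ` acts cocompactly on the horosphere at `ξ` through `O`. -/
def IsFullRankParabolicFixedPoint {n : ℕ} (Γ : Subgroup (SOPlus n)) (ξ : Idx n → ℝ) : Prop :=
  ξ ∈ boundary n ∧
  (∃ γ ∈ Γ ⊓ parabolicSubgroup ξ, IsParabolic γ) ∧
  ∃ C ⊆ horosphere ξ, IsCompact C ∧
    ∀ x ∈ horosphere ξ, ∃ γ ∈ Γ ⊓ parabolicSubgroup ξ, mat γ *ᵥ x ∈ C

/-! ### Critical exponent -/

/-- Convergence of the Poincaré series `∑_{γ ∈ Γ} e^{-s d(O, γO)}`. -/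
def PoincareConverges {n : ℕ} (Γ : Subgroup (SOPlus n)) (s : ℝ) : Prop :=
  Summable fun γ : Γ => Real.exp (-s * hypDist (basePt n) (mat (γ : SOPlus n) *ᵥ basePt n))

/-- The critical exponent `δ(Γ)`. -/
noncomputable def criticalExponent {n : ℕ} (Γ : Subgroup (SOPlus n)) : ℝ :=
  sInf {s : ℝ | PoincareConverges Γ s}

/-- `Γ` is of convergence type: the infimum defining `δ(Γ)` is achieved. -/
def IsConvergenceType {n : ℕ} (Γ : Subgroup (SOPlus n)) : Prop :=
  PoincareConverges Γ (criticalExponent Γ)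

/-! ### The Lie algebra, its exponential map and the adjoint representation -/

/-- The Lie algebra `𝔤 = 𝔰𝔬(n+1,1)` of `G`, with the commutator bracket. -/
def LieAlg (n : ℕ) : Type :=
  (LieAlgebra.Orthogonal.so' (Fin (n + 1)) Unit ℝ : LieSubalgebra ℝ (Matrix (Idx n) (Idx n) ℝ))

instance lieRingInst (n : ℕ) : LieRing (LieAlg n) :=
  inferInstanceAs (LieRing (LieAlgebra.Orthogonal.so' (Fin (n + 1)) Unit ℝ))

instance lieAlgebraInst (n : ℕ) : LieAlgebra ℝ (LieAlg n) :=
  inferInstanceAs (LieAlgebra ℝ (LieAlgebra.Orthogonal.so' (Fin (n + 1)) Unit ℝ))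

/-- The underlying matrix of an element of `𝔤`. -/
def toMat {n : ℕ} : LieAlg n →ₗ[ℝ] Matrix (Idx n) (Idx n) ℝ :=
  (LieAlgebra.Orthogonal.so' (Fin (n + 1)) Unit ℝ).toSubmodule.subtype

theorem toMat_injective {n : ℕ} : Function.Injective (toMat (n := n)) := Subtype.val_injective

theorem toMat_skew {n : ℕ} (X : LieAlg n) : (toMat X)ᵀ * J n = J n * (-toMat X) :=
  (mem_skewAdjointMatricesSubmodule _ _).1 X.2

/-- An element of `𝔤` from its matrix. -/
def ofMat {n : ℕ} (X : Matrix (Idx n) (Idx n) ℝ) (hX : Xᵀ * J n = J n * (-X)) : LieAlg n :=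
  ⟨X, (mem_skewAdjointMatricesSubmodule _ _).2 hX⟩

/-- `𝔤` is normed by the largest absolute value of a matrix entry. -/
noncomputable instance lieNormedAddCommGroup (n : ℕ) : NormedAddCommGroup (LieAlg n) :=
  letI : NormedAddCommGroup (Matrix (Idx n) (Idx n) ℝ) := Matrix.normedAddCommGroup
  NormedAddCommGroup.induced (LieAlg n) (Matrix (Idx n) (Idx n) ℝ) toMat toMat_injective

noncomputable instance lieNormedSpace (n : ℕ) : NormedSpace ℝ (LieAlg n) :=
  letI : NormedAddCommGroup (Matrix (Idx n) (Idx n) ℝ) := Matrix.normedAddCommGroup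
  letI : NormedSpace ℝ (Matrix (Idx n) (Idx n) ℝ) := Matrix.normedSpace
  NormedSpace.induced ℝ (LieAlg n) (Matrix (Idx n) (Idx n) ℝ) toMat

instance lieFiniteDimensional (n : ℕ) : FiniteDimensional ℝ (LieAlg n) :=
  FiniteDimensional.of_injective toMat toMat_injective

theorem lorentz_mulVec {n : ℕ} {A : Matrix (Idx n) (Idx n) ℝ} (hA : Aᵀ * J n * A = J n)
    (x : Idx n → ℝ) : lorentz (A *ᵥ x) (A *ᵥ x) = lorentz x x := by
  unfold lorentz
  conv_rhs => rw [← hA]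
  rw [← Matrix.mulVec_mulVec, ← Matrix.mulVec_mulVec, Matrix.dotProduct_mulVec x,
    Matrix.vecMul_transpose]

theorem exp_isom {n : ℕ} {X : Matrix (Idx n) (Idx n) ℝ} (hX : Xᵀ * J n = J n * (-X)) :
    (NormedSpace.exp X)ᵀ * J n * NormedSpace.exp X = J n := by
  have hJ : J n * J n = 1 := by
    unfold J LieAlgebra.Orthogonal.indefiniteDiagonal
    rw [Matrix.diagonal_mul_diagonal, ← Matrix.diagonal_one]
    congr 1
    ext i
    cases i <;> simp
  have hu : IsUnit (J n) := ⟨⟨J n, J n, hJ, hJ⟩, rfl⟩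
  have hi : (J n)⁻¹ = J n := Matrix.inv_eq_left_inv hJ
  have h1 : Xᵀ = J n * (-X) * (J n)⁻¹ := by
    rw [hi, ← hX, Matrix.mul_assoc, hJ, Matrix.mul_one]
  rw [← Matrix.exp_transpose, h1, Matrix.exp_conj _ _ hu, hi, Matrix.mul_assoc (J n * _), hJ,
    Matrix.mul_one, Matrix.exp_neg, Matrix.mul_assoc,
    Matrix.nonsing_inv_mul _ ((Matrix.isUnit_iff_isUnit_det _).1 (Matrix.isUnit_exp X)),
    Matrix.mul_one]

theorem exp_det {n : ℕ} {X : Matrix (Idx n) (Idx n) ℝ} (hX : Xᵀ * J n = J n * (-X)) :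
    (NormedSpace.exp X).det = 1 := by
  have h0 : (J n).det ≠ 0 := by
    unfold J LieAlgebra.Orthogonal.indefiniteDiagonal
    simp [Matrix.det_diagonal]
  have h1 := congrArg Matrix.det (exp_isom hX)
  rw [Matrix.det_mul, Matrix.det_mul, Matrix.det_transpose] at h1
  have h2 : (NormedSpace.exp X).det = (NormedSpace.exp ((1 / 2 : ℝ) • X)).det ^ 2 := by
    rw [← Matrix.det_pow, ← Matrix.exp_nsmul, ← Nat.cast_smul_eq_nsmul ℝ, smul_smul]
    norm_num
  have h3 : (NormedSpace.exp X).det ^ 2 = 1 := by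
    have : ((NormedSpace.exp X).det ^ 2 - 1) * (J n).det = 0 := by linear_combination h1
    rcases mul_eq_zero.1 this with h | h
    · linarith
    · exact absurd h h0
  have h4 : 0 ≤ (NormedSpace.exp X).det := h2 ▸ sq_nonneg _
  nlinarith

theorem exp_mem_hyperboloid {n : ℕ} {X : Matrix (Idx n) (Idx n) ℝ}
    (hX : Xᵀ * J n = J n * (-X)) {x : Idx n → ℝ} (hx : x ∈ hyperboloid n) : NormedSpace.exp X *ᵥ x ∈ hyperboloid n := by
  have hmem : ∀ t : ℝ, (t • X)ᵀ * J n = J n * (-(t • X)) := fun t => by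
    rw [Matrix.transpose_smul, Matrix.smul_mul, hX, ← smul_neg, Matrix.mul_smul]
  have hl : ∀ t : ℝ, lorentz (NormedSpace.exp (t • X) *ᵥ x) (NormedSpace.exp (t • X) *ᵥ x) = -1 :=
    fun t => by rw [lorentz_mulVec (exp_isom (hmem t)), hx.1]
  refine ⟨by simpa using hl 1, ?_⟩
  by_contra hneg
  push Not at hneg
  set f : ℝ → ℝ := fun t => (NormedSpace.exp (t • X) *ᵥ x) (Sum.inr ()) with hf
  have hc : Continuous f := by
    have h1 : Continuous fun t : ℝ => NormedSpace.exp (t • X) := by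
      let : NormedRing (Matrix (Idx n) (Idx n) ℝ) := Matrix.linftyOpNormedRing
      let : NormedAlgebra ℝ (Matrix (Idx n) (Idx n) ℝ) := Matrix.linftyOpNormedAlgebra
      exact continuous_iff_continuousAt.2 fun t =>
        (hasDerivAt_exp_smul_const (𝕂 := ℝ) X t).continuousAt
    exact (continuous_apply (Sum.inr ())).comp (h1.matrix_mulVec continuous_const)
  have h0 : 0 ≤ f 0 := by simpa [hf] using hx.2.le
  have h1 : f 1 ≤ 0 := by simpa [hf] using hneg
  obtain ⟨t, -, ht⟩ := intermediate_value_Icc' zero_le_one hc.continuousOn ⟨h1, h0⟩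
  have h2 := hl t
  set y := NormedSpace.exp (t • X) *ᵥ x with hy
  have ht' : y (Sum.inr ()) = 0 := ht
  have h3 : 0 ≤ lorentz y y := by
    unfold lorentz J LieAlgebra.Orthogonal.indefiniteDiagonal
    simp only [dotProduct, Matrix.mulVec_diagonal, Fintype.sum_sum_type, Sum.elim_inl,
      Sum.elim_inr, Finset.univ_unique, Finset.sum_singleton]
    have : y (Sum.inr default) = 0 := ht'
    rw [this]
    have : 0 ≤ ∑ i : Fin (n + 1), y (Sum.inl i) * (1 * y (Sum.inl i)) :=
      Finset.sum_nonneg fun i _ => by rw [one_mul]; exact mul_self_nonneg _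
    linarith
  linarith

theorem exp_mul_exp_neg {n : ℕ} (X : Matrix (Idx n) (Idx n) ℝ) :
    NormedSpace.exp X * NormedSpace.exp (-X) = 1 := by
  have h : IsUnit (NormedSpace.exp X).det :=
    (Matrix.isUnit_iff_isUnit_det _).1 (Matrix.isUnit_exp X)
  rw [Matrix.exp_neg, Matrix.mul_nonsing_inv _ h]

theorem exp_neg_mul_exp {n : ℕ} (X : Matrix (Idx n) (Idx n) ℝ) :
    NormedSpace.exp (-X) * NormedSpace.exp X = 1 := by
  have h : IsUnit (NormedSpace.exp X).det :=
    (Matrix.isUnit_iff_isUnit_det _).1 (Matrix.isUnit_exp X)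
  rw [Matrix.exp_neg, Matrix.nonsing_inv_mul _ h]

theorem exp_mem_hyperboloid_iff {n : ℕ} (X : LieAlg n) (x : Idx n → ℝ) :
    NormedSpace.exp (toMat X) *ᵥ x ∈ hyperboloid n ↔ x ∈ hyperboloid n := by
  refine ⟨fun h => ?_, exp_mem_hyperboloid (toMat_skew X)⟩
  have h1 := exp_mem_hyperboloid (toMat_skew (-X)) h
  rwa [map_neg, Matrix.mulVec_mulVec, exp_neg_mul_exp, Matrix.one_mulVec] at h1

/-- The exponential map `𝔤 → G`. -/
noncomputable def expG {n : ℕ} (X : LieAlg n) : SOPlus n :=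
  ⟨⟨NormedSpace.exp (toMat X), NormedSpace.exp (-toMat X), exp_mul_exp_neg _, exp_neg_mul_exp _⟩,
    exp_isom (toMat_skew X), exp_det (toMat_skew X), exp_mem_hyperboloid_iff X⟩

theorem mat_mul_inv {n : ℕ} (g : SOPlus n) : mat g * mat g⁻¹ = 1 := by
  have : mat g * mat g⁻¹ = mat (g * g⁻¹) := rfl
  rw [this, mul_inv_cancel]
  rfl

theorem conj_skew {n : ℕ} (g : SOPlus n) (X : LieAlg n) :
    (mat g * toMat X * mat g⁻¹)ᵀ * J n = J n * (-(mat g * toMat X * mat g⁻¹)) := by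
  have h1 := mat_mul_inv g
  have h2 : (mat g⁻¹)ᵀ * (mat g)ᵀ = 1 := by
    rw [← Matrix.transpose_mul, h1, Matrix.transpose_one]
  have hg : (mat g)ᵀ * J n * mat g = J n := g.2.1
  have hJ1 : (mat g)ᵀ * J n = J n * mat g⁻¹ := by
    conv_rhs => rw [← hg]
    rw [Matrix.mul_assoc, h1, Matrix.mul_one]
  have hJ2 : (mat g⁻¹)ᵀ * J n = J n * mat g := by
    conv_lhs => rw [← hg]
    rw [← Matrix.mul_assoc, ← Matrix.mul_assoc, h2, Matrix.one_mul]
  rw [Matrix.transpose_mul, Matrix.transpose_mul, Matrix.mul_assoc,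
    Matrix.mul_assoc, hJ1, ← Matrix.mul_assoc _ (J n), toMat_skew X, ← Matrix.mul_assoc,
    ← Matrix.mul_assoc, hJ2]
  simp only [Matrix.mul_assoc, Matrix.mul_neg, Matrix.neg_mul]

/-- The adjoint representation `Ad(g) X = g X g⁻¹` of `G` on `𝔤`. -/
noncomputable def Ad (n : ℕ) : Representation ℝ (SOPlus n) (LieAlg n) where
  toFun g :=
    { toFun := fun X => ofMat (mat g * toMat X * mat g⁻¹) (conj_skew g X)
      map_add' := fun X Y => by
        apply toMat_injective
        change mat g * toMat (X + Y) * mat g⁻¹ =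
          mat g * toMat X * mat g⁻¹ + mat g * toMat Y * mat g⁻¹
        rw [map_add, Matrix.mul_add, Matrix.add_mul]
      map_smul' := fun c X => by
        apply toMat_injective
        change mat g * toMat (c • X) * mat g⁻¹ = c • (mat g * toMat X * mat g⁻¹)
        rw [map_smul, Matrix.mul_smul, Matrix.smul_mul] }
  map_one' := by
    ext1 X
    apply toMat_injective
    change mat 1 * toMat X * mat 1⁻¹ = toMat X
    rw [inv_one]
    change (1 : Matrix (Idx n) (Idx n) ℝ) * toMat X * 1 = toMat X
    rw [Matrix.one_mul, Matrix.mul_one]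
  map_mul' g h := by
    ext1 X
    apply toMat_injective
    change mat (g * h) * toMat X * mat (g * h)⁻¹ =
      mat g * (mat h * toMat X * mat h⁻¹) * mat g⁻¹
    have h1 : mat (g * h) = mat g * mat h := rfl
    have h2 : mat (g * h)⁻¹ = mat h⁻¹ * mat g⁻¹ := by rw [mul_inv_rev]; rfl
    simp only [h1, h2, Matrix.mul_assoc]

/-! ### Data attached to a boundary point -/

/-- `T_ξ`: twice the infinitesimal unit-speed translation along the geodesic from `O` to `ξ`. It
spans `𝔞_ξ`, and `[T_ξ, X] = 2X` for `X ∈ 𝔫_ξ`. -/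
noncomputable def translationGen {n : ℕ} (ξ : Idx n → ℝ) : LieAlg n :=
  ofMat ((2 : ℝ) • Matrix.fromBlocks 0 (Matrix.replicateCol Unit fun i => ξ (Sum.inl i))
      (Matrix.replicateRow Unit fun i => ξ (Sum.inl i)) 0) <| by
    have hJ : J n = Matrix.fromBlocks 1 0 0 (-1) := by
      unfold J LieAlgebra.Orthogonal.indefiniteDiagonal
      ext i j
      rcases i with i | i <;> rcases j with j | j <;>
        simp [Matrix.diagonal_apply, Matrix.one_apply]
    rw [hJ, Matrix.transpose_smul, Matrix.fromBlocks_transpose, Matrix.smul_mul, Matrix.mul_neg,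
      Matrix.mul_smul, ← smul_neg]
    simp [Matrix.fromBlocks_multiply, Matrix.fromBlocks_neg]

/-- The summand `𝔤_c` (`c = 2, 0, -2`) of the root space decomposition
`𝔤 = 𝔤₂ ⊕ 𝔤₀ ⊕ 𝔤₋₂` with respect to `𝔞_ξ`: the `c`-eigenspace of `ad T_ξ`.
In particular `𝔤₂ = 𝔫_ξ`, the Lie algebra of the unipotent radical `N_ξ = exp 𝔫_ξ` of `P_ξ`. -/
noncomputable def rootSpace {n : ℕ} (ξ : Idx n → ℝ) (c : ℝ) : Submodule ℝ (LieAlg n) :=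
  Module.End.eigenspace (LieAlgebra.ad ℝ (LieAlg n) (translationGen ξ)) c

/-- The tangent vector `X · O ∈ T_O ℍⁿ⁺¹` of `X ∈ 𝔤`. -/
def tangentAt {n : ℕ} (X : LieAlg n) : Idx n → ℝ :=
  toMat X *ᵥ basePt n

/-- `u₁, …, uₙ ∈ 𝔫_ξ` is a frame of infinitesimal unit translations of the Euclidean space
`𝓗_ξ(1)` along the axes of Cartesian coordinates `x₁, …, xₙ` centred at `O`. -/
def IsHorosphericalFrame {n : ℕ} (ξ : Idx n → ℝ) (u : Fin n → LieAlg n) : Prop :=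
  (∀ i, u i ∈ rootSpace ξ 2) ∧
  ∀ i j, lorentz (tangentAt (u i)) (tangentAt (u j)) = if i = j then 1 else 0

/-- The coframe `X ↦ (u₁*(X), …, uₙ*(X))`, where `uᵢ*(X) = ⟨X·O, uᵢ·O⟩`. When `u` is a
horospherical frame, `uᵢ*` is the dual basis on `𝔫_ξ`, extended by zero to `𝔨 ⊕ 𝔞_ξ`. -/
noncomputable def coframe {n : ℕ} (u : Fin n → LieAlg n) : LieAlg n →L[ℝ] (Fin n → ℝ) :=
  LinearMap.toContinuousLinearMap
    { toFun := fun X i => lorentz (tangentAt X) (tangentAt (u i))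
      map_add' := fun X Y => by
        ext i
        simp [lorentz, tangentAt, Matrix.add_mulVec, add_dotProduct]
      map_smul' := fun c X => by
        ext i
        simp [lorentz, tangentAt, Matrix.smul_mulVec, smul_dotProduct] }

/-- The determinant, as a continuous alternating map in the rows. -/
noncomputable def detForm (n : ℕ) : (Fin n → ℝ) [⋀^Fin n]→L[ℝ] ℝ :=
  { Matrix.detRowAlternating (n := Fin n) (R := ℝ) with
    cont := by
      change Continuous fun M : Matrix (Fin n) (Fin n) ℝ => M.det
      exact continuous_id.matrix_det }

/-- `u₁* ∧ ⋯ ∧ uₙ*`. -/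
noncomputable def volForm {n : ℕ} (u : Fin n → LieAlg n) : LieAlg n [⋀^Fin n]→L[ℝ] ℝ :=
  (detForm n).compContinuousLinearMap (coframe u)

/-- The Iwasawa decomposition `g = n a k` with `n = exp X`, `X ∈ 𝔫_ξ`, `a = exp (τ T_ξ)` and
`k ∈ K`, as the triple `(X, τ, k)`; it exists and is unique for every boundary point `ξ`. -/
noncomputable def iwasawa {n : ℕ} (ξ : Idx n → ℝ) (g : SOPlus n) : LieAlg n × ℝ × SOPlus n :=
  Classical.epsilon fun p => p.1 ∈ rootSpace ξ 2 ∧ p.2.2 ∈ maxCompact n ∧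
    g = expG p.1 * expG (p.2.1 • translationGen ξ) * p.2.2

/-! ### Vector valued forms as functions on `G` -/

section Forms

variable {n : ℕ} {V : Type*} [NormedAddCommGroup V] [NormedSpace ℝ V] [FiniteDimensional ℝ V]

/-- The action `Ad*_𝔤(k⁻¹) ⊗ ρ(k⁻¹)` on `Hom(Λᵐ𝔤, V)`: the form
`(X₁, …, Xₘ) ↦ ρ(k⁻¹) (w (Ad(k) X₁, …, Ad(k) Xₘ))`. -/
noncomputable def twist {m : ℕ} (ρ : Representation ℝ (SOPlus n) V) (k : SOPlus n)
    (w : LieAlg n [⋀^Fin m]→L[ℝ] V) : LieAlg n [⋀^Fin m]→L[ℝ] V :=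
  (LinearMap.toContinuousLinearMap (ρ k⁻¹)).compContinuousAlternatingMap
    (w.compContinuousLinearMap (LinearMap.toContinuousLinearMap (Ad n k)))

/-- The degree `s` extension `φ_{ξ,s} : G → Hom(Λⁿ𝔤, V)` of the form with initial value
`φ_ξ(1) = (u₁* ∧ ⋯ ∧ uₙ*) ⊗ v`: for `g = n a k ∈ N_ξ A_ξ K`,
`φ_{ξ,s}(g) = t_aˢ · Ad*(k⁻¹) ⊗ ρ(k⁻¹) (φ_ξ(1))`, where `t_a = e^τ` for `a = exp (τ T_ξ)`. -/
noncomputable def phi (ρ : Representation ℝ (SOPlus n) V) (ξ : Idx n → ℝ) (u : Fin n → LieAlg n)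
    (v : V) (s : ℝ) (g : SOPlus n) : LieAlg n [⋀^Fin n]→L[ℝ] V :=
  (Real.exp (iwasawa ξ g).2.1) ^ s •
    twist ρ (iwasawa ξ g).2.2
      ((ContinuousLinearMap.toSpanSingleton ℝ v).compContinuousAlternatingMap (volForm u))

/-- The set `Γ_ξ \ Γ` of cosets `Γ_ξ γ`. -/
abbrev Cosets (Γ : Subgroup (SOPlus n)) (ξ : Idx n → ℝ) : Type :=
  Quotient (QuotientGroup.rightRel ((parabolicSubgroup ξ).subgroupOf Γ))

/-- The term `φ_{ξ,s}(γ g)` of the Eisenstein series, for a representative `γ` of the coset `q`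
(it does not depend on the representative when `φ_{ξ,s}` is left `Γ_ξ`-invariant). -/
noncomputable def eisensteinTerm (Γ : Subgroup (SOPlus n)) (ρ : Representation ℝ (SOPlus n) V)
    (ξ : Idx n → ℝ) (u : Fin n → LieAlg n) (v : V) (s : ℝ) (g : SOPlus n) (q : Cosets Γ ξ) :
    LieAlg n [⋀^Fin n]→L[ℝ] V :=
  phi ρ ξ u v s ((q.out : Γ) * g)

/-- The Eisenstein series `E(φ_ξ, g, s) = ∑_{γ ∈ Γ_ξ \ Γ} φ_{ξ,s}(γ g)`. -/
noncomputable def eisenstein (Γ : Subgroup (SOPlus n)) (ρ : Representation ℝ (SOPlus n) V)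
    (ξ : Idx n → ℝ) (u : Fin n → LieAlg n) (v : V) (s : ℝ) (g : SOPlus n) :
    LieAlg n [⋀^Fin n]→L[ℝ] V :=
  ∑' q : Cosets Γ ξ, eisensteinTerm Γ ρ ξ u v s g q

/-- `f : G → Hom(Λᵐ𝔤, V)` represents a smooth `Γ`-invariant `V`-valued `m`-form on
`ℍⁿ⁺¹ = G / K`: it is smooth, left `Γ`-invariant, right `K`-equivariant and horizontal. -/
structure IsInvariantForm {m : ℕ} (Γ : Subgroup (SOPlus n)) (ρ : Representation ℝ (SOPlus n) V)
    (f : SOPlus n → LieAlg n [⋀^Fin m]→L[ℝ] V) : Prop where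
  smooth : ∀ g, ContDiff ℝ ∞ fun X : LieAlg n => f (g * expG X)
  left_inv : ∀ γ ∈ Γ, ∀ g, f (γ * g) = f g
  right_equiv : ∀ k ∈ maxCompact n, ∀ g, f (g * k) = twist ρ k (f g)
  horizontal : ∀ g X, (∃ i, tangentAt (X i) = 0) → f g X = 0

/-- Derivative of `f` at `g` along the left-invariant vector field of `X ∈ 𝔤`. -/
noncomputable def leftDeriv {W : Type*} [NormedAddCommGroup W] [NormedSpace ℝ W]
    (X : LieAlg n) (f : SOPlus n → W) (g : SOPlus n) : W :=
  deriv (fun t : ℝ => f (g * expG (t • X))) 0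

/-- The derived action of `X ∈ 𝔤` on `V`. -/
noncomputable def derivedAction (ρ : Representation ℝ (SOPlus n) V) (X : LieAlg n) (w : V) : V :=
  deriv (fun t : ℝ => ρ (expG (t • X)) w) 0

/-- The bracket part of the coboundary operator, `∑_{i<j} (-1)^{i+j} w([Xᵢ,Xⱼ], …, X̂ᵢ, …, X̂ⱼ, …)`.
Pairs `i < j` are indexed as `(i.castSucc, j.succ)` with `i ≤ j`, whence the minus sign. -/
noncomputable def bracketPart :
    {m : ℕ} → (LieAlg n [⋀^Fin m]→L[ℝ] V) → (Fin (m + 1) → LieAlg n) → V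
  | 0, _, _ => 0
  | m + 1, w, X => -∑ i : Fin (m + 1), ∑ j ≥ i, (-1 : ℝ) ^ (i + j : ℕ) •
      w (Matrix.vecCons ⁅X i.castSucc, X j.succ⁆ (j.removeNth (i.castSucc.removeNth X)))

/-- The coboundary operator on functions `G → Hom(Λᵐ𝔤, V)`,
`df(X₀, …, Xₘ) = ∑ᵢ (-1)ⁱ (Xᵢ + ρ(Xᵢ)) f(…, X̂ᵢ, …) + ∑_{i<j} (-1)^{i+j} f([Xᵢ,Xⱼ], …, X̂ᵢ, …, X̂ⱼ, …)`,
which corresponds to the exterior derivative of `V`-valued forms on `ℍⁿ⁺¹`. -/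
noncomputable def coboundary {m : ℕ} (ρ : Representation ℝ (SOPlus n) V)
    (f : SOPlus n → LieAlg n [⋀^Fin m]→L[ℝ] V) (g : SOPlus n) (X : Fin (m + 1) → LieAlg n) : V :=
  ∑ i : Fin (m + 1), (-1 : ℝ) ^ (i : ℕ) •
      (leftDeriv (X i) (fun h => f h (i.removeNth X)) g +
        derivedAction ρ (X i) (f g (i.removeNth X))) +
    bracketPart (f g) X

/-- The Eisenstein series `E(φ_ξ, ·, s)` is an absolutely convergent closed form. -/
structure IsAbsConvClosedForm (Γ : Subgroup (SOPlus n)) (ρ : Representation ℝ (SOPlus n) V)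
    (ξ : Idx n → ℝ) (u : Fin n → LieAlg n) (v : V) (s : ℝ) : Prop where
  abs_conv : ∀ g, Summable fun q : Cosets Γ ξ => ‖eisensteinTerm Γ ρ ξ u v s g q‖
  form : IsInvariantForm Γ ρ (eisenstein Γ ρ ξ u v s)
  closed : ∀ g X, coboundary ρ (eisenstein Γ ρ ξ u v s) g X = 0

end Forms

end HypEis

/-!
Everything is explicit in Lorentz geometry: `G` acts on `ℝ^{n+1,1}`, and `ξ` is a null vector.

**Closedness of one term.** In the half space model with `ξ` at infinity, coordinates `x ∈ ℝⁿ` and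
height `y`, the form attached to `φ_{ξ,s}` is `y^{s/2 - n} ρ(n a) v ⊗ dx₁ ∧ ⋯ ∧ dxₙ`, where `n a`
in `N_ξ A_ξ` moves `O` to the point `(x, y)` and `a` has `t_a = y^{1/2}`. If `A_ξ` acts on `v` with
weight `2n - s`, as it does for `v ∈ 𝔤₋₂` and `s = 2n + 2`, and for the trivial representation and
`s = 2n`, the height drops out: what remains is `ρ(exp (∑ xᵢ uᵢ)) v ⊗ dx₁ ∧ ⋯ ∧ dxₙ`, the pullback
of a form of top degree on `ℝⁿ`, hence closed (`extDeriv_pullForm`). The coordinates `xᵢ` are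
rational in the matrix entries of `g` (`horoCoord`), so that this form lives on an open set of
operators (`extPhi`, `IsIwasawa.extPhi_eq`). There Mathlib's exterior derivative is available, and
its formula on left-invariant vector fields yields the coboundary operator on functions on `G`
(`coboundary_of_extDeriv_eq_zero`).

**Convergence.** If `γ = n a k`, then `φ(γ g) = t_a^s φ(k g)`, with `k` in a compact set; so the
series, with all its derivatives, is dominated by `∑ t_a^s` (`contDiffAt_tsum_of_isCompact`,
`IsAdapted.isAbsConvClosedForm`). Here `t_a^{-2} = β` for `β = -⟨γ O, ξ⟩`. On the orbit, `β` is
bounded below: at small `β` a parabolic element of `Γ_ξ` would move an orbit point by an amount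
that discreteness forbids (`exists_height_bound`). Together with cocompactness on the horosphere
this provides each coset `Γ_ξ γ` with a representative `γ` such that `cosh d(O, γ O) ≤ C β`
(`exists_time_le`), and `∑ t_a^s` is dominated by the Poincaré series with exponent `s / 2`
(`summable_height_rpow`). For the adjoint representation the exponent is `n + 1`, and the series of
every discrete group converges above `n` by a packing argument (`summable_time_rpow`). For the
trivial representation it is `n`, where convergence is the hypothesis on `Γ`. In that case the
invariance of `φ` under `Γ_ξ` holds because `Γ_ξ` fixes the vector `ξ` and not just its ray, so that
it acts on horospheres by orientation preserving Euclidean isometries (`phi_trivial_mul_left`).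
-/

namespace HypEis

/-! ### The Lorentz form -/

section Lorentz

variable {n : ℕ}

theorem lorentz_eq (x y : Idx n → ℝ) : lorentz x y =
    ∑ i, x (Sum.inl i) * y (Sum.inl i) - x (Sum.inr ()) * y (Sum.inr ()) := by
  unfold lorentz J LieAlgebra.Orthogonal.indefiniteDiagonal
  simp [dotProduct, Matrix.mulVec_diagonal, Fintype.sum_sum_type, sub_eq_add_neg]

theorem lorentz_comm (x y : Idx n → ℝ) : lorentz x y = lorentz y x := by
  simp only [lorentz_eq, mul_comm]

theorem lorentz_add_left (x y z : Idx n → ℝ) :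
    lorentz (x + y) z = lorentz x z + lorentz y z := by
  simp [lorentz, add_dotProduct]

theorem lorentz_smul_left (c : ℝ) (x z : Idx n → ℝ) : lorentz (c • x) z = c * lorentz x z := by
  simp [lorentz, smul_dotProduct]

theorem lorentz_add_right (x y z : Idx n → ℝ) :
    lorentz x (y + z) = lorentz x y + lorentz x z := by
  simp only [lorentz_comm x, lorentz_add_left]

theorem lorentz_smul_right (c : ℝ) (x z : Idx n → ℝ) : lorentz x (c • z) = c * lorentz x z := by
  simp only [lorentz_comm x, lorentz_smul_left]

theorem lorentz_neg_left (x z : Idx n → ℝ) : lorentz (-x) z = -lorentz x z := by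
  simp [lorentz]

theorem lorentz_neg_right (x z : Idx n → ℝ) : lorentz x (-z) = -lorentz x z := by
  simp only [lorentz_comm x, lorentz_neg_left]

theorem lorentz_sub_left (x y z : Idx n → ℝ) :
    lorentz (x - y) z = lorentz x z - lorentz y z := by
  simp [lorentz, sub_dotProduct]

theorem lorentz_sub_right (x y z : Idx n → ℝ) :
    lorentz x (y - z) = lorentz x y - lorentz x z := by
  simp only [lorentz_comm x, lorentz_sub_left]

theorem lorentz_sum_left {ι : Type*} (s : Finset ι) (f : ι → Idx n → ℝ) (z : Idx n → ℝ) :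
    lorentz (∑ i ∈ s, f i) z = ∑ i ∈ s, lorentz (f i) z := by
  simp [lorentz, sum_dotProduct]

theorem lorentz_zero_left (z : Idx n → ℝ) : lorentz 0 z = 0 := by simp [lorentz]

theorem lorentz_zero_right (z : Idx n → ℝ) : lorentz z 0 = 0 := by simp [lorentz]

theorem lorentz_nondegenerate {x : Idx n → ℝ} (h : ∀ y, lorentz x y = 0) : x = 0 := by
  have h1 : ∀ i, x (Sum.inl i) = 0 := fun i => by
    have := h (Pi.single (Sum.inl i) 1)
    simpa [lorentz_eq, Pi.single_apply] using this
  have h2 : x (Sum.inr ()) = 0 := by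
    have := h (Pi.single (Sum.inr ()) 1)
    simpa [lorentz_eq, Pi.single_apply] using this
  ext (i | i)
  · exact h1 i
  · exact h2

theorem continuous_lorentz {X : Type*} [TopologicalSpace X] {f g : X → Idx n → ℝ}
    (hf : Continuous f) (hg : Continuous g) : Continuous fun x => lorentz (f x) (g x) := by
  unfold lorentz
  exact hf.dotProduct ((continuous_const).matrix_mulVec hg)

theorem lorentz_basePt (x : Idx n → ℝ) : lorentz x (basePt n) = -x (Sum.inr ()) := by
  simp [lorentz_eq, basePt]

theorem basePt_lorentz (x : Idx n → ℝ) : lorentz (basePt n) x = -x (Sum.inr ()) := by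
  rw [lorentz_comm, lorentz_basePt]

theorem basePt_mem : basePt n ∈ hyperboloid n := by
  refine ⟨?_, ?_⟩
  · rw [lorentz_basePt]; simp [basePt]
  · simp [basePt]

theorem lorentz_mulVec_mulVec {A : Matrix (Idx n) (Idx n) ℝ} (hA : Aᵀ * J n * A = J n)
    (x y : Idx n → ℝ) : lorentz (A *ᵥ x) (A *ᵥ y) = lorentz x y := by
  have h := lorentz_mulVec hA (x + y)
  rw [Matrix.mulVec_add] at h
  simp only [lorentz_add_left, lorentz_add_right, lorentz_mulVec hA] at h
  rw [lorentz_comm (A *ᵥ y) (A *ᵥ x), lorentz_comm y x] at h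
  linarith

theorem mat_isom (g : SOPlus n) : (mat g)ᵀ * J n * mat g = J n := g.2.1

theorem mat_mul (g h : SOPlus n) : mat (g * h) = mat g * mat h := rfl

theorem mat_one : mat (1 : SOPlus n) = 1 := rfl

theorem mat_inv_mul (g : SOPlus n) : mat g⁻¹ * mat g = 1 := by
  rw [← mat_mul, inv_mul_cancel, mat_one]

theorem mat_injective : Function.Injective (mat (n := n)) := fun _ _ h =>
  Subtype.ext (Units.ext h)

theorem mat_inv_mulVec_mulVec (g : SOPlus n) (x : Idx n → ℝ) : mat g⁻¹ *ᵥ (mat g *ᵥ x) = x := by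
  rw [Matrix.mulVec_mulVec, mat_inv_mul, Matrix.one_mulVec]

theorem mat_mulVec_inv_mulVec (g : SOPlus n) (x : Idx n → ℝ) : mat g *ᵥ (mat g⁻¹ *ᵥ x) = x := by
  rw [Matrix.mulVec_mulVec, mat_mul_inv, Matrix.one_mulVec]

theorem lorentz_mat (g : SOPlus n) (x y : Idx n → ℝ) :
    lorentz (mat g *ᵥ x) (mat g *ᵥ y) = lorentz x y := lorentz_mulVec_mulVec (mat_isom g) x y

theorem lorentz_mat_left (g : SOPlus n) (x y : Idx n → ℝ) :
    lorentz (mat g *ᵥ x) y = lorentz x (mat g⁻¹ *ᵥ y) := by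
  rw [← lorentz_mat g x, mat_mulVec_inv_mulVec]

theorem J_mul_J : J n * J n = 1 := by
  unfold J LieAlgebra.Orthogonal.indefiniteDiagonal
  rw [Matrix.diagonal_mul_diagonal, ← Matrix.diagonal_one]
  congr 1
  ext i
  cases i <;> simp

theorem mat_inv (g : SOPlus n) : mat g⁻¹ = J n * (mat g)ᵀ * J n := by
  have h := congrArg (fun M => J n * M * mat g⁻¹) (mat_isom g)
  simp only [Matrix.mul_assoc, mat_mul_inv] at h
  rw [← Matrix.mul_assoc (J n) (J n), J_mul_J, Matrix.one_mul, Matrix.mul_one] at h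
  rw [← h, Matrix.mul_assoc]

theorem lorentz_toMat (X : LieAlg n) (x y : Idx n → ℝ) :
    lorentz (toMat X *ᵥ x) y = -lorentz x (toMat X *ᵥ y) := by
  unfold lorentz
  have h := toMat_skew X
  rw [← Matrix.vecMul_transpose, ← Matrix.dotProduct_mulVec, Matrix.mulVec_mulVec, h,
    ← Matrix.mulVec_mulVec, Matrix.neg_mulVec, Matrix.mulVec_neg, dotProduct_neg]

theorem mat_mem_hyperboloid (g : SOPlus n) {x : Idx n → ℝ} (hx : x ∈ hyperboloid n) :
    mat g *ᵥ x ∈ hyperboloid n := (g.2.2.2 x).2 hx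

/-- The time coordinate of `g · O`, that is, `cosh d(O, g O)`. -/
theorem mat_basePt_time (g : SOPlus n) :
    (mat g *ᵥ basePt n) (Sum.inr ()) = mat g (Sum.inr ()) (Sum.inr ()) := by
  simp [Matrix.mulVec, dotProduct, basePt]

theorem sum_mul_le {ι : Type*} (s : Finset ι) (f g : ι → ℝ) {a b : ℝ} (ha : 0 ≤ a) (hb : 0 ≤ b)
    (hf : ∑ i ∈ s, f i * f i ≤ a ^ 2) (hg : ∑ i ∈ s, g i * g i ≤ b ^ 2) :
    |∑ i ∈ s, f i * g i| ≤ a * b := by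
  refine abs_le_of_sq_le_sq ?_ (mul_nonneg ha hb)
  calc (∑ i ∈ s, f i * g i) ^ 2 ≤ (∑ i ∈ s, f i ^ 2) * ∑ i ∈ s, g i ^ 2 :=
        Finset.sum_mul_sq_le_sq_mul_sq s f g
    _ ≤ a ^ 2 * b ^ 2 := by
        simp only [pow_two] at *
        exact mul_le_mul hf hg (Finset.sum_nonneg fun i _ => mul_self_nonneg _) (by positivity)
    _ = (a * b) ^ 2 := by ring

theorem sum_sq_of_mem_hyperboloid {x : Idx n → ℝ} (hx : x ∈ hyperboloid n) :
    ∑ i, x (Sum.inl i) * x (Sum.inl i) = x (Sum.inr ()) ^ 2 - 1 := by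
  have := hx.1
  rw [lorentz_eq] at this
  linarith

theorem one_le_time {x : Idx n → ℝ} (hx : x ∈ hyperboloid n) : 1 ≤ x (Sum.inr ()) := by
  have h := sum_sq_of_mem_hyperboloid hx
  have h1 : 0 ≤ ∑ i, x (Sum.inl i) * x (Sum.inl i) :=
    Finset.sum_nonneg fun i _ => mul_self_nonneg _
  have h2 := hx.2
  nlinarith

theorem sum_sq_of_mem_boundary {ξ : Idx n → ℝ} (hξ : ξ ∈ boundary n) :
    ∑ i, ξ (Sum.inl i) * ξ (Sum.inl i) = 1 := by
  have := hξ.1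
  rw [lorentz_eq, hξ.2] at this
  linarith

theorem basePt_lorentz_boundary {ξ : Idx n → ℝ} (hξ : ξ ∈ boundary n) :
    lorentz (basePt n) ξ = -1 := by
  rw [basePt_lorentz, hξ.2]

theorem lorentz_boundary_neg {x ξ : Idx n → ℝ} (hx : x ∈ hyperboloid n) (hξ : ξ ∈ boundary n) :
    lorentz x ξ < 0 := by
  have h1 := sum_sq_of_mem_hyperboloid hx
  have h2 := sum_sq_of_mem_boundary hξ
  have h3 := one_le_time hx
  have h4 := sum_mul_le Finset.univ (fun i => x (Sum.inl i)) (fun i => ξ (Sum.inl i))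
    (Real.sqrt_nonneg (x (Sum.inr ()) ^ 2 - 1)) zero_le_one
    (by rw [h1, Real.sq_sqrt (by nlinarith)]) (by rw [h2]; norm_num)
  have h5 : Real.sqrt (x (Sum.inr ()) ^ 2 - 1) < x (Sum.inr ()) := by
    rw [Real.sqrt_lt' (by linarith)]
    linarith
  rw [lorentz_eq, hξ.2]
  have := (abs_le.1 h4).2
  linarith

theorem linearIndependent_frame {ξ : Idx n → ℝ} (hξ : ξ ∈ boundary n) {e : Fin n → Idx n → ℝ}
    (he : ∀ i j, lorentz (e i) (e j) = if i = j then 1 else 0)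
    (heO : ∀ i, lorentz (e i) (basePt n) = 0) (heξ : ∀ i, lorentz (e i) ξ = 0) :
    LinearIndependent ℝ (Sum.elim e ![basePt n, ξ]) := by
  have hOξ := basePt_lorentz_boundary hξ
  have hOO : lorentz (basePt n) (basePt n) = -1 := basePt_mem.1
  have hξO : lorentz ξ (basePt n) = -1 := by rw [lorentz_comm, hOξ]
  rw [Fintype.linearIndependent_iff]
  intro c hc
  have h (z : Idx n → ℝ) : ∑ i, c (Sum.inl i) * lorentz (e i) z +
      (c (Sum.inr 0) * lorentz (basePt n) z + c (Sum.inr 1) * lorentz ξ z) = 0 := by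
    have := congrArg (fun v => lorentz v z) hc
    simpa [Fintype.sum_sum_type, lorentz_add_left, lorentz_sum_left, lorentz_smul_left,
      lorentz_zero_left] using this
  have h0 := h ξ
  simp only [heξ, hOξ, hξ.1] at h0
  have h1 := h (basePt n)
  simp only [heO, hOO, hξO] at h1
  have c0 : c (Sum.inr 0) = 0 := by simpa using h0
  have c1 : c (Sum.inr 1) = 0 := by simpa [c0] using h1
  rintro (i | i)
  · have h2 := h (e i)
    simpa [he, lorentz_comm _ (e i), heO, heξ] using h2
  · fin_cases i
    · exact c0
    · exact c1

/-- If `e₁, …, eₙ` are orthonormal and orthogonal to `O` and `ξ`, the vectors orthogonal to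
`e₁, …, eₙ` and `ξ` are the multiples of `ξ`. -/
theorem eq_smul_of_orthogonal {ξ : Idx n → ℝ} (hξ : ξ ∈ boundary n) {e : Fin n → Idx n → ℝ}
    (he : ∀ i j, lorentz (e i) (e j) = if i = j then 1 else 0)
    (heO : ∀ i, lorentz (e i) (basePt n) = 0) (heξ : ∀ i, lorentz (e i) ξ = 0)
    {w : Idx n → ℝ} (hw : ∀ i, lorentz w (e i) = 0) (hwξ : lorentz w ξ = 0) :
    w = w (Sum.inr ()) • ξ := by
  let b : Fin n ⊕ Fin 2 → Idx n → ℝ := Sum.elim e ![basePt n, ξ]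
  have hb : LinearIndependent ℝ b := linearIndependent_frame hξ he heO heξ
  have hcard : Fintype.card (Fin n ⊕ Fin 2) = Module.finrank ℝ (Idx n → ℝ) := by simp
  have hspan := hb.span_eq_top_of_card_eq_finrank' hcard
  have hz : w - w (Sum.inr ()) • ξ = 0 := by
    refine lorentz_nondegenerate fun y => ?_
    have hy : y ∈ Submodule.span ℝ (Set.range b) := by rw [hspan]; trivial
    induction hy using Submodule.span_induction with
    | mem y hy =>
      obtain ⟨i, rfl⟩ := hy
      rcases i with i | i
      · simp [b, lorentz_sub_left, hw, lorentz_smul_left, lorentz_comm ξ, heξ]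
      · fin_cases i
        · simp [b, lorentz_basePt, hξ.2]
        · simp [b, lorentz_sub_left, lorentz_smul_left, hξ.1, hwξ]
    | zero => exact lorentz_zero_right _
    | add x y _ _ hx hy => rw [lorentz_add_right, hx, hy, add_zero]
    | smul c x _ hx => rw [lorentz_smul_right, hx, mul_zero]
  exact sub_eq_zero.1 hz

end Lorentz

/-! ### Matrix exponentials on vectors -/

section Exponential

attribute [local instance] Matrix.linftyOpNormedRing Matrix.linftyOpNormedAlgebra

variable {n : ℕ}

theorem hasSum_exp_mulVec (X : Matrix (Idx n) (Idx n) ℝ) (w : Idx n → ℝ) :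
    HasSum (fun k : ℕ => ((k.factorial : ℝ)⁻¹) • ((X ^ k) *ᵥ w)) (NormedSpace.exp X *ᵥ w) := by
  have h := NormedSpace.exp_series_hasSum_exp' (𝕂 := ℝ) X
  have hc : Continuous fun M : Matrix (Idx n) (Idx n) ℝ => M *ᵥ w :=
    continuous_id.matrix_mulVec continuous_const
  have := h.map (⟨⟨fun M : Matrix (Idx n) (Idx n) ℝ => M *ᵥ w, Matrix.zero_mulVec w⟩,
    fun A B => Matrix.add_mulVec A B w⟩ : Matrix (Idx n) (Idx n) ℝ →+ (Idx n → ℝ)) hc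
  convert this using 1
  · funext k
    exact (Matrix.smul_mulVec _ _ _).symm
  · rfl

theorem exp_mulVec_eigenvector {X : Matrix (Idx n) (Idx n) ℝ} {w : Idx n → ℝ} {c : ℝ}
    (h : X *ᵥ w = c • w) : NormedSpace.exp X *ᵥ w = Real.exp c • w := by
  have hk : ∀ k : ℕ, (X ^ k) *ᵥ w = c ^ k • w := fun k => by
    induction k with
    | zero => simp
    | succ k ih => rw [pow_succ', ← Matrix.mulVec_mulVec, ih, Matrix.mulVec_smul, h, smul_smul,
        pow_succ]
  refine (hasSum_exp_mulVec X w).unique ?_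
  simp only [hk, smul_smul]
  rw [Real.exp_eq_exp_ℝ]
  exact (NormedSpace.exp_series_hasSum_exp' (𝕂 := ℝ) c).smul_const w

theorem exp_mulVec_of_sq_eq_zero {X : Matrix (Idx n) (Idx n) ℝ} {w : Idx n → ℝ}
    (h : X *ᵥ (X *ᵥ w) = 0) : NormedSpace.exp X *ᵥ w = w + X *ᵥ w := by
  have hk : ∀ k : ℕ, (X ^ (k + 2)) *ᵥ w = 0 := fun k => by
    rw [pow_add, pow_two, ← Matrix.mulVec_mulVec, ← Matrix.mulVec_mulVec, h, Matrix.mulVec_zero]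
  refine (hasSum_exp_mulVec X w).unique ?_
  have := hasSum_sum_of_ne_finset_zero (L := .unconditional ℕ) (s := Finset.range 2)
    (f := fun k : ℕ => ((k.factorial : ℝ)⁻¹) • ((X ^ k) *ᵥ w)) fun k hk' => by
      obtain ⟨j, rfl⟩ : ∃ j, k = j + 2 := ⟨k - 2, by simp at hk'; omega⟩
      rw [hk, smul_zero]
  simpa [Finset.sum_range_succ] using this

theorem mat_expG (X : LieAlg n) : mat (expG X) = NormedSpace.exp (toMat X) := rfl

theorem mat_expG_inv (X : LieAlg n) : mat (expG X)⁻¹ = NormedSpace.exp (-toMat X) := rfl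

theorem expG_inv (X : LieAlg n) : (expG X)⁻¹ = expG (-X) := by
  apply mat_injective
  rw [mat_expG_inv, mat_expG, map_neg]

theorem toMat_bracket (X Y : LieAlg n) :
    toMat ⁅X, Y⁆ = toMat X * toMat Y - toMat Y * toMat X := rfl

theorem toMat_Ad (g : SOPlus n) (X : LieAlg n) :
    toMat (Ad n g X) = mat g * toMat X * mat g⁻¹ := rfl

theorem expG_zero : expG (0 : LieAlg n) = 1 := by
  apply mat_injective
  rw [mat_expG, map_zero, NormedSpace.exp_zero, mat_one]

/-- `v ∈ 𝔤_c` is scaled by `e^{cτ}` under `Ad (exp (τ T_ξ))`. -/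
theorem Ad_expG_translationGen {ξ : Idx n → ℝ} {c : ℝ} {v : LieAlg n} (hv : v ∈ rootSpace ξ c)
    (τ : ℝ) : Ad n (expG (τ • translationGen ξ)) v = Real.exp (c * τ) • v := by
  have h : ⁅translationGen ξ, v⁆ = c • v := Module.End.mem_eigenspace_iff.1 hv
  have h1 := congrArg toMat h
  rw [toMat_bracket, map_smul] at h1
  set T := toMat (translationGen ξ)
  apply toMat_injective
  rw [toMat_Ad, map_smul, mat_expG, mat_expG_inv, map_smul]
  have h2 : SemiconjBy (toMat v) (τ • T + (c * τ) • (1 : Matrix (Idx n) (Idx n) ℝ)) (τ • T) := by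
    change toMat v * (τ • T + (c * τ) • (1 : Matrix (Idx n) (Idx n) ℝ)) = τ • T * toMat v
    rw [Matrix.mul_add, Matrix.mul_smul, Matrix.mul_smul, Matrix.mul_one, Matrix.smul_mul,
      mul_comm c, mul_smul, ← h1, smul_sub]
    abel
  have h3 := (SemiconjBy.exp_right h2).eq
  have h5 : NormedSpace.exp (τ • T) * toMat v =
      toMat v * NormedSpace.exp (τ • T + (c * τ) • (1 : Matrix (Idx n) (Idx n) ℝ)) := h3.symm
  rw [h5, Matrix.exp_add_of_commute]
  · have h4 : NormedSpace.exp ((c * τ) • (1 : Matrix (Idx n) (Idx n) ℝ)) =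
        Real.exp (c * τ) • (1 : Matrix (Idx n) (Idx n) ℝ) := by
      rw [Real.exp_eq_exp_ℝ, ← Algebra.algebraMap_eq_smul_one, ← Algebra.algebraMap_eq_smul_one]
      exact (NormedSpace.algebraMap_exp_comm _).symm
    rw [h4, Matrix.mul_smul, Matrix.mul_one, Matrix.mul_smul, Matrix.smul_mul, Matrix.mul_assoc,
      exp_mul_exp_neg, Matrix.mul_one]
  · exact (Commute.one_right _).smul_right _

end Exponential

/-! ### Root spaces and the Iwasawa decomposition -/

section Iwasawa

variable {n : ℕ}

theorem translationGen_mulVec (ξ w : Idx n → ℝ) (hξ : ξ ∈ boundary n) :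
    toMat (translationGen ξ) *ᵥ w =
      (2 : ℝ) • (lorentz w ξ • basePt n - lorentz w (basePt n) • ξ) := by
  have h : toMat (translationGen ξ) = (2 : ℝ) •
    Matrix.fromBlocks 0 (Matrix.replicateCol Unit fun i => ξ (Sum.inl i))
      (Matrix.replicateRow Unit fun i => ξ (Sum.inl i)) 0 := rfl
  rw [h, Matrix.smul_mulVec]
  congr 1
  ext (i | i)
  · simp [Matrix.mulVec, dotProduct, Matrix.fromBlocks, Fintype.sum_sum_type, lorentz_basePt w,
      mul_comm]
    simp [basePt]
  · simp [Matrix.mulVec, dotProduct, Matrix.fromBlocks, Fintype.sum_sum_type, lorentz_eq,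
      basePt, hξ.2, mul_comm]

theorem translationGen_mulVec_self {ξ : Idx n → ℝ} (hξ : ξ ∈ boundary n) :
    toMat (translationGen ξ) *ᵥ ξ = (2 : ℝ) • ξ := by
  rw [translationGen_mulVec _ _ hξ, hξ.1, lorentz_comm, basePt_lorentz_boundary hξ]
  simp

theorem rootSpace_mulVec {ξ : Idx n → ℝ} {X : LieAlg n} {c : ℝ} (hX : X ∈ rootSpace ξ c)
    (w : Idx n → ℝ) : toMat (translationGen ξ) *ᵥ (toMat X *ᵥ w) =
      toMat X *ᵥ (toMat (translationGen ξ) *ᵥ w) + c • (toMat X *ᵥ w) := by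
  have h : ⁅translationGen ξ, X⁆ = c • X := Module.End.mem_eigenspace_iff.1 hX
  have h1 := congrArg (fun Y => toMat Y *ᵥ w) h
  simp only [toMat_bracket, map_smul, Matrix.sub_mulVec, ← Matrix.mulVec_mulVec,
    Matrix.smul_mulVec] at h1
  rw [← h1]
  abel

theorem lorentz_toMat_self (X : LieAlg n) (w : Idx n → ℝ) : lorentz (toMat X *ᵥ w) w = 0 := by
  have := lorentz_toMat X w w
  rw [lorentz_comm w] at this
  linarith

theorem rootSpace_two_mulVec_self {ξ : Idx n → ℝ} (hξ : ξ ∈ boundary n) {X : LieAlg n}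
    (hX : X ∈ rootSpace ξ 2) : toMat X *ᵥ ξ = 0 := by
  have h := rootSpace_mulVec hX ξ
  rw [translationGen_mulVec_self hξ, translationGen_mulVec _ _ hξ, lorentz_toMat_self,
    Matrix.mulVec_smul, zero_smul, zero_sub] at h
  have h1 := congrArg (fun z => lorentz z (basePt n)) h
  simp only [lorentz_smul_left, lorentz_neg_left, lorentz_add_left, lorentz_comm ξ,
    basePt_lorentz_boundary hξ] at h1
  have h2 : lorentz (toMat X *ᵥ ξ) (basePt n) = 0 := by linarith
  rw [h2, zero_smul, neg_zero, smul_zero, ← add_smul] at h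
  have := h.symm
  rw [smul_eq_zero] at this
  rcases this with h | h
  · norm_num at h
  · exact h

theorem tangentAt_lorentz_basePt (X : LieAlg n) : lorentz (tangentAt X) (basePt n) = 0 :=
  lorentz_toMat_self X _

theorem tangentAt_lorentz_of_rootSpace {ξ : Idx n → ℝ} (hξ : ξ ∈ boundary n) {X : LieAlg n}
    (hX : X ∈ rootSpace ξ 2) : lorentz (tangentAt X) ξ = 0 := by
  rw [tangentAt, lorentz_toMat, rootSpace_two_mulVec_self hξ hX, lorentz_zero_right, neg_zero]

/-- `X ∈ 𝔫_ξ` maps the orthogonal complement of `O` and `ξ` to `ℝ ξ`. -/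
theorem rootSpace_two_mulVec {ξ : Idx n → ℝ} (hξ : ξ ∈ boundary n) {X : LieAlg n}
    (hX : X ∈ rootSpace ξ 2) {w : Idx n → ℝ} (hwO : lorentz w (basePt n) = 0)
    (hwξ : lorentz w ξ = 0) : toMat X *ᵥ w = lorentz w (tangentAt X) • ξ := by
  have h := rootSpace_mulVec hX w
  have h1 : toMat (translationGen ξ) *ᵥ w = 0 := by
    rw [translationGen_mulVec _ _ hξ, hwO, hwξ]; simp
  have h2 : lorentz (toMat X *ᵥ w) ξ = 0 := by
    rw [lorentz_toMat, rootSpace_two_mulVec_self hξ hX, lorentz_zero_right, neg_zero]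
  rw [h1, Matrix.mulVec_zero, zero_add, translationGen_mulVec _ _ hξ, h2, lorentz_toMat] at h
  have h3 := smul_right_injective (Idx n → ℝ) (two_ne_zero (α := ℝ)) h
  rw [← h3]
  simp [tangentAt]

theorem rootSpace_two_ext {ξ : Idx n → ℝ} (hξ : ξ ∈ boundary n) {X : LieAlg n}
    (hX : X ∈ rootSpace ξ 2) (h : tangentAt X = 0) : X = 0 := by
  apply toMat_injective
  rw [map_zero]
  refine Matrix.ext_of_mulVec_single fun j => ?_
  generalize (Pi.single j 1 : Idx n → ℝ) = w
  have hO : lorentz (basePt n) (basePt n) = -1 := basePt_mem.1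
  have hξO : lorentz ξ (basePt n) = -1 := by rw [lorentz_comm, basePt_lorentz_boundary hξ]
  have h1 := rootSpace_two_mulVec hξ hX
    (w := w + lorentz w ξ • basePt n + (lorentz w (basePt n) - lorentz w ξ) • ξ)
    (by simp only [lorentz_add_left, lorentz_smul_left, hO, hξO]; ring)
    (by simp only [lorentz_add_left, lorentz_smul_left, basePt_lorentz_boundary hξ, hξ.1]; ring)
  rw [h, lorentz_zero_right, zero_smul, Matrix.mulVec_add, Matrix.mulVec_add, Matrix.mulVec_smul,
    Matrix.mulVec_smul, rootSpace_two_mulVec_self hξ hX] at h1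
  rw [tangentAt] at h
  rw [h] at h1
  simpa using h1

/-- A horospherical frame is a basis of `𝔫_ξ`, with coordinates given by the coframe. -/
theorem eq_sum_of_rootSpace {ξ : Idx n → ℝ} (hξ : ξ ∈ boundary n) {u : Fin n → LieAlg n}
    (hu : IsHorosphericalFrame ξ u) {X : LieAlg n} (hX : X ∈ rootSpace ξ 2) :
    X = ∑ i, lorentz (tangentAt X) (tangentAt (u i)) • u i := by
  have hT : ∀ y : Fin n → ℝ, tangentAt (∑ i, y i • u i) = ∑ i, y i • tangentAt (u i) := by
    intro y
    simp only [tangentAt, map_sum, map_smul, Matrix.sum_mulVec, Matrix.smul_mulVec]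
  rw [← sub_eq_zero]
  have hD : X - ∑ i, lorentz (tangentAt X) (tangentAt (u i)) • u i ∈ rootSpace ξ 2 :=
    Submodule.sub_mem _ hX (Submodule.sum_mem _ fun i _ => Submodule.smul_mem _ _ (hu.1 i))
  refine rootSpace_two_ext hξ hD ?_
  have h := eq_smul_of_orthogonal hξ hu.2 (fun i => tangentAt_lorentz_basePt _)
    (fun i => tangentAt_lorentz_of_rootSpace hξ (hu.1 i))
    (w := tangentAt (X - ∑ i, lorentz (tangentAt X) (tangentAt (u i)) • u i)) (fun j => ?_)
    (tangentAt_lorentz_of_rootSpace hξ hD)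
  · have h0 := tangentAt_lorentz_basePt
      (X - ∑ i, lorentz (tangentAt X) (tangentAt (u i)) • u i)
    rw [lorentz_basePt, neg_eq_zero] at h0
    rw [h, h0, zero_smul]
  · have : tangentAt (X - ∑ i, lorentz (tangentAt X) (tangentAt (u i)) • u i) =
        tangentAt X - ∑ i, lorentz (tangentAt X) (tangentAt (u i)) • tangentAt (u i) := by
      rw [← hT, tangentAt, map_sub, Matrix.sub_mulVec]; rfl
    rw [this, lorentz_sub_left, lorentz_sum_left]
    simp [lorentz_smul_left, hu.2]

/-- `(X, τ, k)` is an Iwasawa decomposition of `g`. -/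
def IsIwasawa (ξ : Idx n → ℝ) (g : SOPlus n) (p : LieAlg n × ℝ × SOPlus n) : Prop :=
  p.1 ∈ rootSpace ξ 2 ∧ p.2.2 ∈ maxCompact n ∧
    g = expG p.1 * expG (p.2.1 • translationGen ξ) * p.2.2

theorem maxCompact_lorentz {k : SOPlus n} (hk : k ∈ maxCompact n) (w : Idx n → ℝ) :
    lorentz (basePt n) (mat k⁻¹ *ᵥ w) = lorentz (basePt n) w := by
  have : mat k *ᵥ basePt n = basePt n := hk
  rw [← lorentz_mat_left, this]

theorem IsIwasawa.inv_mulVec_boundary {ξ : Idx n → ℝ} (hξ : ξ ∈ boundary n) {g : SOPlus n}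
    {p : LieAlg n × ℝ × SOPlus n} (h : IsIwasawa ξ g p) :
    mat g⁻¹ *ᵥ ξ = Real.exp (-2 * p.2.1) • (mat p.2.2⁻¹ *ᵥ ξ) := by
  obtain ⟨h1, -, h3⟩ := h
  rw [h3, mul_inv_rev, mul_inv_rev, mat_mul, mat_mul, ← Matrix.mulVec_mulVec,
    ← Matrix.mulVec_mulVec, mat_expG_inv, mat_expG_inv,
    exp_mulVec_eigenvector (X := -toMat p.1) (c := 0)
      (by rw [Matrix.neg_mulVec, rootSpace_two_mulVec_self hξ h1]; simp), Real.exp_zero, one_smul,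
    exp_mulVec_eigenvector (X := -toMat (p.2.1 • translationGen ξ)) (c := -2 * p.2.1)
      (by rw [Matrix.neg_mulVec, map_smul, Matrix.smul_mulVec, translationGen_mulVec_self hξ,
            smul_smul, ← neg_smul]; ring_nf), Matrix.mulVec_smul]

theorem IsIwasawa.lorentz_boundary {ξ : Idx n → ℝ} (hξ : ξ ∈ boundary n) {g : SOPlus n}
    {p : LieAlg n × ℝ × SOPlus n} (h : IsIwasawa ξ g p) :
    lorentz (mat g *ᵥ basePt n) ξ = -Real.exp (-2 * p.2.1) := by
  rw [lorentz_mat_left, h.inv_mulVec_boundary hξ, lorentz_smul_right, maxCompact_lorentz h.2.1,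
    basePt_lorentz_boundary hξ]
  ring

theorem IsIwasawa.inv_mulVec_frame {ξ : Idx n → ℝ} (hξ : ξ ∈ boundary n) {g : SOPlus n}
    {p : LieAlg n × ℝ × SOPlus n} (h : IsIwasawa ξ g p) {w : Idx n → ℝ}
    (hwO : lorentz w (basePt n) = 0) (hwξ : lorentz w ξ = 0) :
    mat g⁻¹ *ᵥ w = mat p.2.2⁻¹ *ᵥ
      (w - (lorentz w (tangentAt p.1) * Real.exp (-2 * p.2.1)) • ξ) := by
  obtain ⟨h1, -, h3⟩ := h
  have hX := rootSpace_two_mulVec hξ h1 hwO hwξ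
  rw [h3, mul_inv_rev, mul_inv_rev, mat_mul, mat_mul, ← Matrix.mulVec_mulVec,
    ← Matrix.mulVec_mulVec, mat_expG_inv, mat_expG_inv,
    exp_mulVec_of_sq_eq_zero (X := -toMat p.1)
      (by rw [Matrix.neg_mulVec, Matrix.neg_mulVec, hX, Matrix.mulVec_neg, Matrix.mulVec_smul,
            rootSpace_two_mulVec_self hξ h1]; simp),
    Matrix.neg_mulVec, hX, Matrix.mulVec_add,
    exp_mulVec_eigenvector (X := -toMat (p.2.1 • translationGen ξ)) (w := w) (c := 0)
      (by rw [Matrix.neg_mulVec, map_smul, Matrix.smul_mulVec, translationGen_mulVec _ _ hξ, hwO,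
            hwξ]; simp), Matrix.mulVec_neg, Matrix.mulVec_smul,
    exp_mulVec_eigenvector (X := -toMat (p.2.1 • translationGen ξ)) (c := -2 * p.2.1)
      (by rw [Matrix.neg_mulVec, map_smul, Matrix.smul_mulVec, translationGen_mulVec_self hξ,
            smul_smul, ← neg_smul]; ring_nf), Real.exp_zero, one_smul, smul_smul, sub_eq_add_neg]

theorem IsIwasawa.lorentz_frame {ξ : Idx n → ℝ} (hξ : ξ ∈ boundary n) {g : SOPlus n}
    {p : LieAlg n × ℝ × SOPlus n} (h : IsIwasawa ξ g p) {w : Idx n → ℝ}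
    (hwO : lorentz w (basePt n) = 0) (hwξ : lorentz w ξ = 0) :
    lorentz (mat g *ᵥ basePt n) w = lorentz w (tangentAt p.1) * Real.exp (-2 * p.2.1) := by
  rw [lorentz_mat_left, h.inv_mulVec_frame hξ hwO hwξ, maxCompact_lorentz h.2.1,
    lorentz_sub_right, lorentz_smul_right, basePt_lorentz_boundary hξ, lorentz_comm _ w, hwO]
  ring

/-- `N_ξ A_ξ` acts transitively on hyperbolic space: `τ` and `X` are read off from the Lorentz
products of `g O` with `ξ` and with the frame, which determine a point of the hyperboloid. -/
theorem exists_isIwasawa {ξ : Idx n → ℝ} (hξ : ξ ∈ boundary n) {u : Fin n → LieAlg n}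
    (hu : IsHorosphericalFrame ξ u) (g : SOPlus n) : ∃ p, IsIwasawa ξ g p := by
  set x := mat g *ᵥ basePt n with hx
  have hxm : x ∈ hyperboloid n := mat_mem_hyperboloid g basePt_mem
  have hb := lorentz_boundary_neg hxm hξ
  set b := -lorentz x ξ with hbdef
  have hbpos : 0 < b := by linarith
  set τ := -(Real.log b) / 2
  have hτ : Real.exp (-2 * τ) = b := by
    rw [show -2 * τ = Real.log b by simp only [τ]; ring, Real.exp_log hbpos]
  set X : LieAlg n := ∑ i, (lorentz x (tangentAt (u i)) / b) • u i with hXdef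
  have hX : X ∈ rootSpace ξ 2 :=
    Submodule.sum_mem _ fun i _ => Submodule.smul_mem _ _ (hu.1 i)
  have hTX : tangentAt X = ∑ i, (lorentz x (tangentAt (u i)) / b) • tangentAt (u i) := by
    simp only [X, tangentAt, map_sum, map_smul, Matrix.sum_mulVec, Matrix.smul_mulVec]
  set h := expG X * expG (τ • translationGen ξ) with hh
  have hIw : IsIwasawa ξ h (X, τ, 1) := ⟨hX, one_mem _, by rw [mul_one]⟩
  have hz := hIw.lorentz_boundary hξ
  have hzm : mat h *ᵥ basePt n ∈ hyperboloid n := mat_mem_hyperboloid h basePt_mem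
  set z := mat h *ᵥ basePt n with hzdef
  simp only [hτ] at hz
  have hd := eq_smul_of_orthogonal hξ hu.2 (fun i => tangentAt_lorentz_basePt _)
    (fun i => tangentAt_lorentz_of_rootSpace hξ (hu.1 i)) (w := x - z) (fun j => ?_)
    (by rw [lorentz_sub_left, hz]; linarith)
  · set c := (x - z) (Sum.inr ())
    have hxz : x = z + c • ξ := by rw [← hd]; abel
    have h1 := hxm.1
    rw [hxz, lorentz_add_left, lorentz_add_right, lorentz_add_right, lorentz_smul_left,
      lorentz_smul_left, lorentz_smul_right, lorentz_smul_right, lorentz_comm ξ z, hz, hξ.1,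
      hzm.1] at h1
    have hc : c = 0 := by
      have : c * b = 0 := by linarith
      rcases mul_eq_zero.1 this with h | h
      · exact h
      · exact absurd h hbpos.ne'
    rw [hc, zero_smul, add_zero] at hxz
    refine ⟨(X, τ, h⁻¹ * g), hX, ?_, ?_⟩
    · change mat (h⁻¹ * g) *ᵥ basePt n = basePt n
      rw [mat_mul, ← Matrix.mulVec_mulVec, ← hx, hxz, hzdef, mat_inv_mulVec_mulVec]
    · simp only [← hh, mul_inv_cancel_left]
  · rw [lorentz_sub_left, hIw.lorentz_frame hξ (tangentAt_lorentz_basePt _)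
      (tangentAt_lorentz_of_rootSpace hξ (hu.1 j)), hτ, hTX, lorentz_comm _ (∑ i, _),
      lorentz_sum_left]
    simp only [lorentz_smul_left, hu.2]
    simp
    field_simp
    ring

theorem isIwasawa_iwasawa {ξ : Idx n → ℝ} (hξ : ξ ∈ boundary n) {u : Fin n → LieAlg n}
    (hu : IsHorosphericalFrame ξ u) (g : SOPlus n) : IsIwasawa ξ g (iwasawa ξ g) :=
  Classical.epsilon_spec (p := IsIwasawa ξ g) (exists_isIwasawa hξ hu g)

end Iwasawa

/-! ### The form `φ_{ξ,s}` in horospherical coordinates -/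

section Operators

variable {n : ℕ}

/-- The normed algebra of operators on `ℝ^{n+1,1}`; matrices have no canonical norm. -/
abbrev Op (n : ℕ) : Type := (Idx n → ℝ) →L[ℝ] (Idx n → ℝ)

/-- Matrices as operators. -/
noncomputable def toOp : Matrix (Idx n) (Idx n) ℝ ≃ₐ[ℝ] Op n :=
  Matrix.toLinAlgEquiv'.trans (Module.End.toContinuousLinearMap (Idx n → ℝ))

theorem toOp_exp (A : Matrix (Idx n) (Idx n) ℝ) :
    toOp (NormedSpace.exp A) = NormedSpace.exp (toOp A) := by
  ext1 w
  have h := NormedSpace.exp_series_hasSum_exp' (𝕂 := ℝ) (toOp A)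
  refine (hasSum_exp_mulVec A w).unique ?_
  have h2 := h.mapL (ContinuousLinearMap.apply ℝ (Idx n → ℝ) w)
  have h3 : ∀ k : ℕ, (ContinuousLinearMap.apply ℝ (Idx n → ℝ)) w
      (((k.factorial : ℝ)⁻¹) • toOp A ^ k) = ((k.factorial : ℝ)⁻¹) • ((A ^ k) *ᵥ w) := fun k => by
    rw [← map_pow]
    rfl
  simp only [h3] at h2
  exact h2

/-- The operator of an element of `G`. -/
noncomputable def op (g : SOPlus n) : Op n := toOp (mat g)

theorem op_mul (g h : SOPlus n) : op (g * h) = op g * op h := map_mul toOp _ _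

theorem op_one : op (1 : SOPlus n) = 1 := map_one toOp

/-- The operator of an element of `𝔤`. -/
noncomputable def toOpL : LieAlg n →L[ℝ] Op n :=
  LinearMap.toContinuousLinearMap (toOp.toLinearMap ∘ₗ toMat)

theorem toOpL_apply (X : LieAlg n) : toOpL X = toOp (toMat X) := rfl

theorem op_expG (X : LieAlg n) : op (expG X) = NormedSpace.exp (toOpL X) := toOp_exp _

theorem toOpL_bracket (X Y : LieAlg n) :
    toOpL ⁅X, Y⁆ = toOpL X * toOpL Y - toOpL Y * toOpL X := by
  rw [toOpL_apply, toMat_bracket, map_sub, map_mul, map_mul]; rfl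

end Operators

section HorosphericalForm

variable {n : ℕ} {V : Type*} [NormedAddCommGroup V] [NormedSpace ℝ V]

/-- Smoothness of a family of alternating maps can be tested on vectors. -/
theorem contDiffAt_alternating {E F : Type*} [NormedAddCommGroup E] [NormedSpace ℝ E]
    [NormedAddCommGroup F] [NormedSpace ℝ F] [FiniteDimensional ℝ F] [FiniteDimensional ℝ V]
    {m : ℕ} {N : WithTop ℕ∞} {f : E → F [⋀^Fin m]→L[ℝ] V} {x : E}
    (h : ∀ X, ContDiffAt ℝ N (fun y => f y X) x) : ContDiffAt ℝ N f x := by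
  let b := Module.finBasis ℝ (F)
  have : FiniteDimensional ℝ (F [⋀^Fin m]→L[ℝ] V) := by
    refine FiniteDimensional.of_injective
      (V₂ := MultilinearMap ℝ (fun _ : Fin m => F) V)
      { toFun := fun w => w.toMultilinearMap
        map_add' := fun _ _ => rfl
        map_smul' := fun _ _ => rfl } fun w w' hw => ?_
    ext X
    exact congrArg (fun M => M X) hw
  let ev : (F [⋀^Fin m]→L[ℝ] V) →ₗ[ℝ]
      ((Fin m → Fin (Module.finrank ℝ (F))) → V) :=
    { toFun := fun w s => w fun i => b (s i)
      map_add' := fun _ _ => rfl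
      map_smul' := fun _ _ => rfl }
  have hinj : Function.Injective ev := fun w w' hw => by
    have : w.toMultilinearMap = w'.toMultilinearMap :=
      Module.Basis.ext_multilinear (fun _ => b) fun s => congrFun hw s
    ext X
    exact congrArg (fun M => M X) this
  obtain ⟨g, hg⟩ := LinearMap.exists_leftInverse_of_injective ev (LinearMap.ker_eq_bot.2 hinj)
  have hf : f = fun y => LinearMap.toContinuousLinearMap g (ev (f y)) := by
    funext y
    exact (congrArg (fun M => M (f y)) hg).symm
  rw [hf]
  refine (ContinuousLinearMap.contDiff _).contDiffAt.comp x ?_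
  exact contDiffAt_pi.2 fun s => h _

/-- The linear map `A ↦ ⟨A O, w⟩`. -/
noncomputable def pairBasePt (w : Idx n → ℝ) : Op n →L[ℝ] ℝ :=
  LinearMap.toContinuousLinearMap
    { toFun := fun A => lorentz (A (basePt n)) w
      map_add' := fun _ _ => lorentz_add_left _ _ _
      map_smul' := fun _ _ => lorentz_smul_left _ _ _ }

/-- The Cartesian coordinates, on horospheres centred at `ξ`, of the point `A · O`, as functions of
the operator `A`. They are defined on the open set `⟨A O, ξ⟩ < 0`, which contains `G`. -/
noncomputable def horoCoord (ξ : Idx n → ℝ) (u : Fin n → LieAlg n) (A : Op n) :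
    Fin n → ℝ := fun i => pairBasePt (tangentAt (u i)) A / -pairBasePt ξ A

/-- The horospherical frame as a linear map `ℝⁿ → 𝔫_ξ`. -/
noncomputable def frameMap (u : Fin n → LieAlg n) : (Fin n → ℝ) →L[ℝ] LieAlg n :=
  LinearMap.toContinuousLinearMap (Fintype.linearCombination ℝ u)

theorem frameMap_apply (u : Fin n → LieAlg n) (y : Fin n → ℝ) :
    frameMap u y = ∑ i, y i • u i := rfl

/-- The `n`-form `h(y) dy₁ ∧ ⋯ ∧ dyₙ` on `ℝⁿ`, where `h(y) = ρ(exp (∑ yᵢ uᵢ)) v`. The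
representation enters through a function `R` of operators with `R(g) = ρ(g⁻¹)` for `g ∈ G`. -/
noncomputable def coeffForm (R : Op n → V →L[ℝ] V) (u : Fin n → LieAlg n)
    (v : V) (y : Fin n → ℝ) : (Fin n → ℝ) [⋀^Fin n]→L[ℝ] V :=
  (ContinuousLinearMap.toSpanSingleton ℝ
    (R (NormedSpace.exp (toOpL (-frameMap u y))) v)).compContinuousAlternatingMap (detForm n)

/-- The pullback of `coeffForm` under `horoCoord`. -/
noncomputable def pullForm (R : Op n → V →L[ℝ] V) (ξ : Idx n → ℝ)
    (u : Fin n → LieAlg n) (v : V) (A : Op n) :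
    Op n [⋀^Fin n]→L[ℝ] V :=
  (coeffForm R u v (horoCoord ξ u A)).compContinuousLinearMap (fderiv ℝ (horoCoord ξ u) A)

/-- The left-invariant vector fields `X ↦ A X` at the operator `A`. -/
noncomputable def leftMul (A : Op n) :
    LieAlg n →L[ℝ] Op n :=
  (ContinuousLinearMap.mul ℝ (Op n) A).comp toOpL

/-- The extension of `φ_{ξ,s}` to a neighbourhood of `G` in the space of operators: the form
`pullForm` in the left-invariant frame, with the coefficients twisted by `ρ(g⁻¹)`. -/
noncomputable def extPhi (R : Op n → V →L[ℝ] V) (ξ : Idx n → ℝ)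
    (u : Fin n → LieAlg n) (v : V) (A : Op n) :
    LieAlg n [⋀^Fin n]→L[ℝ] V :=
  (R A).compContinuousAlternatingMap ((pullForm R ξ u v A).compContinuousLinearMap (leftMul A))

theorem extPhi_apply (R : Op n → V →L[ℝ] V) (ξ : Idx n → ℝ)
    (u : Fin n → LieAlg n) (v : V) (A : Op n) (X : Fin n → LieAlg n) :
    extPhi R ξ u v A X = R A (pullForm R ξ u v A fun i => A * toOpL (X i)) := rfl

theorem pullForm_apply (R : Op n → V →L[ℝ] V) (ξ : Idx n → ℝ)
    (u : Fin n → LieAlg n) (v : V) (A : Op n)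
    (Y : Fin n → Op n) :
    pullForm R ξ u v A Y = (Matrix.of fun i => fderiv ℝ (horoCoord ξ u) A (Y i)).det •
      R (NormedSpace.exp (toOpL (-frameMap u (horoCoord ξ u A)))) v := rfl

theorem contDiffAt_horoCoord {ξ : Idx n → ℝ} (u : Fin n → LieAlg n)
    {A : Op n} (hA : pairBasePt ξ A < 0) {N : WithTop ℕ∞} :
    ContDiffAt ℝ N (horoCoord ξ u) A := by
  refine contDiffAt_pi.2 fun i => ?_
  exact ((pairBasePt _).contDiff.contDiffAt).div ((pairBasePt _).contDiff.contDiffAt.neg)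
    (by linarith)

theorem fderiv_horoCoord {ξ : Idx n → ℝ} (u : Fin n → LieAlg n)
    {A : Op n} (hA : pairBasePt ξ A < 0) (Y : Op n)
    (i : Fin n) : fderiv ℝ (horoCoord ξ u) A Y i =
      (pairBasePt (tangentAt (u i)) Y * -pairBasePt ξ A +
        pairBasePt (tangentAt (u i)) A * pairBasePt ξ Y) / (-pairBasePt ξ A) ^ 2 := by
  have h1 : HasFDerivAt (horoCoord ξ u) (fderiv ℝ (horoCoord ξ u) A) A :=
    ((contDiffAt_horoCoord u hA (N := 1)).differentiableAt one_ne_zero).hasFDerivAt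
  have hline : HasDerivAt (fun t : ℝ => A + t • Y) Y 0 := by
    have := ((hasDerivAt_id (0 : ℝ)).smul_const Y).const_add A
    rwa [one_smul] at this
  have h1' : HasFDerivAt (horoCoord ξ u) (fderiv ℝ (horoCoord ξ u) A)
      ((fun t : ℝ => A + t • Y) 0) := by simpa using h1
  have h2 := hasDerivAt_pi.1 (h1'.comp_hasDerivAt (0 : ℝ) hline) i
  have h3 (w : Idx n → ℝ) : HasDerivAt (fun t : ℝ => pairBasePt w (A + t • Y))
      (pairBasePt w Y) 0 := (pairBasePt w).hasFDerivAt.comp_hasDerivAt (0 : ℝ) hline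
  have h4 := (h3 (tangentAt (u i))).div (h3 ξ).neg (by simp; linarith)
  exact (h2.unique h4).trans (by simp)

theorem contDiff_exp_toOpL {N : WithTop ℕ∞} :
    ContDiff ℝ N fun X : LieAlg n => NormedSpace.exp (toOpL X) :=
  (contDiff_iff_contDiffAt.2 fun x => (NormedSpace.exp_analytic (𝕂 := ℝ) x).contDiffAt).comp
    toOpL.contDiff

theorem contDiff_coefficient {R : Op n → V →L[ℝ] V} (hR : ContDiff ℝ ∞ R)
    (u : Fin n → LieAlg n) (v : V) :
    ContDiff ℝ ∞ fun y => R (NormedSpace.exp (toOpL (-frameMap u y))) v :=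
  ((hR.comp (contDiff_exp_toOpL.comp (frameMap u).contDiff.neg))).clm_apply contDiff_const

theorem contDiffAt_pullForm_apply {R : Op n → V →L[ℝ] V}
    (hR : ContDiff ℝ ∞ R) {ξ : Idx n → ℝ} (u : Fin n → LieAlg n) (v : V)
    {A : Op n} (hA : pairBasePt ξ A < 0)
    {Y : Fin n → Op n → Op n}
    (hY : ∀ i, ContDiffAt ℝ ∞ (Y i) A) :
    ContDiffAt ℝ ∞ (fun B => pullForm R ξ u v B fun i => Y i B) A := by
  simp only [pullForm_apply]
  have hdet : ContDiffAt ℝ ∞ (fun B : Op n => (Matrix.of fun i =>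
      fderiv ℝ (horoCoord ξ u) B (Y i B)).det) A := by
    simp only [Matrix.det_apply]
    refine ContDiffAt.sum fun σ _ => ContDiffAt.const_smul _ (contDiffAt_prod fun i _ => ?_)
    have h1 : ContDiffAt ℝ ∞ (fun B : Op n =>
        fderiv ℝ (horoCoord ξ u) B (Y (σ i) B)) A :=
      ((contDiffAt_horoCoord u hA (N := ∞)).fderiv_right (m := ∞) (by simp)).clm_apply (hY _)
    exact contDiffAt_pi.1 h1 i
  exact hdet.smul ((contDiff_coefficient hR u v).contDiffAt.comp A (contDiffAt_horoCoord u hA))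

theorem contDiffAt_pullForm [FiniteDimensional ℝ V] {R : Op n → V →L[ℝ] V}
    (hR : ContDiff ℝ ∞ R) {ξ : Idx n → ℝ} (u : Fin n → LieAlg n) (v : V)
    {A : Op n} (hA : pairBasePt ξ A < 0) :
    ContDiffAt ℝ ∞ (pullForm R ξ u v) A :=
  contDiffAt_alternating fun _ => contDiffAt_pullForm_apply hR u v hA fun _ => contDiffAt_const

theorem contDiffAt_extPhi [FiniteDimensional ℝ V] {R : Op n → V →L[ℝ] V}
    (hR : ContDiff ℝ ∞ R) {ξ : Idx n → ℝ} (u : Fin n → LieAlg n) (v : V)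
    {A : Op n} (hA : pairBasePt ξ A < 0) :
    ContDiffAt ℝ ∞ (extPhi R ξ u v) A :=
  contDiffAt_alternating fun _ => hR.contDiffAt.clm_apply
    (contDiffAt_pullForm_apply hR u v hA fun _ => contDiffAt_id.mul contDiffAt_const)

theorem tangentAt_Ad {k : SOPlus n} (hk : k ∈ maxCompact n) (X : LieAlg n) :
    tangentAt (Ad n k X) = mat k *ᵥ tangentAt X := by
  have : mat k⁻¹ *ᵥ basePt n = basePt n := (maxCompact n).inv_mem hk
  rw [tangentAt, toMat_Ad, ← Matrix.mulVec_mulVec, ← Matrix.mulVec_mulVec, this, tangentAt]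

theorem pairBasePt_op_neg {ξ : Idx n → ℝ} (hξ : ξ ∈ boundary n) (g : SOPlus n) :
    pairBasePt ξ (op g) < 0 :=
  lorentz_boundary_neg (mat_mem_hyperboloid g basePt_mem) hξ

theorem IsIwasawa.horoCoord_eq {ξ : Idx n → ℝ} (hξ : ξ ∈ boundary n) {u : Fin n → LieAlg n}
    (hu : IsHorosphericalFrame ξ u) {g : SOPlus n} {p : LieAlg n × ℝ × SOPlus n}
    (h : IsIwasawa ξ g p) (i : Fin n) :
    horoCoord ξ u (op g) i = lorentz (tangentAt p.1) (tangentAt (u i)) := by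
  change lorentz (mat g *ᵥ basePt n) (tangentAt (u i)) / -lorentz (mat g *ᵥ basePt n) ξ = _
  rw [h.lorentz_boundary hξ, h.lorentz_frame hξ (tangentAt_lorentz_basePt _)
      (tangentAt_lorentz_of_rootSpace hξ (hu.1 i)), lorentz_comm (tangentAt (u i)), neg_neg,
      mul_div_cancel_right₀ _ (Real.exp_pos _).ne']

theorem IsIwasawa.frameMap_horoCoord {ξ : Idx n → ℝ} (hξ : ξ ∈ boundary n) {u : Fin n → LieAlg n}
    (hu : IsHorosphericalFrame ξ u) {g : SOPlus n} {p : LieAlg n × ℝ × SOPlus n}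
    (h : IsIwasawa ξ g p) : frameMap u (horoCoord ξ u (op g)) = p.1 := by
  rw [frameMap_apply]
  simp only [h.horoCoord_eq hξ hu]
  exact (eq_sum_of_rootSpace hξ hu h.1).symm

theorem IsIwasawa.fderiv_horoCoord {ξ : Idx n → ℝ} (hξ : ξ ∈ boundary n) {u : Fin n → LieAlg n}
    (hu : IsHorosphericalFrame ξ u) {g : SOPlus n} {p : LieAlg n × ℝ × SOPlus n}
    (h : IsIwasawa ξ g p) (X : LieAlg n) :
    fderiv ℝ (horoCoord ξ u) (op g) (op g * toOpL X) =
      Real.exp (2 * p.2.1) • coframe u (Ad n p.2.2 X) := by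
  ext i
  have heO := tangentAt_lorentz_basePt (u i)
  have heξ := tangentAt_lorentz_of_rootSpace hξ (hu.1 i)
  have hpair (w : Idx n → ℝ) : pairBasePt w (op g * toOpL X) =
      lorentz (tangentAt X) (mat g⁻¹ *ᵥ w) := by
    change lorentz (mat g *ᵥ tangentAt X) w = _
    rw [lorentz_mat_left]
  have h1 : pairBasePt ξ (op g) = -Real.exp (-2 * p.2.1) := h.lorentz_boundary hξ
  have h2 : pairBasePt (tangentAt (u i)) (op g) =
    lorentz (tangentAt (u i)) (tangentAt p.1) * Real.exp (-2 * p.2.1) := h.lorentz_frame hξ heO heξ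
  rw [HypEis.fderiv_horoCoord u (pairBasePt_op_neg hξ g), hpair, hpair, h1, h2,
    h.inv_mulVec_boundary hξ, h.inv_mulVec_frame hξ heO heξ, lorentz_smul_right,
    ← lorentz_mat_left, ← lorentz_mat_left, ← tangentAt_Ad h.2.1, lorentz_sub_right,
    lorentz_smul_right]
  change _ = Real.exp (2 * p.2.1) * lorentz (tangentAt (Ad n p.2.2 X)) (tangentAt (u i))
  have h3 : Real.exp (2 * p.2.1) = (Real.exp (-2 * p.2.1))⁻¹ := by
    rw [← Real.exp_neg]; ring_nf
  have h4 := Real.exp_pos (-2 * p.2.1)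
  rw [h3]
  field_simp
  ring

/-- For every Iwasawa decomposition `g = n a k`, the defining expression of `φ_{ξ,s}(g)` is
`extPhi` at `g`; in particular it does not depend on the decomposition. The hypothesis `hv` links
the degree `s` to the weight of `v`: the factors `e^{2nτ}` (from the volume form) and
`e^{(s - 2n)τ}` (from `ρ(a⁻¹) v`) combine to `t_a^s`. -/
theorem IsIwasawa.extPhi_eq [FiniteDimensional ℝ V] {ρ : Representation ℝ (SOPlus n) V}
    {R : Op n → V →L[ℝ] V} (hRρ : ∀ g w, R (op g) w = ρ g⁻¹ w)
    {ξ : Idx n → ℝ} (hξ : ξ ∈ boundary n) {u : Fin n → LieAlg n}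
    (hu : IsHorosphericalFrame ξ u) {v : V} {s : ℝ}
    (hv : ∀ τ : ℝ, ρ (expG (τ • translationGen ξ)) v = Real.exp ((2 * n - s) * τ) • v)
    {g : SOPlus n} {p : LieAlg n × ℝ × SOPlus n} (h : IsIwasawa ξ g p) :
    (Real.exp p.2.1) ^ s • twist ρ p.2.2
      ((ContinuousLinearMap.toSpanSingleton ℝ v).compContinuousAlternatingMap (volForm u)) =
    extPhi R ξ u v (op g) := by
  ext X
  rw [extPhi_apply, pullForm_apply, h.frameMap_horoCoord hξ hu, map_smul, hRρ]
  have h1 : R (NormedSpace.exp (toOpL (-p.1))) v = ρ (expG p.1) v := by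
    have := hRρ (expG (-p.1)) v
    rwa [expG_inv, neg_neg, op_expG] at this
  have h2 : g⁻¹ * expG p.1 = p.2.2⁻¹ * expG ((-p.2.1) • translationGen ξ) := by
    have e := h.2.2
    have e2 : (expG (p.2.1 • translationGen ξ))⁻¹ = expG ((-p.2.1) • translationGen ξ) := by
      rw [expG_inv, neg_smul]
    rw [← e2]
    conv_lhs => rw [e]
    group
  rw [h1, ← Module.End.mul_apply, ← map_mul, h2, map_mul, Module.End.mul_apply, hv, map_smul,
    smul_smul]
  have h3 : (Matrix.of fun i => fderiv ℝ (horoCoord ξ u) (op g) (op g * toOpL (X i))) =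
      Real.exp (2 * p.2.1) • Matrix.of fun i => coframe u (Ad n p.2.2 (X i)) := by
    ext i j
    rw [Matrix.smul_apply, Matrix.of_apply, Matrix.of_apply, h.fderiv_horoCoord hξ hu]
    rfl
  rw [h3, Matrix.det_smul, Fintype.card_fin]
  have h4 : (Real.exp p.2.1) ^ s • twist ρ p.2.2
      ((ContinuousLinearMap.toSpanSingleton ℝ v).compContinuousAlternatingMap (volForm u)) X =
      (Real.exp p.2.1) ^ s •
        ρ p.2.2⁻¹ ((Matrix.of fun i => coframe u (Ad n p.2.2 (X i))).det • v) := rfl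
  rw [ContinuousAlternatingMap.smul_apply, h4, map_smul, smul_smul]
  congr 1
  have h5 : Real.exp p.2.1 ^ s = Real.exp (2 * p.2.1) ^ n * Real.exp ((2 * n - s) * -p.2.1) := by
    rw [← Real.exp_mul, ← Real.exp_nat_mul, ← Real.exp_add]
    ring_nf
  rw [h5]
  ring

end HorosphericalForm

/-! ### Derivatives along left-invariant vector fields and closedness of `φ_{ξ,s}` -/

section Closed

variable {n : ℕ} {V : Type*} [NormedAddCommGroup V] [NormedSpace ℝ V]

/-- The form `pullForm` is closed: its exterior derivative is pulled back from a form of degree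
`n + 1` on `ℝⁿ`. -/
theorem extDeriv_pullForm [FiniteDimensional ℝ V] {R : Op n → V →L[ℝ] V} (hR : ContDiff ℝ ∞ R)
    {ξ : Idx n → ℝ} (u : Fin n → LieAlg n) (v : V) {A : Op n}
    (hA : pairBasePt ξ A < 0) : extDeriv (pullForm R ξ u v) A = 0 := by
  have hd : DifferentiableAt ℝ (coeffForm R u v) (horoCoord ξ u A) :=
    (contDiffAt_alternating fun Y => ((contDiff_coefficient hR u v).contDiffAt.const_smul
      (detForm n Y))).differentiableAt (n := ∞) (by simp)
  have h := extDeriv_pullback (r := 2) hd (contDiffAt_horoCoord u hA) (by simp)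
  refine h.trans ?_
  ext Y
  refine ((extDeriv (coeffForm R u v) (horoCoord ξ u A)).toAlternatingMap.map_linearDependent _
    fun hli => ?_)
  have := hli.fintype_card_le_finrank
  simp at this

theorem hasDerivAt_mul_expG (A : Op n) (X : LieAlg n) :
    HasDerivAt (fun t : ℝ => A * op (expG (t • X))) (A * toOpL X) 0 := by
  have h := hasDerivAt_exp_smul_const (𝕂 := ℝ) (toOpL X) (0 : ℝ)
  rw [zero_smul, NormedSpace.exp_zero, one_mul] at h
  simp only [op_expG, map_smul]
  exact h.const_mul A

theorem hasDerivAt_comp_mul_expG {W : Type*} [NormedAddCommGroup W] [NormedSpace ℝ W]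
    {F : Op n → W} {F' : Op n →L[ℝ] W} {g : SOPlus n}
    (hF : HasFDerivAt F F' (op g)) (X : LieAlg n) :
    HasDerivAt (fun t : ℝ => F (op (g * expG (t • X)))) (F' (op g * toOpL X)) 0 := by
  have h0 : op g * op (expG ((0 : ℝ) • X)) = op g := by
    rw [zero_smul, expG_zero, op_one, mul_one]
  have hF' : HasFDerivAt F F' (op g * op (expG ((0 : ℝ) • X))) := by rwa [h0]
  simp only [op_mul]
  exact HasFDerivAt.comp_hasDerivAt (f := fun t : ℝ => op g * op (expG (t • X))) 0 hF'
    (hasDerivAt_mul_expG (op g) X)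

theorem leftDeriv_eq {W : Type*} [NormedAddCommGroup W] [NormedSpace ℝ W]
    {F : Op n → W} {F' : Op n →L[ℝ] W} {g : SOPlus n}
    (hF : HasFDerivAt F F' (op g)) (X : LieAlg n) :
    leftDeriv X (fun h => F (op h)) g = F' (op g * toOpL X) :=
  (hasDerivAt_comp_mul_expG hF X).deriv

theorem hasDerivAt_derivedAction {ρ : Representation ℝ (SOPlus n) V}
    {R : Op n → V →L[ℝ] V} (hR : ContDiff ℝ ∞ R)
    (hRρ : ∀ g w, R (op g) w = ρ g⁻¹ w) (X : LieAlg n) (w : V) :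
    HasDerivAt (fun t : ℝ => ρ (expG (t • X)) w) (fderiv ℝ R 1 (toOpL (-X)) w) 0 := by
  have hd : HasFDerivAt R (fderiv ℝ R 1) (op (1 : SOPlus n)) :=
    op_one (n := n) ▸ (hR.differentiable (by simp) _).hasFDerivAt
  have h := (hasDerivAt_comp_mul_expG hd (-X)).clm_apply (hasDerivAt_const (0 : ℝ) w)
  rw [op_one, one_mul, map_zero, add_zero] at h
  convert h using 1
  funext t
  rw [one_mul, hRρ, expG_inv, smul_neg, neg_neg]

theorem derivedAction_eq {ρ : Representation ℝ (SOPlus n) V}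
    {R : Op n → V →L[ℝ] V} (hR : ContDiff ℝ ∞ R)
    (hRρ : ∀ g w, R (op g) w = ρ g⁻¹ w) (X : LieAlg n) (w : V) :
    derivedAction ρ X w = fderiv ℝ R 1 (toOpL (-X)) w :=
  (hasDerivAt_derivedAction hR hRρ X w).deriv

/-- The function `A ↦ R(A)`, with `R(g) = ρ(g⁻¹)` on `G`, differentiates to `-ρ(X)` along
left-invariant vector fields. -/
theorem fderiv_apply_mul_toOpL {ρ : Representation ℝ (SOPlus n) V}
    {R : Op n → V →L[ℝ] V} (hR : ContDiff ℝ ∞ R)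
    (hRρ : ∀ g w, R (op g) w = ρ g⁻¹ w) (g : SOPlus n) (X : LieAlg n) (w : V) :
    fderiv ℝ R (op g) (op g * toOpL X) w = -derivedAction ρ X (R (op g) w) := by
  have hd : HasFDerivAt R (fderiv ℝ R (op g)) (op g) :=
    (hR.differentiable (by simp) _).hasFDerivAt
  have h := (hasDerivAt_comp_mul_expG hd X).clm_apply (hasDerivAt_const (0 : ℝ) w)
  rw [map_zero, add_zero] at h
  have h2 := hasDerivAt_derivedAction hR hRρ (-X) (R (op g) w)
  have h3 : (fun t : ℝ => R (op (g * expG (t • X))) w) =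
      fun t : ℝ => ρ (expG (t • -X)) (R (op g) w) := by
    funext t
    rw [hRρ, hRρ, mul_inv_rev, map_mul, expG_inv, smul_neg]
    rfl
  rw [h3] at h
  have h4 := h.unique h2
  rw [derivedAction_eq hR hRρ, h4, neg_neg, map_neg, map_neg, neg_apply,
    neg_neg]

theorem bracketPart_comp {m : ℕ} (L : V →L[ℝ] V) (w : LieAlg n [⋀^Fin m]→L[ℝ] V)
    (X : Fin (m + 1) → LieAlg n) :
    bracketPart (L.compContinuousAlternatingMap w) X = L (bracketPart w X) := by
  cases m with
  | zero => simp [bracketPart]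
  | succ m => simp [bracketPart, map_sum]

/-- Cartan's formula for the exterior derivative of a closed form, on the linear vector fields
`A ↦ A X`. -/
theorem sum_fderiv_add_bracketPart {m : ℕ}
    {η : Op n → Op n [⋀^Fin m]→L[ℝ] V}
    {A : Op n} (hη : DifferentiableAt ℝ η A) (h0 : extDeriv η A = 0)
    (X : Fin (m + 1) → LieAlg n) :
    ∑ i : Fin (m + 1), (-1 : ℝ) ^ (i : ℕ) •
        fderiv ℝ (fun B => η B fun j => B * toOpL (i.removeNth X j)) A (A * toOpL (X i)) +
      bracketPart ((η A).compContinuousLinearMap (leftMul A)) X = 0 := by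
  have hV : ∀ (Y : LieAlg n) (B : Op n), HasFDerivAt
      (fun B : Op n => B * toOpL Y)
      ((ContinuousLinearMap.mul ℝ (Op n)).flip (toOpL Y)) B := fun Y B =>
    ((ContinuousLinearMap.mul ℝ (Op n)).flip (toOpL Y)).hasFDerivAt
  let Vf : Fin (m + 1) → Op n → Op n :=
    fun i B => B * toOpL (X i)
  have hVd : ∀ i, DifferentiableAt ℝ (Vf i) A := fun i => (hV (X i) A).differentiableAt
  have hs : ∀ (k : ℕ) (w : V), (-1 : ℝ) ^ k • w = (-1 : ℤ) ^ k • w := fun k w => by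
    rw [← Int.cast_smul_eq_zsmul ℝ]; simp
  cases m with
  | zero =>
    have h := extDeriv_apply_vectorField_of_pairwise_commute hη hVd
      (fun i j hij => absurd (Fin.ext (by omega)) hij)
    rw [h0] at h
    simp only [hs]
    exact (add_zero _).trans h.symm
  | succ m =>
    have h := extDeriv_apply_vectorField hη hVd
    rw [h0] at h
    have hl (i j : Fin (m + 2)) : VectorField.lieBracket ℝ (Vf i) (Vf j) A =
        A * toOpL ⁅X i, X j⁆ := by
      simp only [VectorField.lieBracket, Vf]
      rw [(hV (X i) A).fderiv, (hV (X j) A).fderiv, toOpL_bracket, mul_sub,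
        ← mul_assoc, ← mul_assoc]
      rfl
    simp only [hl] at h
    simp only [hs]
    rw [sub_eq_add_neg] at h
    refine Eq.trans ?_ h.symm
    congr 1
    rw [bracketPart]
    congr 1
    refine Finset.sum_congr rfl fun i _ => Finset.sum_congr rfl fun j _ => ?_
    rw [hs]
    congr 1
    rw [ContinuousAlternatingMap.compContinuousLinearMap_apply]
    congr 1
    ext k : 1
    refine Fin.cases ?_ (fun k => ?_) k <;> rfl

/-- A twisted closed form is annihilated by the coboundary operator: the derivative of `ρ(g⁻¹)`
cancels the derived action. -/
theorem coboundary_of_extDeriv_eq_zero [FiniteDimensional ℝ V] {ρ : Representation ℝ (SOPlus n) V}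
    {R : Op n → V →L[ℝ] V} (hR : ContDiff ℝ ∞ R)
    (hRρ : ∀ g w, R (op g) w = ρ g⁻¹ w) {m : ℕ}
    {η : Op n → Op n [⋀^Fin m]→L[ℝ] V}
    {g : SOPlus n} (hη : DifferentiableAt ℝ η (op g)) (h0 : extDeriv η (op g) = 0)
    (X : Fin (m + 1) → LieAlg n) :
    coboundary ρ (fun h => (R (op h)).compContinuousAlternatingMap
      ((η (op h)).compContinuousLinearMap (leftMul (op h)))) g X = 0 := by
  have key := congrArg (R (op g)) (sum_fderiv_add_bracketPart hη h0 X)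
  rw [map_zero, map_add, ← bracketPart_comp, map_sum] at key
  rw [← key, coboundary]
  congr 1
  refine Finset.sum_congr rfl fun i _ => ?_
  rw [map_smul]
  congr 1
  have hY : DifferentiableAt ℝ (fun B => η B fun j => B * toOpL (i.removeNth X j)) (op g) :=
    hη.continuousAlternatingMap_apply (fun j =>
      ((ContinuousLinearMap.mul ℝ (Op n)).flip
        (toOpL (i.removeNth X j))).differentiableAt)
  have hd := ((hR.differentiable (by simp) (op g)).hasFDerivAt).clm_apply hY.hasFDerivAt
  have hl := leftDeriv_eq hd (X i)
  refine (congrArg (· + derivedAction ρ (X i) _) hl).trans ?_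
  have h1 := fderiv_apply_mul_toOpL hR hRρ g (X i) (η (op g) fun j => op g * toOpL (i.removeNth X j))
  have h2 : ((R (op g)).compContinuousAlternatingMap
      ((η (op g)).compContinuousLinearMap (leftMul (op g)))) (i.removeNth X) =
      R (op g) (η (op g) fun j => op g * toOpL (i.removeNth X j)) := rfl
  rw [h2]
  simp only [add_apply, ContinuousLinearMap.comp_apply,
    ContinuousLinearMap.flip_apply]
  rw [h1]
  abel

theorem coboundary_extPhi [FiniteDimensional ℝ V] {ρ : Representation ℝ (SOPlus n) V}
    {R : Op n → V →L[ℝ] V} (hR : ContDiff ℝ ∞ R)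
    (hRρ : ∀ g w, R (op g) w = ρ g⁻¹ w) {ξ : Idx n → ℝ} (hξ : ξ ∈ boundary n)
    (u : Fin n → LieAlg n) (v : V) (g : SOPlus n) (X : Fin (n + 1) → LieAlg n) :
    coboundary ρ (fun h => extPhi R ξ u v (op h)) g X = 0 :=
  coboundary_of_extDeriv_eq_zero hR hRρ
    ((contDiffAt_pullForm hR u v (pairBasePt_op_neg hξ g)).differentiableAt (by simp))
    (extDeriv_pullForm hR u v (pairBasePt_op_neg hξ g)) X

end Closed

/-! ### Series of smooth functions with parameters in a compact set -/

section SmoothSeries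

open Topology

variable {E P W : Type*} [NormedAddCommGroup E] [NormedSpace ℝ E] [FiniteDimensional ℝ E]
  [NormedAddCommGroup P] [NormedSpace ℝ P] [FiniteDimensional ℝ P]
  [NormedAddCommGroup W] [NormedSpace ℝ W]

/-- A smooth function on a neighbourhood of a compact set agrees near that set with a smooth
function of compact support. -/
theorem exists_compactSupport_extension {Ψ : E → W} {U S : Set E} (hU : IsOpen U)
    (hΨ : ContDiffOn ℝ ∞ Ψ U) (hS : IsCompact S) (hSU : S ⊆ U) :
    ∃ Φ : E → W, ContDiff ℝ ∞ Φ ∧ HasCompactSupport Φ ∧ ∀ z ∈ S, ∀ᶠ y in 𝓝 z, Φ y = Ψ y := by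
  obtain ⟨t, ht, hSt, htU⟩ := exists_compact_between hS hU hSU
  obtain ⟨χ, h1, h0, -⟩ := exists_contMDiffMap_one_nhds_of_subset_interior (n := ⊤)
    (modelWithCornersSelf ℝ E) hS.isClosed hSt
  have hχ : ContDiff ℝ ∞ χ := χ.contMDiff.contDiff
  refine ⟨fun z => χ z • Ψ z, contDiff_iff_contDiffAt.2 fun z => ?_, ?_, fun z hz => ?_⟩
  · by_cases hz : z ∈ U
    · exact hχ.contDiffAt.smul (hΨ.contDiffAt (hU.mem_nhds hz))
    · have hzt : ∀ᶠ y in 𝓝 z, χ y • Ψ y = 0 := by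
        filter_upwards [ht.isClosed.isOpen_compl.mem_nhds fun h => hz (htU h)] with y hy
        rw [h0 y hy, zero_smul]
      exact contDiffAt_const.congr_of_eventuallyEq hzt
  · exact HasCompactSupport.intro ht fun z hz => by simp only [h0 z hz, zero_smul]
  · filter_upwards [Filter.eventually_of_mem (mem_nhdsSet_iff_forall.1 h1 z hz) fun _ h => h]
      with y hy
    have hy' : χ y = 1 := hy
    rw [hy', one_smul]

/-- Let `Ψ` be smooth near `{x₀} × K` with `K` compact. For absolutely summable coefficients `c` and
parameters `κ` in `K`, the series `∑ cₐ Ψ(x, κₐ)` is smooth at `x₀`, and it may be differentiated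
term by term. -/
theorem contDiffAt_tsum_of_isCompact [CompleteSpace W] {Ψ : E × P → W} {U : Set (E × P)}
    (hU : IsOpen U) (hΨ : ContDiffOn ℝ ∞ Ψ U) {K : Set P} (hK : IsCompact K) {x₀ : E}
    (hx₀ : ∀ k ∈ K, (x₀, k) ∈ U) {α : Type*} {c : α → ℝ} (hc : Summable fun a => |c a|)
    {κ : α → P} (hκ : ∀ a, κ a ∈ K) :
    ContDiffAt ℝ ∞ (fun x => ∑' a, c a • Ψ (x, κ a)) x₀ ∧
    HasFDerivAt (fun x => ∑' a, c a • Ψ (x, κ a))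
      (∑' a, c a • fderiv ℝ (fun x => Ψ (x, κ a)) x₀) x₀ ∧
    (Summable fun a => c a • fderiv ℝ (fun x => Ψ (x, κ a)) x₀) ∧
    Summable fun a => ‖c a • Ψ (x₀, κ a)‖ := by
  obtain ⟨Φ, hΦ, hΦc, hΦΨ⟩ := exists_compactSupport_extension (S := {x₀} ×ˢ K) hU hΨ
    (isCompact_singleton.prod hK) (by rintro ⟨x, k⟩ ⟨rfl, hk⟩; exact hx₀ k hk)
  have hnear : ∀ᶠ x in 𝓝 x₀, ∀ k ∈ K, Φ (x, k) = Ψ (x, k) :=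
    hK.eventually_forall_of_forall_eventually fun k hk => hΦΨ (x₀, k) ⟨rfl, hk⟩
  choose C hC using fun k : ℕ => (hΦ.continuous_iteratedFDeriv (m := k)
    (by exact_mod_cast le_top)).bounded_above_of_compact_support (hΦc.iteratedFDeriv k)
  set ι := ContinuousLinearMap.inl ℝ E P
  have hcomp : ∀ a, (fun x => Φ (x, κ a)) = (fun z => Φ (z + (0, κ a))) ∘ ι := fun a => by
    funext x; simp [ι]
  have hsm : ∀ a, ContDiff ℝ ∞ fun x => Φ (x, κ a) := fun a =>
    hΦ.comp (contDiff_id.prodMk contDiff_const)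
  have hbound : ∀ (k : ℕ) a x, ‖iteratedFDeriv ℝ k (fun x => c a • Φ (x, κ a)) x‖ ≤
      |c a| * (C k * ‖ι‖ ^ k) := fun k a x => by
    have h1 : iteratedFDeriv ℝ k (fun x => c a • Φ (x, κ a)) x =
        c a • iteratedFDeriv ℝ k (fun x => Φ (x, κ a)) x :=
      iteratedFDeriv_const_smul_apply ((hsm a).contDiffAt.of_le (by exact_mod_cast le_top))
    rw [h1, norm_smul, Real.norm_eq_abs]
    refine mul_le_mul_of_nonneg_left ?_ (abs_nonneg _)
    have h2 : ContDiff ℝ ∞ fun z => Φ (z + (0, κ a)) :=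
      hΦ.comp (contDiff_id.add contDiff_const)
    rw [hcomp a, ι.iteratedFDeriv_comp_right h2 x (by exact_mod_cast le_top)]
    refine (ContinuousMultilinearMap.norm_compContinuousLinearMap_le _ _).trans ?_
    rw [Finset.prod_const, Finset.card_univ, Fintype.card_fin]
    refine mul_le_mul_of_nonneg_right ?_ (by positivity)
    rw [iteratedFDeriv_comp_add_right]
    exact hC k _
  have hsum : ∀ k, Summable fun a => |c a| * (C k * ‖ι‖ ^ k) := fun k => hc.mul_right _
  have hsmc : ∀ a, ContDiff ℝ ∞ fun x => c a • Φ (x, κ a) := fun a => (hsm a).const_smul _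
  have heq : (fun x => ∑' a, c a • Ψ (x, κ a)) =ᶠ[𝓝 x₀] fun x => ∑' a, c a • Φ (x, κ a) := by
    filter_upwards [hnear] with x hx
    exact tsum_congr fun a => by rw [hx _ (hκ a)]
  have hfd : ∀ a, c a • fderiv ℝ (fun x => Ψ (x, κ a)) x₀ =
      fderiv ℝ (fun x => c a • Φ (x, κ a)) x₀ := fun a => by
    have h1 : (fun x => Ψ (x, κ a)) =ᶠ[𝓝 x₀] fun x => Φ (x, κ a) := by
      filter_upwards [hnear] with x hx
      rw [hx _ (hκ a)]
    rw [h1.fderiv_eq, fderiv_fun_const_smul ((hsm a).differentiable (by simp) _)]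
  have hb1 : ∀ a x, ‖fderiv ℝ (fun x => c a • Φ (x, κ a)) x‖ ≤ |c a| * (C 1 * ‖ι‖ ^ 1) :=
    fun a x => by rw [← norm_iteratedFDeriv_one]; exact hbound 1 a x
  have hb0 : ∀ a x, ‖c a • Φ (x, κ a)‖ ≤ |c a| * (C 0 * ‖ι‖ ^ 0) :=
    fun a x => by
      rw [← norm_iteratedFDeriv_zero (𝕜 := ℝ) (f := fun x => c a • Φ (x, κ a))]
      exact hbound 0 a x
  simp only [hfd]
  refine ⟨?_, ?_, Summable.of_norm_bounded (hsum 1) fun a => hb1 a x₀, ?_⟩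
  · have := contDiff_tsum (N := ⊤) (v := fun k a => |c a| * (C k * ‖ι‖ ^ k)) hsmc
      (fun k _ => hsum k) fun k a x _ => hbound k a x
    exact this.contDiffAt.congr_of_eventuallyEq heq
  · refine HasFDerivAt.congr_of_eventuallyEq ?_ heq
    exact hasFDerivAt_tsum (hsum 1)
      (fun a x => ((hsmc a).differentiable (by simp) x).hasFDerivAt) hb1
      (Summable.of_norm_bounded (hsum 0) fun a => hb0 a x₀) x₀
  · refine Summable.of_nonneg_of_le (fun a => norm_nonneg _) (fun a => ?_) (hsum 0)
    rw [← hnear.self_of_nhds _ (hκ a)]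
    exact hb0 a x₀

end SmoothSeries

/-! ### Discreteness -/

section Discrete

open Topology

variable {n : ℕ}

theorem mat_inv_apply (g : SOPlus n) (i j : Idx n) : mat g⁻¹ i j =
    J n i i * mat g j i * J n j j := by
  rw [mat_inv, Matrix.mul_assoc]
  unfold J LieAlgebra.Orthogonal.indefiniteDiagonal
  rw [Matrix.diagonal_mul, Matrix.mul_diagonal]
  simp [mul_assoc]

theorem mat_inv_time_time (g : SOPlus n) :
    mat g⁻¹ (Sum.inr ()) (Sum.inr ()) = mat g (Sum.inr ()) (Sum.inr ()) := by
  rw [mat_inv_apply]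
  simp [J, LieAlgebra.Orthogonal.indefiniteDiagonal]

theorem one_le_mat_time (g : SOPlus n) : 1 ≤ mat g (Sum.inr ()) (Sum.inr ()) := by
  rw [← mat_basePt_time]
  exact one_le_time (mat_mem_hyperboloid g basePt_mem)

theorem mat_mulVec_single (A : Matrix (Idx n) (Idx n) ℝ) (i j : Idx n) :
    (A *ᵥ Pi.single j 1) i = A i j := by simp

/-- The entries of an element of `G` are bounded by its largest one, `cosh d(O, g O)`. -/
theorem abs_mat_le (g : SOPlus n) (i j : Idx n) :
    |mat g i j| ≤ mat g (Sum.inr ()) (Sum.inr ()) := by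
  set M := mat g (Sum.inr ()) (Sum.inr ()) with hM
  have hM1 : 1 ≤ M := one_le_mat_time g
  have hcol : ∀ h : SOPlus n, ∑ k, mat h (Sum.inl k) (Sum.inr ()) * mat h (Sum.inl k) (Sum.inr ()) =
      mat h (Sum.inr ()) (Sum.inr ()) ^ 2 - 1 := fun h => by
    have := sum_sq_of_mem_hyperboloid (mat_mem_hyperboloid h basePt_mem)
    rw [mat_basePt_time] at this
    rw [← this]
    refine Finset.sum_congr rfl fun k _ => ?_
    simp [Matrix.mulVec, dotProduct, basePt]
  have hrow : ∑ k, mat g (Sum.inr ()) (Sum.inl k) * mat g (Sum.inr ()) (Sum.inl k) = M ^ 2 - 1 := by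
    rw [hM, ← mat_inv_time_time, ← hcol g⁻¹]
    refine Finset.sum_congr rfl fun k _ => ?_
    rw [mat_inv_apply]
    simp [J, LieAlgebra.Orthogonal.indefiniteDiagonal]
  have hle : ∀ f : Fin (n + 1) → ℝ, ∀ k, f k * f k ≤ ∑ k, f k * f k := fun f k =>
    Finset.single_le_sum (f := fun k => f k * f k) (fun k _ => mul_self_nonneg _)
      (Finset.mem_univ k)
  refine abs_le_of_sq_le_sq ?_ (by linarith)
  rcases j with j | ⟨⟩
  · have h2 := hle (fun k => mat g (Sum.inr ()) (Sum.inl k)) j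
    simp only [hrow] at h2
    rcases i with i | ⟨⟩
    · have h1 := lorentz_mat g (Pi.single (Sum.inl j) 1) (Pi.single (Sum.inl j) 1)
      rw [lorentz_eq, lorentz_eq] at h1
      simp only [mat_mulVec_single] at h1
      simp only [Pi.single_apply, Sum.inl.injEq, reduceCtorEq, if_false] at h1
      have h3 := hle (fun k => mat g (Sum.inl k) (Sum.inl j)) i
      simp at h1 h3 h2
      nlinarith
    · nlinarith
  · rcases i with i | ⟨⟩
    · have h1 := hle (fun k => mat g (Sum.inl k) (Sum.inr ())) i
      simp only [hcol g] at h1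
      nlinarith
    · exact le_rfl

theorem isCompact_lorentz (n : ℕ) (M : ℝ) : IsCompact {A : Matrix (Idx n) (Idx n) ℝ |
    (∀ i j, A i j ∈ Set.Icc (-M) M) ∧ Aᵀ * J n * A = J n} := by
  have h1 : IsCompact (Set.pi Set.univ fun _ : Idx n => Set.pi Set.univ fun _ : Idx n =>
      Set.Icc (-M) M) :=
    isCompact_univ_pi fun _ => isCompact_univ_pi fun _ => isCompact_Icc
  have h2 : IsCompact {A : Matrix (Idx n) (Idx n) ℝ | ∀ i j, A i j ∈ Set.Icc (-M) M} := by
    have h3 : {A : Matrix (Idx n) (Idx n) ℝ | ∀ i j, A i j ∈ Set.Icc (-M) M} =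
        Set.pi Set.univ fun _ : Idx n => Set.pi Set.univ fun _ : Idx n => Set.Icc (-M) M :=
      Set.ext fun A => ⟨fun h i _ j _ => h i j, fun h i j => h i trivial j trivial⟩
    rw [h3]
    exact h1
  refine h2.inter_right (isClosed_eq ?_ continuous_const)
  exact ((continuous_id.matrix_transpose).matrix_mul continuous_const).matrix_mul continuous_id

theorem mat_mem_lorentz {g : SOPlus n} {M : ℝ} (hg : mat g (Sum.inr ()) (Sum.inr ()) ≤ M) :
    mat g ∈ {A : Matrix (Idx n) (Idx n) ℝ |
      (∀ i j, A i j ∈ Set.Icc (-M) M) ∧ Aᵀ * J n * A = J n} :=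
  ⟨fun i j => abs_le.1 ((abs_mat_le g i j).trans hg), mat_isom g⟩

/-- The topology of `G` is that of its matrices: inversion is the polynomial map
`A ↦ J Aᵀ J`. -/
theorem isInducing_mat : IsInducing (mat (n := n)) := by
  have h1 : IsInducing fun g : SOPlus n =>
      Units.embedProduct (Matrix (Idx n) (Idx n) ℝ) (g : (Matrix (Idx n) (Idx n) ℝ)ˣ) :=
    Units.isInducing_embedProduct.comp IsInducing.subtypeVal
  let F : Matrix (Idx n) (Idx n) ℝ → Matrix (Idx n) (Idx n) ℝ × (Matrix (Idx n) (Idx n) ℝ)ᵐᵒᵖ :=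
    fun A => (A, MulOpposite.op (J n * Aᵀ * J n))
  have hF : Continuous F := by
    refine continuous_id.prodMk (MulOpposite.continuous_op.comp ?_)
    exact (continuous_const.matrix_mul continuous_id.matrix_transpose).matrix_mul continuous_const
  have h2 : (fun g : SOPlus n =>
      Units.embedProduct (Matrix (Idx n) (Idx n) ℝ) (g : (Matrix (Idx n) (Idx n) ℝ)ˣ)) =
      F ∘ mat := by
    funext g
    refine Prod.ext rfl (congrArg MulOpposite.op ?_)
    exact mat_inv g
  rw [h2] at h1
  exact IsInducing.of_comp (Units.continuous_val.comp continuous_subtype_val) hF h1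

/-- A discrete group contains finitely many elements that move `O` by a bounded amount. -/
theorem finite_time_le (Γ : Subgroup (SOPlus n)) [DiscreteTopology Γ] (M : ℝ) :
    {γ : Γ | mat (γ : SOPlus n) (Sum.inr ()) (Sum.inr ()) ≤ M}.Finite := by
  by_contra hinf
  set S : Set Γ := {γ : Γ | mat (γ : SOPlus n) (Sum.inr ()) (Sum.inr ()) ≤ M}
  have hinj : Function.Injective fun γ : Γ => mat (γ : SOPlus n) :=
    mat_injective.comp Subtype.val_injective
  have hSinf : ((fun γ : Γ => mat (γ : SOPlus n)) '' S).Infinite :=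
    Set.Infinite.image hinj.injOn hinf
  obtain ⟨A, ⟨-, hA⟩, hacc⟩ := hSinf.exists_accPt_of_subset_isCompact (isCompact_lorentz n M)
    (by rintro _ ⟨γ, hγ, rfl⟩; exact mat_mem_lorentz hγ)
  have hind : IsInducing fun γ : Γ => mat (γ : SOPlus n) :=
    isInducing_mat.comp IsInducing.subtypeVal
  obtain ⟨O, hO, hO1⟩ := hind.isOpen_iff.1 (isOpen_discrete ({1} : Set Γ))
  have h1O : (1 : Matrix (Idx n) (Idx n) ℝ) ∈ O := by
    have : (1 : Γ) ∈ (fun γ : Γ => mat (γ : SOPlus n)) ⁻¹' O := by rw [hO1]; rfl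
    exact this
  let D : Matrix (Idx n) (Idx n) ℝ × Matrix (Idx n) (Idx n) ℝ → Matrix (Idx n) (Idx n) ℝ :=
    fun p => J n * p.1ᵀ * J n * p.2
  have hD : Continuous D :=
    ((continuous_const.matrix_mul continuous_fst.matrix_transpose).matrix_mul
      continuous_const).matrix_mul continuous_snd
  have hDA : D (A, A) = 1 := by
    change J n * Aᵀ * J n * A = 1
    rw [Matrix.mul_assoc, Matrix.mul_assoc, ← Matrix.mul_assoc Aᵀ, hA, J_mul_J]
  have hev : D ⁻¹' O ∈ 𝓝 (A, A) := (hO.preimage hD).mem_nhds (by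
    change D (A, A) ∈ O
    rw [hDA]; exact h1O)
  obtain ⟨N, hN, N', hN', hNN⟩ := mem_nhds_prod_iff.1 hev
  -- Two distinct elements close to an accumulation point have a quotient close to `1`.
  rw [accPt_iff_nhds] at hacc
  obtain ⟨_, ⟨⟨hy1, hy1'⟩, ⟨γ₁, hγ₁, rfl⟩⟩, hne1⟩ := hacc _ (Filter.inter_mem hN hN')
  obtain ⟨_, ⟨⟨⟨hy2, hy2'⟩, hy2ne⟩, ⟨γ₂, hγ₂, rfl⟩⟩, -⟩ := hacc _
    (Filter.inter_mem (Filter.inter_mem hN hN') (isOpen_ne.mem_nhds hne1.symm))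
  have hmem : (γ₁⁻¹ * γ₂ : Γ) ∈ (fun γ : Γ => mat (γ : SOPlus n)) ⁻¹' O := by
    have h3 : D (mat (γ₁ : SOPlus n), mat (γ₂ : SOPlus n)) ∈ O := hNN ⟨hy1, hy2'⟩
    have h4 : D (mat (γ₁ : SOPlus n), mat (γ₂ : SOPlus n)) =
        mat ((γ₁⁻¹ * γ₂ : Γ) : SOPlus n) := by
      change J n * (mat (γ₁ : SOPlus n))ᵀ * J n * mat (γ₂ : SOPlus n) = _
      rw [← mat_inv, ← mat_mul]; rfl
    rw [h4] at h3
    exact h3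
  rw [hO1] at hmem
  have h12 : γ₁ = γ₂ := inv_mul_eq_one.1 hmem
  exact hy2ne (by rw [h12])

end Discrete

/-! ### Convergence of the Poincaré series above the dimension -/

section Poincare

open MeasureTheory
open scoped NNReal ENNReal

variable {n : ℕ}

/-- The future timelike vectors `z` with `1 < -⟨z, z⟩ < 4`. -/
def shell (n : ℕ) : Set (Idx n → ℝ) :=
  {z | 0 < z (Sum.inr ()) ∧ 1 < -lorentz z z ∧ -lorentz z z < 4}

/-- The part `z_t < 2` of the shell. -/
def shellBall (n : ℕ) : Set (Idx n → ℝ) := {z | z ∈ shell n ∧ z (Sum.inr ()) < 2}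

theorem isOpen_shell : IsOpen (shell n) := by
  have h1 : Continuous fun z : Idx n → ℝ => -lorentz z z :=
    (continuous_lorentz continuous_id continuous_id).neg
  exact (isOpen_lt continuous_const (continuous_apply _)).inter
    ((isOpen_lt continuous_const h1).inter (isOpen_lt h1 continuous_const))

theorem isOpen_shellBall : IsOpen (shellBall n) :=
  isOpen_shell.inter (isOpen_lt (continuous_apply _) continuous_const)

theorem volume_shellBall_pos : 0 < volume (shellBall n) := by
  refine isOpen_shellBall.measure_pos _ ⟨(3 / 2 : ℝ) • basePt n, ?_⟩
  simp only [shellBall, shell, Set.mem_ofPred_eq, lorentz_smul_left, lorentz_smul_right,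
    (basePt_mem (n := n)).1]
  simp only [basePt, Pi.smul_apply, Sum.elim_inr, smul_eq_mul, Pi.one_apply]
  norm_num

/-- `-⟨x, w⟩` is comparable to `x_t w_t` for `x` in hyperbolic space and `w` in the shell. -/
theorem lorentz_shell_bounds {x w : Idx n → ℝ} (hx : x ∈ hyperboloid n) (hw : w ∈ shell n) :
    x (Sum.inr ()) ≤ 2 * w (Sum.inr ()) * -lorentz x w ∧
      -lorentz x w ≤ 2 * w (Sum.inr ()) * x (Sum.inr ()) := by
  obtain ⟨hw0, hw1, -⟩ := hw
  have hs := sum_sq_of_mem_hyperboloid hx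
  have hx1 := one_le_time hx
  have hws : ∑ i, w (Sum.inl i) * w (Sum.inl i) = w (Sum.inr ()) ^ 2 - -lorentz w w := by
    rw [lorentz_eq]; ring
  have hws0 : 0 ≤ ∑ i, w (Sum.inl i) * w (Sum.inl i) :=
    Finset.sum_nonneg fun i _ => mul_self_nonneg _
  set b := Real.sqrt (w (Sum.inr ()) ^ 2 - 1) with hb
  have hb0 : 0 ≤ b := Real.sqrt_nonneg _
  have hb2 : b ^ 2 = w (Sum.inr ()) ^ 2 - 1 := Real.sq_sqrt (by linarith)
  have habs := sum_mul_le Finset.univ (fun i => x (Sum.inl i)) (fun i => w (Sum.inl i))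
    (a := x (Sum.inr ())) (b := b) (by linarith) hb0 (by rw [hs]; linarith)
    (by rw [hws, hb2]; linarith)
  obtain ⟨h1, h2⟩ := abs_le.1 habs
  have hbw : b ≤ w (Sum.inr ()) := by nlinarith
  rw [lorentz_eq]
  constructor
  · have h3 : x (Sum.inr ()) * (w (Sum.inr ()) - b) ≤
        -(∑ i, x (Sum.inl i) * w (Sum.inl i) - x (Sum.inr ()) * w (Sum.inr ())) := by linarith
    have h4 : 1 ≤ 2 * w (Sum.inr ()) * (w (Sum.inr ()) - b) := by nlinarith
    calc x (Sum.inr ()) = x (Sum.inr ()) * 1 := (mul_one _).symm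
      _ ≤ x (Sum.inr ()) * (2 * w (Sum.inr ()) * (w (Sum.inr ()) - b)) :=
          mul_le_mul_of_nonneg_left h4 (by linarith)
      _ = 2 * w (Sum.inr ()) * (x (Sum.inr ()) * (w (Sum.inr ()) - b)) := by ring
      _ ≤ _ := mul_le_mul_of_nonneg_left h3 (by linarith)
  · nlinarith

theorem mat_mulVec_time (g : SOPlus n) (w : Idx n → ℝ) :
    (mat g *ᵥ w) (Sum.inr ()) = -lorentz (mat g⁻¹ *ᵥ basePt n) w := by
  rw [lorentz_mat_left, inv_inv, basePt_lorentz, neg_neg]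

theorem time_bounds (g : SOPlus n) {w : Idx n → ℝ} (hw : w ∈ shell n) :
    mat g (Sum.inr ()) (Sum.inr ()) ≤ 2 * w (Sum.inr ()) * (mat g *ᵥ w) (Sum.inr ()) ∧
      (mat g *ᵥ w) (Sum.inr ()) ≤ 2 * w (Sum.inr ()) * mat g (Sum.inr ()) (Sum.inr ()) := by
  have := lorentz_shell_bounds (mat_mem_hyperboloid g⁻¹ basePt_mem) hw
  rwa [← mat_mulVec_time, mat_basePt_time, mat_inv_time_time] at this

theorem mat_mem_shell (g : SOPlus n) {w : Idx n → ℝ} (hw : w ∈ shell n) :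
    mat g *ᵥ w ∈ shell n := by
  refine ⟨?_, ?_⟩
  · have h1 := (time_bounds g hw).1
    have h2 := one_le_mat_time g
    by_contra h
    push Not at h
    have := mul_nonpos_of_nonneg_of_nonpos (mul_nonneg zero_le_two hw.1.le) h
    linarith
  · rw [lorentz_mat]; exact hw.2

/-- The translate `γ · shellBall`. -/
def shellTranslate (g : SOPlus n) : Set (Idx n → ℝ) := (fun z => mat g⁻¹ *ᵥ z) ⁻¹' shellBall n

theorem measurableSet_shellTranslate (g : SOPlus n) : MeasurableSet (shellTranslate g) :=
  (isOpen_shellBall.preimage (continuous_const.matrix_mulVec continuous_id)).measurableSet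

theorem volume_shellTranslate (g : SOPlus n) :
    volume (shellTranslate g) = volume (shellBall n) := by
  have hdet : LinearMap.det (Matrix.toLin' (mat g⁻¹)) = 1 := by
    rw [LinearMap.det_toLin']; exact g⁻¹.2.2.1
  have h := Measure.addHaar_preimage_linearMap (volume : Measure (Idx n → ℝ))
    (f := Matrix.toLin' (mat g⁻¹)) (by rw [hdet]; exact one_ne_zero) (shellBall n)
  rw [hdet] at h
  exact h.trans (by simp)

theorem shellTranslate_bounds {g : SOPlus n} {z : Idx n → ℝ} (hz : z ∈ shellTranslate g) :
    z ∈ shell n ∧ mat g (Sum.inr ()) (Sum.inr ()) ≤ 4 * z (Sum.inr ()) ∧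
      z (Sum.inr ()) ≤ 4 * mat g (Sum.inr ()) (Sum.inr ()) := by
  have hw : mat g⁻¹ *ᵥ z ∈ shellBall n := hz
  have h1 := time_bounds g hw.1
  have h2 := mat_mem_shell g hw.1
  rw [mat_mulVec_inv_mulVec] at h1 h2
  have h3 := hw.2
  have h4 := hw.1.1
  have h5 := h2.1
  have h6 := one_le_mat_time g
  exact ⟨h2, by nlinarith, by nlinarith⟩

/-- The translates of the shell ball under a discrete group overlap a bounded number of times. -/
theorem exists_multiplicity_bound (Γ : Subgroup (SOPlus n)) [DiscreteTopology Γ] :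
    ∃ N : ℕ, ∀ (s : Finset Γ) (z : Idx n → ℝ),
      ∑ γ ∈ s, (shellTranslate (γ : SOPlus n)).indicator (1 : (Idx n → ℝ) → ℝ≥0∞) z ≤ N := by
  classical
  refine ⟨(finite_time_le Γ 8).toFinset.card, fun s z => ?_⟩
  have h1 : ∑ γ ∈ s, (shellTranslate (γ : SOPlus n)).indicator (1 : (Idx n → ℝ) → ℝ≥0∞) z =
      (s.filter fun γ : Γ => z ∈ shellTranslate (γ : SOPlus n)).card := by
    simp only [Set.indicator_apply, Pi.one_apply, Finset.sum_boole]
  rw [h1, Nat.cast_le]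
  rcases (s.filter fun γ : Γ => z ∈ shellTranslate (γ : SOPlus n)).eq_empty_or_nonempty with h | h
  · rw [h]; simp
  · obtain ⟨γ₀, hγ₀⟩ := h
    have hz₀ : z ∈ shellTranslate (γ₀ : SOPlus n) := (Finset.mem_filter.1 hγ₀).2
    refine Finset.card_le_card_of_injOn (fun γ => γ₀⁻¹ * γ) (fun γ hγ => ?_)
      fun γ _ γ' _ h => mul_left_cancel h
    have hz : z ∈ shellTranslate (γ : SOPlus n) := (Finset.mem_filter.1 hγ).2
    have hw₀ : mat (γ₀ : SOPlus n)⁻¹ *ᵥ z ∈ shellBall n := hz₀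
    have hw : mat (γ : SOPlus n)⁻¹ *ᵥ z ∈ shellBall n := hz
    have h2 := (time_bounds ((γ₀ : SOPlus n)⁻¹ * (γ : SOPlus n)) hw.1).1
    rw [mat_mul, ← Matrix.mulVec_mulVec, mat_mulVec_inv_mulVec, ← mat_mul] at h2
    simp only [Set.Finite.coe_toFinset, Set.mem_ofPred_eq]
    change mat ((γ₀ : SOPlus n)⁻¹ * (γ : SOPlus n)) (Sum.inr ()) (Sum.inr ()) ≤ 8
    have h3 := hw.2
    have h4 := hw₀.2
    have h5 := hw.1.1
    have h6 := hw₀.1.1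
    nlinarith

theorem norm_sq_le_sum_sq {m : ℕ} (x : Fin m → ℝ) : ‖x‖ ^ 2 ≤ ∑ i, x i * x i := by
  have h0 : 0 ≤ ∑ i, x i * x i := Finset.sum_nonneg fun i _ => mul_self_nonneg _
  have h1 : ‖x‖ ≤ Real.sqrt (∑ i, x i * x i) := by
    refine (pi_norm_le_iff_of_nonneg (Real.sqrt_nonneg _)).2 fun i => ?_
    refine Real.le_sqrt_of_sq_le ?_
    rw [Real.norm_eq_abs, sq_abs, pow_two]
    exact Finset.single_le_sum (f := fun i => x i * x i) (fun i _ => mul_self_nonneg _)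
      (Finset.mem_univ i)
  calc ‖x‖ ^ 2 ≤ Real.sqrt (∑ i, x i * x i) ^ 2 := by gcongr
    _ = _ := Real.sq_sqrt h0

/-- The fibre of the shell over `x` is an interval of length at most `3 (1 + |x|²)^{-1/2}`. -/
theorem lintegral_shell_fibre_le (x : Fin (n + 1) → ℝ) {p : ℝ} (hp : 0 ≤ p) :
    ∫⁻ t : ℝ, (shell n).indicator (fun z => ENNReal.ofReal (z (Sum.inr ()) ^ (-p)))
      (Sum.elim x fun _ => t) ≤ ENNReal.ofReal (3 * (1 + ‖x‖ ^ 2) ^ (-(p + 1) / 2)) := by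
  set r := ∑ i, x i * x i with hr
  have hr0 : 0 ≤ r := Finset.sum_nonneg fun i _ => mul_self_nonneg _
  have hxr : ‖x‖ ^ 2 ≤ r := norm_sq_le_sum_sq x
  set a := Real.sqrt (1 + r) with ha
  set b := Real.sqrt (4 + r) with hb
  have ha0 : 0 < a := Real.sqrt_pos.2 (by linarith)
  have ha2 : a ^ 2 = 1 + r := Real.sq_sqrt (by linarith)
  have hb2 : b ^ 2 = 4 + r := Real.sq_sqrt (by linarith)
  have hb0 : 0 ≤ b := Real.sqrt_nonneg _
  have hle : ∀ t : ℝ, (shell n).indicator (fun z => ENNReal.ofReal (z (Sum.inr ()) ^ (-p)))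
      (Sum.elim x fun _ => t) ≤
      (Set.Icc a b).indicator (fun _ => ENNReal.ofReal (a ^ (-p))) t := by
    intro t
    by_cases ht : (Sum.elim x fun _ => t : Idx n → ℝ) ∈ shell n
    · obtain ⟨h1, h2, h3⟩ := id ht
      rw [lorentz_eq] at h2 h3
      simp only [Sum.elim_inl, Sum.elim_inr, ← hr] at h1 h2 h3
      have hat : a ≤ t := by nlinarith
      have htb : t ≤ b := by nlinarith
      rw [Set.indicator_of_mem ht, Set.indicator_of_mem (show t ∈ Set.Icc a b from ⟨hat, htb⟩)]
      refine ENNReal.ofReal_le_ofReal ?_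
      exact Real.rpow_le_rpow_of_nonpos ha0 hat (by linarith)
    · rw [Set.indicator_of_notMem ht]
      exact zero_le
  refine (lintegral_mono hle).trans ?_
  rw [lintegral_indicator measurableSet_Icc, setLIntegral_const, Real.volume_Icc,
    ← ENNReal.ofReal_mul (by positivity)]
  refine ENNReal.ofReal_le_ofReal ?_
  have h1 : b - a ≤ 3 * a⁻¹ := by
    rw [← div_eq_mul_inv, le_div_iff₀ ha0]
    nlinarith
  calc a ^ (-p) * (b - a) ≤ a ^ (-p) * (3 * a⁻¹) :=
        mul_le_mul_of_nonneg_left h1 (by positivity)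
    _ = 3 * (a ^ (-p) * a ^ (-1 : ℝ)) := by rw [Real.rpow_neg_one]; ring
    _ = 3 * (1 + r) ^ (-(p + 1) / 2) := by
        rw [← Real.rpow_add ha0, ha, Real.sqrt_eq_rpow, ← Real.rpow_mul (by linarith)]
        ring_nf
    _ ≤ 3 * (1 + ‖x‖ ^ 2) ^ (-(p + 1) / 2) := by
        refine mul_le_mul_of_nonneg_left ?_ (by norm_num)
        exact Real.rpow_le_rpow_of_nonpos (by positivity) (by linarith) (by linarith)

theorem lintegral_shell_lt_top {p : ℝ} (hp : (n : ℝ) < p) :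
    ∫⁻ z, (shell n).indicator (fun z => ENNReal.ofReal (z (Sum.inr ()) ^ (-p))) z < ⊤ := by
  set f : (Idx n → ℝ) → ℝ≥0∞ :=
    (shell n).indicator fun z => ENNReal.ofReal (z (Sum.inr ()) ^ (-p)) with hf
  have hfm : Measurable f := by
    refine Measurable.indicator ?_ isOpen_shell.measurableSet
    exact ((measurable_pi_apply _).pow_const _).ennreal_ofReal
  have hp0 : 0 ≤ p := (Nat.cast_nonneg n).trans hp.le
  have e1 := volume_measurePreserving_sumPiEquivProdPi_symm fun _ : Idx n => ℝ
  have e2 := (volume_preserving_funUnique Unit ℝ).symm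
  rw [← e1.lintegral_comp hfm, Measure.volume_eq_prod,
    lintegral_prod (fun a => f ((MeasurableEquiv.sumPiEquivProdPi fun _ : Idx n => ℝ).symm a))
      (hfm.comp e1.measurable).aemeasurable]
  have hint := integrable_rpow_neg_one_add_norm_sq (E := Fin (n + 1) → ℝ) (μ := volume)
    (r := p + 1) (by simpa using hp)
  refine lt_of_le_of_lt (lintegral_mono fun x => ?_) (hint.const_mul 3).lintegral_lt_top
  have h1 : Measurable fun y : Unit → ℝ =>
      f ((MeasurableEquiv.sumPiEquivProdPi fun _ : Idx n => ℝ).symm (x, y)) :=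
    (hfm.comp e1.measurable).comp measurable_prodMk_left
  rw [← e2.lintegral_comp h1]
  refine le_trans (le_of_eq ?_) (lintegral_shell_fibre_le x hp0)
  refine lintegral_congr fun t => ?_
  congr 1

/-- Packing estimate: for a discrete group, `∑ cosh(d(O, γO))^{-p}` converges for `p > n`. The
translates of a ball in the shell have the same volume, since `det γ = 1`, and bounded overlap; so
the sum is dominated by the integral of `z_t^{-p}` over the shell. -/
theorem summable_time_rpow (Γ : Subgroup (SOPlus n)) [DiscreteTopology Γ] {p : ℝ}
    (hp : (n : ℝ) < p) :
    Summable fun γ : Γ => mat (γ : SOPlus n) (Sum.inr ()) (Sum.inr ()) ^ (-p) := by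
  obtain ⟨N, hN⟩ := exists_multiplicity_bound Γ
  have hp0 : 0 ≤ p := (Nat.cast_nonneg n).trans hp.le
  set F : (Idx n → ℝ) → ℝ≥0∞ :=
    (shell n).indicator fun z => ENNReal.ofReal (z (Sum.inr ()) ^ (-p)) with hF
  have hFm : Measurable F := by
    refine Measurable.indicator ?_ isOpen_shell.measurableSet
    exact ((measurable_pi_apply _).pow_const _).ennreal_ofReal
  set c : ℝ≥0∞ := ENNReal.ofReal (4 ^ p)
  set a : Γ → ℝ≥0∞ := fun γ =>
    ENNReal.ofReal (mat (γ : SOPlus n) (Sum.inr ()) (Sum.inr ()) ^ (-p)) with ha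
  have hpt : ∀ (γ : Γ) (z : Idx n → ℝ),
      (shellTranslate (γ : SOPlus n)).indicator (fun _ => a γ) z ≤
        (shellTranslate (γ : SOPlus n)).indicator (1 : (Idx n → ℝ) → ℝ≥0∞) z * (c * F z) := by
    intro γ z
    by_cases hz : z ∈ shellTranslate (γ : SOPlus n)
    · obtain ⟨h1, -, h3⟩ := shellTranslate_bounds hz
      rw [Set.indicator_of_mem hz, Set.indicator_of_mem hz, Pi.one_apply, one_mul, hF,
        Set.indicator_of_mem h1, ← ENNReal.ofReal_mul (by positivity)]
      refine ENNReal.ofReal_le_ofReal ?_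
      have h4 := one_le_mat_time (γ : SOPlus n)
      have h5 := h1.1
      calc mat (γ : SOPlus n) (Sum.inr ()) (Sum.inr ()) ^ (-p)
          ≤ (z (Sum.inr ()) / 4) ^ (-p) :=
            Real.rpow_le_rpow_of_nonpos (by positivity) (by linarith) (by linarith)
        _ = 4 ^ p * z (Sum.inr ()) ^ (-p) := by
            rw [Real.div_rpow h5.le (by norm_num), Real.rpow_neg (by norm_num : (0 : ℝ) ≤ 4),
              div_inv_eq_mul, mul_comm]
    · rw [Set.indicator_of_notMem hz]
      exact zero_le
  have hfin : ∀ s : Finset Γ, (∑ γ ∈ s, a γ) * volume (shellBall n) ≤ N * (c * ∫⁻ z, F z) := by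
    intro s
    calc (∑ γ ∈ s, a γ) * volume (shellBall n)
        = ∑ γ ∈ s, ∫⁻ z, (shellTranslate (γ : SOPlus n)).indicator (fun _ => a γ) z := by
          rw [Finset.sum_mul]
          refine Finset.sum_congr rfl fun γ _ => ?_
          rw [lintegral_indicator (measurableSet_shellTranslate _), setLIntegral_const,
            volume_shellTranslate]
      _ = ∫⁻ z, ∑ γ ∈ s, (shellTranslate (γ : SOPlus n)).indicator (fun _ => a γ) z := by
          rw [lintegral_finsetSum]
          exact fun γ _ => measurable_const.indicator (measurableSet_shellTranslate _)
      _ ≤ ∫⁻ z, N * (c * F z) := by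
          refine lintegral_mono fun z => ?_
          refine (Finset.sum_le_sum fun γ _ => hpt γ z).trans ?_
          rw [← Finset.sum_mul]
          exact mul_le_mul_left (hN s z) _
      _ = N * (c * ∫⁻ z, F z) := by
          rw [lintegral_const_mul _ (hFm.const_mul _), lintegral_const_mul _ hFm]
  have hvol := (volume_shellBall_pos (n := n)).ne'
  have hvolt : volume (shellBall n) ≠ ⊤ := by
    refine ((measure_mono fun z hz => ?_).trans_lt
      (measure_closedBall_lt_top (x := (0 : Idx n → ℝ)) (r := 2))).ne
    obtain ⟨⟨h1, h2, -⟩, h3⟩ := hz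
    rw [lorentz_eq] at h2
    refine mem_closedBall_zero_iff.2 ((pi_norm_le_iff_of_nonneg zero_le_two).2 ?_)
    rintro (i | ⟨⟩)
    · have h4 := Finset.single_le_sum (f := fun i => z (Sum.inl i) * z (Sum.inl i))
        (fun i _ => mul_self_nonneg _) (Finset.mem_univ i)
      exact abs_le_of_sq_le_sq (by nlinarith) zero_le_two
    · rw [Real.norm_eq_abs, abs_of_pos h1]
      exact h3.le
  have htop : (N * (c * ∫⁻ z, F z)) / volume (shellBall n) < ⊤ := by
    refine ENNReal.div_lt_top ?_ hvol
    exact (ENNReal.mul_lt_top (by simp) (ENNReal.mul_lt_top ENNReal.ofReal_lt_top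
      (lintegral_shell_lt_top hp))).ne
  have htsum : ∑' γ, a γ ≠ ⊤ := by
    refine (lt_of_le_of_lt ?_ htop).ne
    rw [ENNReal.tsum_eq_iSup_sum]
    exact iSup_le fun s => (ENNReal.le_div_iff_mul_le (Or.inl hvol) (Or.inl hvolt)).2 (hfin s)
  refine (ENNReal.summable_toReal htsum).congr fun γ => ?_
  exact ENNReal.toReal_ofReal (Real.rpow_nonneg ((zero_le_one.trans (one_le_mat_time _))) _)

theorem neg_lorentz_basePt_mat (g : SOPlus n) : -lorentz (basePt n) (mat g *ᵥ basePt n) =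
    mat g (Sum.inr ()) (Sum.inr ()) := by
  rw [basePt_lorentz, neg_neg, mat_basePt_time]

theorem hypDist_basePt_nonneg (g : SOPlus n) :
    0 ≤ hypDist (basePt n) (mat g *ᵥ basePt n) := by
  rw [hypDist, neg_lorentz_basePt_mat]
  exact Real.arcosh_nonneg (one_le_mat_time g)

theorem time_le_exp_hypDist (g : SOPlus n) :
    mat g (Sum.inr ()) (Sum.inr ()) ≤ Real.exp (hypDist (basePt n) (mat g *ᵥ basePt n)) := by
  rw [hypDist, neg_lorentz_basePt_mat, Real.exp_arcosh (one_le_mat_time g)]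
  linarith [Real.sqrt_nonneg (mat g (Sum.inr ()) (Sum.inr ()) ^ 2 - 1)]

theorem exp_hypDist_le (g : SOPlus n) :
    Real.exp (hypDist (basePt n) (mat g *ᵥ basePt n)) ≤ 2 * mat g (Sum.inr ()) (Sum.inr ()) := by
  have h := one_le_mat_time g
  rw [hypDist, neg_lorentz_basePt_mat, Real.exp_arcosh h]
  have : Real.sqrt (mat g (Sum.inr ()) (Sum.inr ()) ^ 2 - 1) ≤ mat g (Sum.inr ()) (Sum.inr ()) :=
    Real.sqrt_le_iff.2 ⟨by linarith, by linarith⟩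
  linarith

theorem poincareConverges_of_lt (Γ : Subgroup (SOPlus n)) [DiscreteTopology Γ] {s : ℝ}
    (hs : (n : ℝ) < s) : PoincareConverges Γ s := by
  have hs0 : 0 ≤ s := (Nat.cast_nonneg n).trans hs.le
  refine Summable.of_nonneg_of_le (fun γ => (Real.exp_pos _).le) (fun γ => ?_)
    (summable_time_rpow Γ hs)
  have h1 := one_le_mat_time (γ : SOPlus n)
  rw [mul_comm, Real.exp_mul]
  exact Real.rpow_le_rpow_of_nonpos (by linarith) (time_le_exp_hypDist _) (by linarith)

theorem PoincareConverges.mono {Γ : Subgroup (SOPlus n)} {s s' : ℝ} (h : PoincareConverges Γ s)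
    (hs : s ≤ s') : PoincareConverges Γ s' := by
  refine Summable.of_nonneg_of_le (fun γ => (Real.exp_pos _).le) (fun γ => ?_) h
  refine Real.exp_le_exp.2 (mul_le_mul_of_nonneg_right (by linarith) ?_)
  exact hypDist_basePt_nonneg _

/-- The critical exponent is at most `n`, so the Poincaré series converges at `n` if it converges
at the critical exponent or the critical exponent is less than `n`. -/
theorem poincareConverges_of_convergenceType (Γ : Subgroup (SOPlus n)) [DiscreteTopology Γ]
    (h : IsConvergenceType Γ ∨ criticalExponent Γ < n) : PoincareConverges Γ n := by
  rcases h with h | h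
  · refine PoincareConverges.mono h ?_
    by_cases hb : BddBelow {s : ℝ | PoincareConverges Γ s}
    · refine le_of_forall_gt_imp_ge_of_dense fun s hs => ?_
      exact csInf_le hb (poincareConverges_of_lt Γ hs)
    -- A set without lower bound (as for finite `Γ`) has `sInf = 0`.
    · rw [criticalExponent, Real.sInf_of_not_bddBelow hb]
      exact Nat.cast_nonneg n
  · obtain ⟨s, hs, hsn⟩ := exists_lt_of_csInf_lt
      ⟨(n : ℝ) + 1, poincareConverges_of_lt Γ (lt_add_one _)⟩ h
    exact PoincareConverges.mono hs hsn.le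

end Poincare

/-! ### Full rank parabolic fixed points: heights of the orbit -/

section Heights

open Topology

variable {n : ℕ}

theorem mem_hyperboloid_of_lorentz_neg {x ξ : Idx n → ℝ} (hξ : ξ ∈ boundary n)
    (hx : lorentz x x = -1) (hxξ : lorentz x ξ < 0) : x ∈ hyperboloid n := by
  refine ⟨hx, ?_⟩
  by_contra h
  push Not at h
  have h1 : lorentz x x = -1 := hx
  rw [lorentz_eq] at h1
  have h2 : 0 ≤ ∑ i, x (Sum.inl i) * x (Sum.inl i) :=
    Finset.sum_nonneg fun i _ => mul_self_nonneg _
  have h3 : -x ∈ hyperboloid n := by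
    refine ⟨by rw [lorentz_neg_left, lorentz_neg_right, neg_neg, hx], ?_⟩
    rw [Pi.neg_apply]
    nlinarith
  have h4 := lorentz_boundary_neg h3 hξ
  rw [lorentz_neg_left] at h4
  linarith

/-- The transpose of `p` has the same eigenvalues as `p`, and `p⁻¹ = J pᵀ J`; so the inverse of an
eigenvalue is an eigenvalue. -/
theorem exists_eigenvector_inv (p : SOPlus n) {c : ℝ} {w : Idx n → ℝ} (hc : c ≠ 0) (hw : w ≠ 0)
    (h : mat p *ᵥ w = c • w) : ∃ z ≠ 0, mat p *ᵥ z = c⁻¹ • z := by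
  have h1 : (mat p - c • 1).det = 0 := Matrix.exists_mulVec_eq_zero_iff.1 ⟨w, hw, by
    rw [Matrix.sub_mulVec, h, Matrix.smul_mulVec, Matrix.one_mulVec, sub_self]⟩
  rw [← Matrix.det_transpose] at h1
  obtain ⟨y, hy, hyp⟩ := Matrix.exists_mulVec_eq_zero_iff.2 h1
  rw [Matrix.transpose_sub, Matrix.transpose_smul, Matrix.transpose_one, Matrix.sub_mulVec,
    Matrix.smul_mulVec, Matrix.one_mulVec, sub_eq_zero] at hyp
  have h2 : mat p⁻¹ *ᵥ (J n *ᵥ y) = c • (J n *ᵥ y) := by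
    rw [mat_inv, Matrix.mulVec_mulVec, Matrix.mul_assoc, J_mul_J, Matrix.mul_one,
      ← Matrix.mulVec_mulVec, hyp, Matrix.mulVec_smul]
  refine ⟨J n *ᵥ y, fun h0 => hy ?_, ?_⟩
  · have := congrArg (fun z => J n *ᵥ z) h0
    simpa [Matrix.mulVec_mulVec, J_mul_J] using this
  · have h3 := congrArg (fun z => c⁻¹ • (mat p *ᵥ z)) h2
    simp only [mat_mulVec_inv_mulVec, Matrix.mulVec_smul, smul_smul, inv_mul_cancel₀ hc,
      one_smul] at h3
    exact h3.symm

/-- A parabolic element fixes the null vector of its fixed point, not only the null ray: otherwise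
it would have a second fixed point at infinity. -/
theorem IsParabolic.mulVec_eq {p : SOPlus n} (hp : IsParabolic p) {ξ : Idx n → ℝ}
    (hξ : ξ ∈ boundary n) (hpξ : p ∈ parabolicSubgroup ξ) : mat p *ᵥ ξ = ξ := by
  obtain ⟨c, hc, hcξ⟩ := id hpξ
  by_cases h1 : c = 1
  · rw [hcξ, h1, one_smul]
  exfalso
  have hξ0 : ξ ≠ 0 := fun h => by
    have := hξ.2
    rw [h] at this
    simp at this
  obtain ⟨z, hz0, hz⟩ := exists_eigenvector_inv p hc.ne' hξ0 hcξ
  have hzz : lorentz z z = 0 := by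
    have h2 := lorentz_mat p z z
    rw [hz, lorentz_smul_left, lorentz_smul_right] at h2
    have h3 : (1 - c ^ 2) * lorentz z z = 0 := by
      field_simp at h2
      linear_combination h2
    rcases mul_eq_zero.1 h3 with h | h
    · exact absurd (by nlinarith : c = 1) h1
    · exact h
  have hzt : z (Sum.inr ()) ≠ 0 := fun h => hz0 <| by
    have h2 : ∑ i, z (Sum.inl i) * z (Sum.inl i) = 0 := by
      rw [lorentz_eq, h] at hzz
      linarith
    have h3 := (Finset.sum_eq_zero_iff_of_nonneg fun i _ => mul_self_nonneg _).1 h2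
    ext (i | ⟨⟩)
    · exact mul_self_eq_zero.1 (h3 i (Finset.mem_univ i))
    · exact h
  set η := (z (Sum.inr ()))⁻¹ • z with hη
  have hηb : η ∈ boundary n := by
    refine ⟨by rw [hη, lorentz_smul_left, lorentz_smul_right, hzz]; simp, ?_⟩
    simp [hη, hzt]
  have hpη : mat p *ᵥ η = c⁻¹ • η := by
    rw [hη, Matrix.mulVec_smul, hz, smul_comm]
  have heq : η = ξ := hp.2.unique ⟨hηb, c⁻¹, inv_pos.2 hc, hpη⟩ ⟨hξ, hpξ⟩
  rw [heq, hcξ] at hpη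
  have h2 := congrFun hpη (Sum.inr ())
  simp only [Pi.smul_apply, hξ.2, smul_eq_mul, mul_one] at h2
  field_simp at h2
  exact h1 (by nlinarith)

/-- The orbit points can be moved by `Γ_ξ` into a cylinder over a compact set: `-⟨γ O, ξ⟩ = β`
and `x ↦ β x + (1 - β²)/(2β) ξ` maps the horosphere through `O` to the horosphere of `γ O`. -/
theorem exists_translate_mem {Γ : Subgroup (SOPlus n)} {ξ : Idx n → ℝ} (hξ : ξ ∈ boundary n)
    {C : Set (Idx n → ℝ)} (hC : C ⊆ horosphere ξ)
    (hCΓ : ∀ x ∈ horosphere ξ, ∃ γ ∈ Γ ⊓ parabolicSubgroup ξ, mat γ *ᵥ x ∈ C) (γ : SOPlus n) :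
    ∃ q ∈ Γ ⊓ parabolicSubgroup ξ, mat q *ᵥ ξ = ξ ∧ ∃ x ∈ C,
      mat (q * γ) *ᵥ basePt n = (-lorentz (mat γ *ᵥ basePt n) ξ) • x +
        ((1 - (-lorentz (mat γ *ᵥ basePt n) ξ) ^ 2) / (2 * -lorentz (mat γ *ᵥ basePt n) ξ)) • ξ := by
  have hy : mat γ *ᵥ basePt n ∈ hyperboloid n := mat_mem_hyperboloid γ basePt_mem
  have hneg := lorentz_boundary_neg hy hξ
  have hyy := hy.1
  simp only [mat_mul, ← Matrix.mulVec_mulVec]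
  set y := mat γ *ᵥ basePt n
  set β := -lorentz y ξ with hβ
  have hyξ : lorentz y ξ = -β := by rw [hβ, neg_neg]
  have hβ0 : 0 < β := by linarith
  set s := (1 - β ^ 2) / (2 * β) with hs
  have hx : β⁻¹ • (y - s • ξ) ∈ horosphere ξ := by
    have h1 : lorentz (β⁻¹ • (y - s • ξ)) ξ = -1 := by
      rw [lorentz_smul_left, lorentz_sub_left, lorentz_smul_left, hξ.1, hyξ]
      field_simp
      ring
    refine ⟨mem_hyperboloid_of_lorentz_neg hξ ?_ (by rw [h1]; norm_num), ?_⟩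
    · rw [lorentz_smul_left, lorentz_smul_right, lorentz_sub_left, lorentz_sub_right,
        lorentz_sub_right, lorentz_smul_left, lorentz_smul_right, lorentz_smul_left,
        lorentz_smul_right, hξ.1, lorentz_comm ξ y, hyξ, hyy, hs]
      field_simp
      ring
    · rw [h1, basePt_lorentz_boundary hξ]
  obtain ⟨q, hq, hqC⟩ := hCΓ _ hx
  obtain ⟨c, -, hc⟩ := hq.2
  have hc1 : c = 1 := by
    have h1 := lorentz_mat q (β⁻¹ • (y - s • ξ)) ξ
    rw [hc, lorentz_smul_right, (hC hqC).2, hx.2, basePt_lorentz_boundary hξ] at h1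
    linarith
  rw [hc1, one_smul] at hc
  refine ⟨q, hq, hc, _, hqC, ?_⟩
  rw [Matrix.mulVec_smul, smul_smul, mul_inv_cancel₀ hβ0.ne', one_smul, Matrix.mulVec_sub,
    Matrix.mulVec_smul, hc, sub_add_cancel]

/-- On a discrete group, `cosh d(O, γ O)` takes no values just above `1`. -/
theorem exists_gap (Γ : Subgroup (SOPlus n)) [DiscreteTopology Γ] : ∃ ε > 0, ∀ γ ∈ Γ,
    mat γ (Sum.inr ()) (Sum.inr ()) < 1 + ε → mat γ (Sum.inr ()) (Sum.inr ()) = 1 := by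
  set T : Set ℝ := (fun γ : Γ => mat (γ : SOPlus n) (Sum.inr ()) (Sum.inr ())) ''
    {γ : Γ | mat (γ : SOPlus n) (Sum.inr ()) (Sum.inr ()) ≤ 2} \ {1}
  have hT : T.Finite := ((finite_time_le Γ 2).image _).subset Set.sdiff_subset
  obtain ⟨ε, hε, hball⟩ := Metric.isOpen_iff.1 hT.isClosed.isOpen_compl 1 fun h => h.2 rfl
  refine ⟨min ε 1, lt_min hε one_pos, fun γ hγ h => ?_⟩
  by_contra hne
  have h1 := one_le_mat_time γ
  have h2 := min_le_left ε 1
  have h3 := min_le_right ε 1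
  refine hball (a := mat γ (Sum.inr ()) (Sum.inr ())) ?_ ⟨⟨⟨γ, hγ⟩, ?_, rfl⟩, hne⟩
  · rw [Metric.mem_ball, Real.dist_eq, abs_lt]
    constructor <;> linarith
  · change mat γ (Sum.inr ()) (Sum.inr ()) ≤ 2
    linarith

theorem mulVec_basePt_of_time_eq_one {g : SOPlus n}
    (h : mat g (Sum.inr ()) (Sum.inr ()) = 1) : mat g *ᵥ basePt n = basePt n := by
  have h1 := sum_sq_of_mem_hyperboloid (mat_mem_hyperboloid g basePt_mem)
  rw [mat_basePt_time, h] at h1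
  have h2 := (Finset.sum_eq_zero_iff_of_nonneg fun i _ => mul_self_nonneg _).1
    (h1.trans (by norm_num))
  ext (i | ⟨⟩)
  · rw [mul_self_eq_zero.1 (h2 i (Finset.mem_univ i))]; simp [basePt]
  · rw [mat_basePt_time, h]; simp [basePt]

/-- The heights `1/β`, `β = -⟨γ O, ξ⟩`, of the orbit points are bounded: a parabolic element of
`Γ_ξ` displaces points of great height by small amounts, which discreteness forbids. -/
theorem exists_height_bound {Γ : Subgroup (SOPlus n)} [DiscreteTopology Γ] {ξ : Idx n → ℝ}
    (h : IsFullRankParabolicFixedPoint Γ ξ) :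
    ∃ b > 0, ∀ γ ∈ Γ, b ≤ -lorentz (mat γ *ᵥ basePt n) ξ := by
  obtain ⟨hξ, ⟨p, hp, hpar⟩, C, hC, hCc, hCΓ⟩ := h
  have hpξ := hpar.mulVec_eq hξ hp.2
  obtain ⟨ε, hε, hgap⟩ := exists_gap Γ
  have hcont : Continuous fun x : Idx n → ℝ => lorentz (mat p *ᵥ x - x) (mat p *ᵥ x - x) := by
    have h1 : Continuous fun x : Idx n → ℝ => mat p *ᵥ x - x :=
      (continuous_const.matrix_mulVec continuous_id).sub continuous_id
    exact continuous_lorentz h1 h1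
  obtain ⟨M, hM⟩ := (hCc.image hcont).bddAbove
  have hM' : ∀ x ∈ C, lorentz (mat p *ᵥ x - x) (mat p *ᵥ x - x) ≤ max M 1 :=
    fun x hx => (hM ⟨x, hx, rfl⟩).trans (le_max_left _ _)
  set M₁ := max M 1
  have hM₁ : 0 < M₁ := lt_max_of_lt_right one_pos
  refine ⟨Real.sqrt (2 * ε / M₁), Real.sqrt_pos.2 (by positivity), fun γ hγ => ?_⟩
  have hβ0 : 0 < -lorentz (mat γ *ᵥ basePt n) ξ := by
    have := lorentz_boundary_neg (mat_mem_hyperboloid γ basePt_mem) hξ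
    linarith
  obtain ⟨q, hq, hqξ, x, hxC, hx⟩ := exists_translate_mem hξ hC hCΓ γ
  set β := -lorentz (mat γ *ᵥ basePt n) ξ
  rw [Real.sqrt_le_left hβ0.le]
  by_contra hlt
  push Not at hlt
  rw [lt_div_iff₀ hM₁] at hlt
  set g := q * γ with hg
  have hgΓ : g ∈ Γ := Γ.mul_mem hq.1 hγ
  have hz := mat_mem_hyperboloid g (basePt_mem (n := n))
  have hdiff : mat p *ᵥ (mat g *ᵥ basePt n) - mat g *ᵥ basePt n = β • (mat p *ᵥ x - x) := by
    rw [hx, Matrix.mulVec_add, Matrix.mulVec_smul, Matrix.mulVec_smul, hpξ, smul_sub]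
    abel
  -- The displacement of `O` under `g⁻¹ p g` is that of `g O` under `p`, of order `β`.
  have htime : mat (g⁻¹ * p * g) (Sum.inr ()) (Sum.inr ()) =
      1 + β ^ 2 * lorentz (mat p *ᵥ x - x) (mat p *ᵥ x - x) / 2 := by
    have h1 : lorentz (β • (mat p *ᵥ x - x)) (β • (mat p *ᵥ x - x)) =
        -2 - 2 * lorentz (mat p *ᵥ (mat g *ᵥ basePt n)) (mat g *ᵥ basePt n) := by
      rw [← hdiff, lorentz_sub_left, lorentz_sub_right, lorentz_sub_right, lorentz_mat, hz.1,
        lorentz_comm (mat g *ᵥ basePt n) (mat p *ᵥ _)]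
      ring
    have h2 : mat (g⁻¹ * p * g) (Sum.inr ()) (Sum.inr ()) =
        -lorentz (mat p *ᵥ (mat g *ᵥ basePt n)) (mat g *ᵥ basePt n) := by
      rw [← neg_lorentz_basePt_mat, mat_mul, mat_mul, ← Matrix.mulVec_mulVec,
        ← Matrix.mulVec_mulVec, lorentz_comm, lorentz_mat_left, inv_inv]
    rw [lorentz_smul_left, lorentz_smul_right] at h1
    rw [h2]
    linarith
  have hone := hgap _ (Γ.mul_mem (Γ.mul_mem (Γ.inv_mem hgΓ) hp.1) hgΓ) (by
    rw [htime]
    have := mul_le_mul_of_nonneg_left (hM' x hxC) (sq_nonneg β)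
    linarith)
  -- So `p` would fix the point `g O`, but it is parabolic.
  have hfix := mulVec_basePt_of_time_eq_one hone
  refine hpar.1 _ hz ?_
  have h3 := congrArg (fun w => mat g *ᵥ w) hfix
  simpa only [mat_mul, ← Matrix.mulVec_mulVec, mat_mulVec_inv_mulVec] using h3

theorem mat_pow_mulVec {γ : SOPlus n} {ξ : Idx n → ℝ} {c : ℝ} (h : mat γ *ᵥ ξ = c • ξ) (k : ℕ) :
    mat (γ ^ k) *ᵥ ξ = c ^ k • ξ := by
  induction k with
  | zero => rw [pow_zero, pow_zero, mat_one, Matrix.one_mulVec, one_smul]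
  | succ k ih => rw [pow_succ', mat_mul, ← Matrix.mulVec_mulVec, ih, Matrix.mulVec_smul, h,
      smul_smul, pow_succ]

/-- All elements of `Γ_ξ` preserve the horospheres at `ξ`; powers of any other element would
violate the bound on heights. -/
theorem mulVec_eq_of_mem_parabolicSubgroup {Γ : Subgroup (SOPlus n)} [DiscreteTopology Γ]
    {ξ : Idx n → ℝ} (h : IsFullRankParabolicFixedPoint Γ ξ) {γ : SOPlus n}
    (hγ : γ ∈ Γ ⊓ parabolicSubgroup ξ) : mat γ *ᵥ ξ = ξ := by
  obtain ⟨b, hb, hbΓ⟩ := exists_height_bound h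
  have key : ∀ (g : SOPlus n) (c : ℝ), g ∈ Γ → 0 < c → mat g *ᵥ ξ = c • ξ → 1 ≤ c := by
    intro g c hg hc hgc
    by_contra hlt
    push Not at hlt
    obtain ⟨k, hk⟩ := exists_pow_lt_of_lt_one hb hlt
    have h1 := hbΓ (g ^ k)⁻¹ (Γ.inv_mem (Γ.pow_mem hg k))
    rw [lorentz_mat_left, inv_inv, mat_pow_mulVec hgc, lorentz_smul_right,
      basePt_lorentz_boundary h.1] at h1
    linarith
  obtain ⟨c, hc, hcξ⟩ := hγ.2
  have h1 := key γ c hγ.1 hc hcξ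
  have h2 : mat γ⁻¹ *ᵥ ξ = c⁻¹ • ξ := by
    have := congrArg (fun w => c⁻¹ • (mat γ⁻¹ *ᵥ w)) hcξ
    simp only [mat_inv_mulVec_mulVec, Matrix.mulVec_smul, smul_smul, inv_mul_cancel₀ hc.ne',
      one_smul] at this
    exact this.symm
  have h3 := key γ⁻¹ c⁻¹ (Γ.inv_mem hγ.1) (inv_pos.2 hc) h2
  have h4 : c = 1 := le_antisymm ((one_le_inv₀ hc).1 h3) h1
  rw [hcξ, h4, one_smul]

/-- Every coset in `Γ_ξ \ Γ` has a representative whose displacement of `O` is controlled by the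
height of the coset. -/
theorem exists_time_le {Γ : Subgroup (SOPlus n)} [DiscreteTopology Γ] {ξ : Idx n → ℝ}
    (h : IsFullRankParabolicFixedPoint Γ ξ) :
    ∃ C > 0, ∀ γ ∈ Γ, ∃ q ∈ Γ ⊓ parabolicSubgroup ξ,
      mat (q * γ) (Sum.inr ()) (Sum.inr ()) ≤ C * -lorentz (mat γ *ᵥ basePt n) ξ := by
  obtain ⟨b, hb, hbΓ⟩ := exists_height_bound h
  obtain ⟨hξ, -, D, hD, hDc, hDΓ⟩ := h
  obtain ⟨M, hM⟩ := (hDc.image (continuous_apply (Sum.inr ()))).bddAbove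
  have hM' : ∀ x ∈ D, x (Sum.inr ()) ≤ max M 1 :=
    fun x hx => (hM ⟨x, hx, rfl⟩).trans (le_max_left _ _)
  have hM₁ : 0 < max M 1 := lt_max_of_lt_right one_pos
  refine ⟨max M 1 + 1 / (2 * b ^ 2), by positivity, fun γ hγ => ?_⟩
  have hβ := hbΓ γ hγ
  obtain ⟨q, hq, -, x, hxD, hx⟩ := exists_translate_mem hξ hD hDΓ γ
  refine ⟨q, hq, ?_⟩
  set β := -lorentz (mat γ *ᵥ basePt n) ξ
  have hβ0 : 0 < β := hb.trans_le hβ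
  rw [← mat_basePt_time, hx, Pi.add_apply, Pi.smul_apply, Pi.smul_apply, hξ.2, smul_eq_mul,
    smul_eq_mul, mul_one, add_mul, mul_comm β]
  refine add_le_add (mul_le_mul_of_nonneg_right (hM' x hxD) hβ0.le) ?_
  rw [div_mul_eq_mul_div, one_mul, div_le_div_iff₀ (by positivity) (by positivity)]
  have h1 : b ^ 2 ≤ β ^ 2 := by gcongr
  have h2 : 0 ≤ b ^ 2 * β ^ 2 := by positivity
  nlinarith

/-- The Eisenstein series `∑ β^{-s}` over `Γ_ξ \ Γ` is dominated by the Poincaré series. -/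
theorem summable_height_rpow {Γ : Subgroup (SOPlus n)} [DiscreteTopology Γ] {ξ : Idx n → ℝ}
    (h : IsFullRankParabolicFixedPoint Γ ξ) {s : ℝ} (hs : 0 ≤ s) (hP : PoincareConverges Γ s) :
    Summable fun Q : Cosets Γ ξ =>
      (-lorentz (mat ((Q.out : Γ) : SOPlus n) *ᵥ basePt n) ξ) ^ (-s) := by
  obtain ⟨C, hC, hCΓ⟩ := exists_time_le h
  choose q hq hqC using fun Q : Cosets Γ ξ => hCΓ (Q.out : Γ) (Q.out : Γ).2
  let f : Cosets Γ ξ → Γ := fun Q => ⟨q Q * (Q.out : Γ), Γ.mul_mem (hq Q).1 (Q.out : Γ).2⟩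
  have hf : Function.Injective f := by
    intro Q Q' hQ
    rw [← Quotient.out_eq Q, ← Quotient.out_eq Q']
    refine Quotient.sound ?_
    change QuotientGroup.rightRel _ _ _
    rw [QuotientGroup.rightRel_apply, Subgroup.mem_subgroupOf]
    have h1 : q Q * ((Q.out : Γ) : SOPlus n) = q Q' * ((Q'.out : Γ) : SOPlus n) :=
      congrArg Subtype.val hQ
    have h2 : ((Q'.out : Γ) : SOPlus n) * ((Q.out : Γ) : SOPlus n)⁻¹ = (q Q')⁻¹ * q Q := by
      rw [mul_inv_eq_iff_eq_mul, mul_assoc, h1, inv_mul_cancel_left]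
    change ((Q'.out : Γ) : SOPlus n) * ((Q.out : Γ) : SOPlus n)⁻¹ ∈ _
    rw [h2]
    exact mul_mem (inv_mem (hq Q').2) (hq Q).2
  have hsum := (hP.comp_injective hf).mul_left ((2 * C) ^ s)
  have hβ : ∀ Q : Cosets Γ ξ, 0 < -lorentz (mat ((Q.out : Γ) : SOPlus n) *ᵥ basePt n) ξ := by
    intro Q
    have := lorentz_boundary_neg (mat_mem_hyperboloid ((Q.out : Γ) : SOPlus n) basePt_mem) h.1
    linarith
  refine Summable.of_nonneg_of_le (fun Q => Real.rpow_nonneg (hβ Q).le _) (fun Q => ?_) hsum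
  have h1 := exp_hypDist_le (q Q * ((Q.out : Γ) : SOPlus n))
  have h2 := hqC Q
  change _ ≤ (2 * C) ^ s * Real.exp (-s * hypDist (basePt n)
    (mat (q Q * ((Q.out : Γ) : SOPlus n)) *ᵥ basePt n))
  set d := hypDist (basePt n) (mat (q Q * ((Q.out : Γ) : SOPlus n)) *ᵥ basePt n)
  set β := -lorentz (mat ((Q.out : Γ) : SOPlus n) *ᵥ basePt n) ξ
  have h3 : Real.exp d / (2 * C) ≤ β := by
    rw [div_le_iff₀ (by positivity)]
    linarith
  calc β ^ (-s) ≤ (Real.exp d / (2 * C)) ^ (-s) :=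
        Real.rpow_le_rpow_of_nonpos (by positivity) h3 (by linarith)
    _ = (2 * C) ^ s * Real.exp (-s * d) := by
        rw [Real.div_rpow (Real.exp_pos _).le (by positivity), ← Real.exp_mul,
          Real.rpow_neg (by positivity), div_inv_eq_mul, mul_comm, mul_comm d]

end Heights

/-! ### The Eisenstein series -/

section Eisenstein

variable {n : ℕ}

/-- `X Y` for `X, Y ∈ 𝔫_ξ`; the formula is symmetric, so `𝔫_ξ` is abelian. -/
theorem rootSpace_two_mulVec_mulVec {ξ : Idx n → ℝ} (hξ : ξ ∈ boundary n) {X Y : LieAlg n}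
    (hX : X ∈ rootSpace ξ 2) (hY : Y ∈ rootSpace ξ 2) (w : Idx n → ℝ) :
    toMat X *ᵥ (toMat Y *ᵥ w) =
      -(lorentz w ξ * lorentz (tangentAt Y) (tangentAt X)) • ξ := by
  have hO : lorentz (basePt n) (basePt n) = -1 := basePt_mem.1
  have hξO : lorentz ξ (basePt n) = -1 := by rw [lorentz_comm, basePt_lorentz_boundary hξ]
  have h1 := rootSpace_two_mulVec hξ hY
    (w := w + lorentz w ξ • basePt n + (lorentz w (basePt n) - lorentz w ξ) • ξ)
    (by simp only [lorentz_add_left, lorentz_smul_left, hO, hξO]; ring)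
    (by simp only [lorentz_add_left, lorentz_smul_left, basePt_lorentz_boundary hξ, hξ.1]; ring)
  have h2 := congrArg (fun z => toMat X *ᵥ z) h1
  have h3 := rootSpace_two_mulVec hξ hX (tangentAt_lorentz_basePt Y)
    (tangentAt_lorentz_of_rootSpace hξ hY)
  simp only [Matrix.mulVec_add, Matrix.mulVec_smul, rootSpace_two_mulVec_self hξ hY,
    rootSpace_two_mulVec_self hξ hX, smul_zero, add_zero] at h2
  rw [← tangentAt, h3, smul_smul] at h2
  rw [neg_smul]
  exact eq_neg_of_add_eq_zero_left h2

theorem expG_add_of_rootSpace {ξ : Idx n → ℝ} (hξ : ξ ∈ boundary n) {X Y : LieAlg n}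
    (hX : X ∈ rootSpace ξ 2) (hY : Y ∈ rootSpace ξ 2) : expG (X + Y) = expG X * expG Y := by
  apply mat_injective
  rw [mat_mul, mat_expG, mat_expG, mat_expG, map_add, Matrix.exp_add_of_commute]
  refine Matrix.ext_of_mulVec_single fun j => ?_
  rw [← Matrix.mulVec_mulVec, ← Matrix.mulVec_mulVec, rootSpace_two_mulVec_mulVec hξ hX hY,
    rootSpace_two_mulVec_mulVec hξ hY hX, lorentz_comm (tangentAt X)]

theorem expG_Ad (g : SOPlus n) (X : LieAlg n) : expG (Ad n g X) = g * expG X * g⁻¹ := by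
  apply mat_injective
  have hu : IsUnit (mat g) := ⟨⟨mat g, mat g⁻¹, mat_mul_inv g, mat_inv_mul g⟩, rfl⟩
  have hi : (mat g)⁻¹ = mat g⁻¹ := Matrix.inv_eq_left_inv (mat_inv_mul g)
  rw [mat_mul, mat_mul, mat_expG, mat_expG, toMat_Ad, ← hi, Matrix.exp_conj _ _ hu]

theorem expG_smul_mul (a b : ℝ) (X : LieAlg n) :
    expG ((a + b) • X) = expG (a • X) * expG (b • X) := by
  apply mat_injective
  rw [mat_mul, mat_expG, mat_expG, mat_expG, add_smul, map_add, Matrix.exp_add_of_commute]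
  rw [map_smul, map_smul]
  exact ((Commute.refl _).smul_left a).smul_right b

/-- `N_ξ A_ξ` is a group: an Iwasawa decomposition of `k h`, where `g = n a k`, gives one of
`g h`. -/
theorem IsIwasawa.mul {ξ : Idx n → ℝ} (hξ : ξ ∈ boundary n) {g h : SOPlus n}
    {p q : LieAlg n × ℝ × SOPlus n} (hp : IsIwasawa ξ g p) (hq : IsIwasawa ξ (p.2.2 * h) q) :
    IsIwasawa ξ (g * h) (p.1 + Real.exp (2 * p.2.1) • q.1, p.2.1 + q.2.1, q.2.2) := by
  refine ⟨Submodule.add_mem _ hp.1 (Submodule.smul_mem _ _ hq.1), hq.2.1, ?_⟩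
  have h1 : g * h = expG p.1 * expG (p.2.1 • translationGen ξ) * (p.2.2 * h) := by
    conv_lhs => rw [hp.2.2]
    rw [mul_assoc]
  rw [h1, hq.2.2]
  simp only
  rw [expG_add_of_rootSpace hξ hp.1 (Submodule.smul_mem _ _ hq.1),
    ← Ad_expG_translationGen hq.1, expG_Ad, expG_smul_mul]
  group

variable {V : Type*} [NormedAddCommGroup V] [NormedSpace ℝ V]

theorem extPhi_smul (R : Op n → V →L[ℝ] V) (ξ : Idx n → ℝ) (u : Fin n → LieAlg n) (c : ℝ) (v : V)
    (A : Op n) : extPhi R ξ u (c • v) A = c • extPhi R ξ u v A := by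
  ext X
  rw [ContinuousAlternatingMap.smul_apply, extPhi_apply, extPhi_apply, pullForm_apply,
    pullForm_apply, map_smul (R (NormedSpace.exp _)), smul_comm, map_smul (R A)]

theorem hasSum_bracketPart {m : ℕ} {α : Type*} {f : α → LieAlg n [⋀^Fin m]→L[ℝ] V}
    {w : LieAlg n [⋀^Fin m]→L[ℝ] V} (hf : HasSum f w) (X : Fin (m + 1) → LieAlg n) :
    HasSum (fun a => bracketPart (f a) X) (bracketPart w X) := by
  cases m with
  | zero => exact hasSum_zero
  | succ m =>
    refine HasSum.neg (hasSum_sum fun i _ => hasSum_sum fun j _ => HasSum.const_smul _ ?_)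
    exact hf.mapL (ContinuousAlternatingMap.apply ℝ (LieAlg n) V _)

theorem coboundary_mul_left {m : ℕ} (ρ : Representation ℝ (SOPlus n) V)
    (f : SOPlus n → LieAlg n [⋀^Fin m]→L[ℝ] V) (k g : SOPlus n) (X : Fin (m + 1) → LieAlg n) :
    coboundary ρ (fun h => f (k * h)) g X = coboundary ρ f (k * g) X := by
  simp only [coboundary, leftDeriv, mul_assoc]

/-- The coboundary in terms of the derivative of an extension to operators; this expression is
continuous and linear in the pair of `F (op g)` and `F'`, so it passes to series. -/
theorem coboundary_eq_of_hasFDerivAt {m : ℕ} {ρ : Representation ℝ (SOPlus n) V} {R : Op n → V →L[ℝ] V}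
    (hR : ContDiff ℝ ∞ R) (hRρ : ∀ g w, R (op g) w = ρ g⁻¹ w)
    {F : Op n → LieAlg n [⋀^Fin m]→L[ℝ] V} {F' : Op n →L[ℝ] LieAlg n [⋀^Fin m]→L[ℝ] V}
    {g : SOPlus n} (hF : HasFDerivAt F F' (op g)) (X : Fin (m + 1) → LieAlg n) :
    coboundary ρ (fun h => F (op h)) g X = ∑ i : Fin (m + 1), (-1 : ℝ) ^ (i : ℕ) •
      (F' (op g * toOpL (X i)) (i.removeNth X) +
        fderiv ℝ R 1 (toOpL (-X i)) (F (op g) (i.removeNth X))) + bracketPart (F (op g)) X := by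
  rw [coboundary]
  congr 1
  refine Finset.sum_congr rfl fun i _ => ?_
  have h1 : HasFDerivAt (fun A => F A (i.removeNth X))
      ((ContinuousAlternatingMap.apply ℝ (LieAlg n) V (i.removeNth X)).comp F') (op g) :=
    (ContinuousAlternatingMap.apply ℝ (LieAlg n) V (i.removeNth X)).hasFDerivAt.comp _ hF
  rw [leftDeriv_eq h1, derivedAction_eq hR hRρ]
  rfl

variable [FiniteDimensional ℝ V]

theorem twist_mul {m : ℕ} (ρ : Representation ℝ (SOPlus n) V) (k k' : SOPlus n)
    (w : LieAlg n [⋀^Fin m]→L[ℝ] V) : twist ρ (k * k') w = twist ρ k' (twist ρ k w) := by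
  ext X
  change ρ (k * k')⁻¹ (w fun i => Ad n (k * k') (X i)) =
    ρ k'⁻¹ (ρ k⁻¹ (w fun i => Ad n k (Ad n k' (X i))))
  rw [mul_inv_rev, map_mul, map_mul]
  rfl

theorem twist_smul {m : ℕ} (ρ : Representation ℝ (SOPlus n) V) (k : SOPlus n) (c : ℝ)
    (w : LieAlg n [⋀^Fin m]→L[ℝ] V) : twist ρ k (c • w) = c • twist ρ k w := by
  ext X
  exact map_smul (ρ k⁻¹) c _

theorem tsum_twist {m : ℕ} (ρ : Representation ℝ (SOPlus n) V) (k : SOPlus n) {α : Type*}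
    {f : α → LieAlg n [⋀^Fin m]→L[ℝ] V} (hf : Summable f) :
    twist ρ k (∑' a, f a) = ∑' a, twist ρ k (f a) := by
  let L : (LieAlg n [⋀^Fin m]→L[ℝ] V) →L[ℝ] LieAlg n [⋀^Fin m]→L[ℝ] V :=
    (ContinuousLinearMap.compContinuousAlternatingMapCLM ℝ (LieAlg n) V V (Fin m)
      (LinearMap.toContinuousLinearMap (ρ k⁻¹))).comp
    (ContinuousAlternatingMap.compContinuousLinearMapCLM (LinearMap.toContinuousLinearMap (Ad n k)))
  exact (hf.hasSum.mapL L).tsum_eq.symm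

/-- The hypotheses under which the Eisenstein series is treated uniformly for the adjoint and the
trivial representation: `g ↦ ρ(g⁻¹)` extends smoothly to operators, and `v` has weight `2n - s`
under `A_ξ`. -/
structure IsAdapted (ρ : Representation ℝ (SOPlus n) V) (R : Op n → V →L[ℝ] V) (ξ : Idx n → ℝ)
    (v : V) (s : ℝ) : Prop where
  smooth : ContDiff ℝ ∞ R
  eq_inv : ∀ g w, R (op g) w = ρ g⁻¹ w
  weight : ∀ τ : ℝ, ρ (expG (τ • translationGen ξ)) v = Real.exp ((2 * n - s) * τ) • v

section Adapted

variable {ρ : Representation ℝ (SOPlus n) V} {R : Op n → V →L[ℝ] V} {ξ : Idx n → ℝ} {v : V} {s : ℝ}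
  {u : Fin n → LieAlg n}

theorem IsAdapted.phi_eq (hA : IsAdapted ρ R ξ v s) (hξ : ξ ∈ boundary n)
    (hu : IsHorosphericalFrame ξ u) (g : SOPlus n) :
    phi ρ ξ u v s g = extPhi R ξ u v (op g) :=
  (isIwasawa_iwasawa hξ hu g).extPhi_eq hA.eq_inv hξ hu hA.weight

/-- If `g = n a k`, then `φ_{ξ,s}(g h) = t_a^s φ_{ξ,s}(k h)`. -/
theorem IsAdapted.phi_mul (hA : IsAdapted ρ R ξ v s) (hξ : ξ ∈ boundary n)
    (hu : IsHorosphericalFrame ξ u) (g h : SOPlus n) :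
    phi ρ ξ u v s (g * h) =
      Real.exp (iwasawa ξ g).2.1 ^ s • phi ρ ξ u v s ((iwasawa ξ g).2.2 * h) := by
  have hq := isIwasawa_iwasawa hξ hu ((iwasawa ξ g).2.2 * h)
  have h1 := ((isIwasawa_iwasawa hξ hu g).mul hξ hq).extPhi_eq hA.eq_inv hξ hu hA.weight
  rw [hA.phi_eq hξ hu, ← h1, phi, smul_smul, Real.exp_add,
    Real.mul_rpow (Real.exp_pos _).le (Real.exp_pos _).le]

theorem IsAdapted.phi_mul_maxCompact (hA : IsAdapted ρ R ξ v s) (hξ : ξ ∈ boundary n)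
    (hu : IsHorosphericalFrame ξ u) (g : SOPlus n) {k : SOPlus n} (hk : k ∈ maxCompact n) :
    phi ρ ξ u v s (g * k) = twist ρ k (phi ρ ξ u v s g) := by
  have hp := isIwasawa_iwasawa hξ hu g
  have hq : IsIwasawa ξ (g * k) ((iwasawa ξ g).1, (iwasawa ξ g).2.1, (iwasawa ξ g).2.2 * k) :=
    ⟨hp.1, mul_mem hp.2.1 hk, by
      conv_lhs => rw [hp.2.2]
      simp only [mul_assoc]⟩
  have h1 := hq.extPhi_eq hA.eq_inv hξ hu hA.weight
  rw [hA.phi_eq hξ hu, ← h1, phi, twist_smul, twist_mul]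

theorem phi_horizontal (ρ : Representation ℝ (SOPlus n) V) (hξ : ξ ∈ boundary n)
    (hu : IsHorosphericalFrame ξ u) (v : V) (s : ℝ) (g : SOPlus n) {X : Fin n → LieAlg n}
    {i : Fin n} (hX : tangentAt (X i) = 0) : phi ρ ξ u v s g X = 0 := by
  have hk := (isIwasawa_iwasawa hξ hu g).2.1
  have h1 : phi ρ ξ u v s g X = Real.exp (iwasawa ξ g).2.1 ^ s •
      ρ (iwasawa ξ g).2.2⁻¹ ((detForm n fun i => coframe u (Ad n (iwasawa ξ g).2.2 (X i))) • v) :=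
    rfl
  have h2 : coframe u (Ad n (iwasawa ξ g).2.2 (X i)) = 0 := by
    ext j
    change lorentz (tangentAt (Ad n (iwasawa ξ g).2.2 (X i))) (tangentAt (u j)) = 0
    rw [tangentAt_Ad hk, hX, Matrix.mulVec_zero, lorentz_zero_left]
  rw [h1, (detForm n).map_coord_zero i h2, zero_smul, map_zero, smul_zero]

/-- A compact set of operators that contains those of `K`: they fix `O`, preserve the Lorentz form
and have entries in `[-1, 1]`. -/
def compactOps (n : ℕ) : Set (Op n) :=
  toOp '' ({A : Matrix (Idx n) (Idx n) ℝ | (∀ i j, A i j ∈ Set.Icc (-1) 1) ∧ Aᵀ * J n * A = J n} ∩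
    {A | A *ᵥ basePt n = basePt n})

theorem isCompact_compactOps : IsCompact (compactOps n) := by
  have hc : Continuous (toOp : Matrix (Idx n) (Idx n) ℝ → Op n) :=
    LinearMap.continuous_of_finiteDimensional (toOp (n := n)).toLinearMap
  refine IsCompact.image ?_ hc
  refine (isCompact_lorentz n 1).inter_right (isClosed_eq ?_ continuous_const)
  exact continuous_id.matrix_mulVec continuous_const

theorem op_mem_compactOps {k : SOPlus n} (hk : k ∈ maxCompact n) : op k ∈ compactOps n := by
  have hk' : mat k *ᵥ basePt n = basePt n := hk
  refine ⟨mat k, ⟨mat_mem_lorentz ?_, hk⟩, rfl⟩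
  rw [← mat_basePt_time, hk']
  simp [basePt]

theorem pairBasePt_mul_neg (hξ : ξ ∈ boundary n) {B : Op n} (hB : B ∈ compactOps n)
    (g : SOPlus n) : pairBasePt ξ (B * op g) < 0 := by
  obtain ⟨A, ⟨⟨-, hA⟩, hAO⟩, rfl⟩ := hB
  have hAO' : A *ᵥ basePt n = basePt n := hAO
  have hy := mat_mem_hyperboloid g (basePt_mem (n := n))
  refine lorentz_boundary_neg (x := A *ᵥ (mat g *ᵥ basePt n)) ⟨?_, ?_⟩ hξ
  · rw [lorentz_mulVec hA]; exact hy.1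
  · have h1 := lorentz_mulVec_mulVec hA (mat g *ᵥ basePt n) (basePt n)
    rw [hAO', lorentz_basePt, lorentz_basePt] at h1
    have h2 := hy.2
    linarith

theorem isOpen_pairBasePt_mul_neg :
    IsOpen {z : Op n × Op n | pairBasePt ξ (z.2 * z.1) < 0} := by
  refine isOpen_lt ?_ continuous_const
  exact (pairBasePt ξ).continuous.comp (continuous_snd.mul continuous_fst)

theorem IsAdapted.contDiffOn (hA : IsAdapted ρ R ξ v s) (u : Fin n → LieAlg n) :
    ContDiffOn ℝ ∞ (fun z : Op n × Op n => extPhi R ξ u v (z.2 * z.1))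
      {z : Op n × Op n | pairBasePt ξ (z.2 * z.1) < 0} := fun z hz =>
  ((contDiffAt_extPhi hA.smooth u v hz).comp z
    (contDiffAt_snd.mul contDiffAt_fst)).contDiffWithinAt

/-- The terms of the Eisenstein series are closed, being left translates of a closed form. -/
theorem IsAdapted.coboundary_term (hA : IsAdapted ρ R ξ v s) (hξ : ξ ∈ boundary n)
    (u : Fin n → LieAlg n) (c : ℝ) (k g : SOPlus n) (X : Fin (n + 1) → LieAlg n) :
    coboundary ρ (fun h => c • extPhi R ξ u v (op k * op h)) g X = 0 := by
  set F : SOPlus n → LieAlg n [⋀^Fin n]→L[ℝ] V := fun h => extPhi R ξ u (c • v) (op h) with hF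
  have h1 : (fun h => c • extPhi R ξ u v (op k * op h)) = fun h => F (k * h) := by
    funext h
    simp only [hF, op_mul, extPhi_smul]
  rw [h1, coboundary_mul_left, hF, coboundary_extPhi hA.smooth hA.eq_inv hξ]

/-- The series `∑ t_q^s φ(k_q g)` over `Γ_ξ \ Γ`, with Iwasawa decompositions `γ_q = n_q a_q k_q`
of the representatives, as a function on operators. -/
noncomputable def extEisenstein (Γ : Subgroup (SOPlus n)) (R : Op n → V →L[ℝ] V) (ξ : Idx n → ℝ)
    (u : Fin n → LieAlg n) (v : V) (s : ℝ) (A : Op n) : LieAlg n [⋀^Fin n]→L[ℝ] V :=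
  ∑' Q : Cosets Γ ξ, Real.exp (iwasawa ξ ((Q.out : Γ) : SOPlus n)).2.1 ^ s •
    extPhi R ξ u v (op (iwasawa ξ ((Q.out : Γ) : SOPlus n)).2.2 * A)

variable {Γ : Subgroup (SOPlus n)}

theorem IsAdapted.eisensteinTerm_eq (hA : IsAdapted ρ R ξ v s) (hξ : ξ ∈ boundary n)
    (hu : IsHorosphericalFrame ξ u) (g : SOPlus n) (Q : Cosets Γ ξ) :
    eisensteinTerm Γ ρ ξ u v s g Q =
      Real.exp (iwasawa ξ ((Q.out : Γ) : SOPlus n)).2.1 ^ s •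
        extPhi R ξ u v (op (iwasawa ξ ((Q.out : Γ) : SOPlus n)).2.2 * op g) := by
  rw [eisensteinTerm, hA.phi_mul hξ hu, hA.phi_eq hξ hu, op_mul]

theorem IsAdapted.eisenstein_eq (hA : IsAdapted ρ R ξ v s) (hξ : ξ ∈ boundary n)
    (hu : IsHorosphericalFrame ξ u) (g : SOPlus n) :
    eisenstein Γ ρ ξ u v s g = extEisenstein Γ R ξ u v s (op g) :=
  tsum_congr fun Q => hA.eisensteinTerm_eq hξ hu g Q

/-- Right translation by `γ` on `Γ_ξ \ Γ`. -/
def cosetMul (Γ : Subgroup (SOPlus n)) (ξ : Idx n → ℝ) (γ : Γ) : Cosets Γ ξ ≃ Cosets Γ ξ :=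
  Quotient.congr (Equiv.mulRight γ) fun a b => by
    change QuotientGroup.rightRel _ a b ↔ QuotientGroup.rightRel _ (a * γ) (b * γ)
    rw [QuotientGroup.rightRel_apply, QuotientGroup.rightRel_apply, mul_inv_rev, mul_assoc,
      mul_inv_cancel_left]

/-- The term of the Eisenstein series does not depend on the representative. -/
theorem eisensteinTerm_mk
    (hinv : ∀ γ ∈ Γ ⊓ parabolicSubgroup ξ, ∀ g, phi ρ ξ u v s (γ * g) = phi ρ ξ u v s g)
    (g : SOPlus n) (γ : Γ) :
    eisensteinTerm Γ ρ ξ u v s g (Quotient.mk _ γ) = phi ρ ξ u v s (γ * g) := by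
  have h1 := Quotient.exact (Quotient.out_eq (Quotient.mk
    (QuotientGroup.rightRel ((parabolicSubgroup ξ).subgroupOf Γ)) γ))
  set δ : Γ := (Quotient.mk (QuotientGroup.rightRel ((parabolicSubgroup ξ).subgroupOf Γ)) γ).out
    with hδ
  have h2 : γ * δ⁻¹ ∈ (parabolicSubgroup ξ).subgroupOf Γ :=
    QuotientGroup.rightRel_apply.1 h1
  have h3 := hinv ((γ * δ⁻¹ : Γ) : SOPlus n) ⟨(γ * δ⁻¹).2, Subgroup.mem_subgroupOf.1 h2⟩
    ((δ : SOPlus n) * g)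
  change phi ρ ξ u v s ((δ : SOPlus n) * g) = _
  rw [← h3]
  congr 1
  push_cast
  group

theorem eisenstein_mul_left
    (hinv : ∀ γ ∈ Γ ⊓ parabolicSubgroup ξ, ∀ g, phi ρ ξ u v s (γ * g) = phi ρ ξ u v s g)
    {γ : SOPlus n} (hγ : γ ∈ Γ) (g : SOPlus n) :
    eisenstein Γ ρ ξ u v s (γ * g) = eisenstein Γ ρ ξ u v s g := by
  rw [eisenstein, eisenstein,
    ← (cosetMul Γ ξ ⟨γ, hγ⟩).tsum_eq fun Q => eisensteinTerm Γ ρ ξ u v s g Q]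
  refine tsum_congr fun Q => ?_
  induction Q using Quotient.inductionOn with
  | h δ =>
    have h1 : cosetMul Γ ξ ⟨γ, hγ⟩ (Quotient.mk _ δ) = Quotient.mk _ (δ * ⟨γ, hγ⟩) := rfl
    rw [h1, eisensteinTerm_mk hinv, eisensteinTerm_mk hinv]
    simp [mul_assoc]

/-- Absolute convergence, smoothness and closedness of the Eisenstein series follow from
convergence of `∑ t_q^s`. -/
theorem IsAdapted.isAbsConvClosedForm (hA : IsAdapted ρ R ξ v s) (hξ : ξ ∈ boundary n)
    (hu : IsHorosphericalFrame ξ u)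
    (hinv : ∀ γ ∈ Γ ⊓ parabolicSubgroup ξ, ∀ g, phi ρ ξ u v s (γ * g) = phi ρ ξ u v s g)
    (hsum : Summable fun Q : Cosets Γ ξ =>
      Real.exp (iwasawa ξ ((Q.out : Γ) : SOPlus n)).2.1 ^ s) :
    IsAbsConvClosedForm Γ ρ ξ u v s := by
  have : CompleteSpace V := FiniteDimensional.complete ℝ V
  set c : Cosets Γ ξ → ℝ := fun Q => Real.exp (iwasawa ξ ((Q.out : Γ) : SOPlus n)).2.1 ^ s with hc
  set κ : Cosets Γ ξ → SOPlus n := fun Q => (iwasawa ξ ((Q.out : Γ) : SOPlus n)).2.2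
  have hκ : ∀ Q, κ Q ∈ maxCompact n := fun Q => (isIwasawa_iwasawa hξ hu _).2.1
  have habs : Summable fun Q => |c Q| :=
    hsum.congr fun Q => (abs_of_nonneg (Real.rpow_nonneg (Real.exp_pos _).le _)).symm
  -- The pole `⟨A O, ξ⟩ = 0` of the horospherical coordinates stays away from `κ g`, `κ ∈ K`.
  have key := fun g : SOPlus n => contDiffAt_tsum_of_isCompact isOpen_pairBasePt_mul_neg
    (hA.contDiffOn u) isCompact_compactOps (x₀ := op g)
    (fun B hB => pairBasePt_mul_neg hξ hB g) habs (κ := fun Q => op (κ Q))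
    fun Q => op_mem_compactOps (hκ Q)
  have hterm : ∀ g Q, eisensteinTerm Γ ρ ξ u v s g Q = c Q • extPhi R ξ u v (op (κ Q) * op g) :=
    fun g Q => hA.eisensteinTerm_eq hξ hu g Q
  have hE : eisenstein Γ ρ ξ u v s = fun g => extEisenstein Γ R ξ u v s (op g) :=
    funext fun g => hA.eisenstein_eq hξ hu g
  have hconv : ∀ g, Summable fun Q : Cosets Γ ξ => ‖eisensteinTerm Γ ρ ξ u v s g Q‖ := fun g => by
    simp only [hterm]
    exact (key g).2.2.2
  refine ⟨hconv, ⟨fun g => ?_, fun γ hγ g => eisenstein_mul_left hinv hγ g, fun k hk g => ?_,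
    fun g X hX => ?_⟩, fun g X => ?_⟩
  · rw [hE]
    refine contDiff_iff_contDiffAt.2 fun X => ?_
    have h1 : ContDiffAt ℝ ∞ (extEisenstein Γ R ξ u v s) (op g * NormedSpace.exp (toOpL X)) := by
      have := (key (g * expG X)).1
      rwa [op_mul, op_expG] at this
    have h2 : ContDiffAt ℝ ∞ (fun X : LieAlg n => op g * NormedSpace.exp (toOpL X)) X :=
      contDiffAt_const.mul contDiff_exp_toOpL.contDiffAt
    simp only [op_mul, op_expG]
    exact ContDiffAt.comp X h1 h2
  · rw [eisenstein, eisenstein, tsum_twist ρ k (hconv g).of_norm]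
    refine tsum_congr fun Q => ?_
    rw [eisensteinTerm, eisensteinTerm, ← mul_assoc, hA.phi_mul_maxCompact hξ hu _ hk]
  · obtain ⟨i, hi⟩ := hX
    have h1 := (hconv g).of_norm.hasSum.mapL (ContinuousAlternatingMap.apply ℝ (LieAlg n) V X)
    refine h1.unique ?_
    convert hasSum_zero with Q
    exact phi_horizontal ρ hξ hu v s _ hi
  · obtain ⟨-, hd, hds, hs⟩ := key g
    have hFd : HasFDerivAt (extEisenstein Γ R ξ u v s) _ (op g) := hd
    rw [hE, coboundary_eq_of_hasFDerivAt hA.smooth hA.eq_inv hFd]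
    have hsE : HasSum (fun Q => c Q • extPhi R ξ u v (op (κ Q) * op g))
        (extEisenstein Γ R ξ u v s (op g)) := hs.of_norm.hasSum
    have hcl : ∀ Q, HasFDerivAt (fun A => c Q • extPhi R ξ u v (op (κ Q) * A))
        (c Q • fderiv ℝ (fun A => extPhi R ξ u v (op (κ Q) * A)) (op g)) (op g) := fun Q => by
      have h1 : ContDiffAt ℝ ∞ (fun A => extPhi R ξ u v (op (κ Q) * A)) (op g) :=
        ContDiffAt.comp (op g) (contDiffAt_extPhi hA.smooth u v
          (pairBasePt_mul_neg hξ (op_mem_compactOps (hκ Q)) g))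
          (contDiffAt_const.mul contDiffAt_id)
      exact (h1.differentiableAt (by simp)).hasFDerivAt.const_smul (c Q)
    have hzero : ∀ Q, coboundary ρ (fun h => c Q • extPhi R ξ u v (op (κ Q) * op h)) g X = 0 :=
      fun Q => hA.coboundary_term hξ u (c Q) (κ Q) g X
    have hQ := fun Q => (coboundary_eq_of_hasFDerivAt hA.smooth hA.eq_inv (hcl Q) X).symm.trans (hzero Q)
    refine HasSum.unique (L := .unconditional _) (f := fun Q => ∑ i : Fin (n + 1), (-1 : ℝ) ^ (i : ℕ) •
        ((c Q • fderiv ℝ (fun A => extPhi R ξ u v (op (κ Q) * A)) (op g)) (op g * toOpL (X i))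
            (i.removeNth X) +
          fderiv ℝ R 1 (toOpL (-X i)) ((c Q • extPhi R ξ u v (op (κ Q) * op g)) (i.removeNth X))) +
        bracketPart (c Q • extPhi R ξ u v (op (κ Q) * op g)) X) ?_ ?_
    · refine HasSum.add (hasSum_sum fun i _ => HasSum.const_smul _ (HasSum.add ?_ ?_))
        (hasSum_bracketPart hsE X)
      · exact hds.hasSum.mapL ((ContinuousAlternatingMap.apply ℝ (LieAlg n) V (i.removeNth X)).comp
          (ContinuousLinearMap.apply ℝ _ (op g * toOpL (X i))))
      · exact hsE.mapL ((fderiv ℝ R 1 (toOpL (-X i))).comp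
          (ContinuousAlternatingMap.apply ℝ (LieAlg n) V (i.removeNth X)))
    · simp only [hQ]
      exact hasSum_zero

end Adapted

end Eisenstein

/-! ### The trivial and the adjoint representation -/

section Frame

variable {n : ℕ} {ξ : Idx n → ℝ} {e : Fin n → Idx n → ℝ}

theorem eq_sum_of_lorentz_eq_zero (hξ : ξ ∈ boundary n)
    (he : ∀ i j, lorentz (e i) (e j) = if i = j then 1 else 0)
    (heO : ∀ i, lorentz (e i) (basePt n) = 0) (heξ : ∀ i, lorentz (e i) ξ = 0)
    {w : Idx n → ℝ} (hwO : lorentz w (basePt n) = 0) (hwξ : lorentz w ξ = 0) :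
    w = ∑ i, lorentz w (e i) • e i := by
  have h := eq_smul_of_orthogonal hξ he heO heξ (w := w - ∑ i, lorentz w (e i) • e i)
    (fun j => by simp [lorentz_sub_left, lorentz_sum_left, lorentz_smul_left, he])
    (by simp [lorentz_sub_left, lorentz_sum_left, lorentz_smul_left, heξ, hwξ])
  have h1 : lorentz (w - ∑ i, lorentz w (e i) • e i) (basePt n) = 0 := by
    simp [lorentz_sub_left, lorentz_sum_left, lorentz_smul_left, heO, hwO]
  rw [lorentz_basePt, neg_eq_zero] at h1
  rw [h1, zero_smul] at h
  exact sub_eq_zero.1 h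

/-- An element of `G` that fixes `O` and `ξ` acts with determinant one on the orthogonal
complement of `O` and `ξ`. -/
theorem det_lorentz_mulVec (hξ : ξ ∈ boundary n)
    (he : ∀ i j, lorentz (e i) (e j) = if i = j then 1 else 0)
    (heO : ∀ i, lorentz (e i) (basePt n) = 0) (heξ : ∀ i, lorentz (e i) ξ = 0) {m : SOPlus n}
    (hmO : mat m *ᵥ basePt n = basePt n) (hmξ : mat m *ᵥ ξ = ξ) :
    (Matrix.of fun i j => lorentz (mat m *ᵥ e i) (e j)).det = 1 := by
  have hcard : Fintype.card (Fin n ⊕ Fin 2) = Module.finrank ℝ (Idx n → ℝ) := by simp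
  let b := basisOfLinearIndependentOfCardEqFinrank (linearIndependent_frame hξ he heO heξ) hcard
  have hb : ∀ i, b i = Sum.elim e ![basePt n, ξ] i := fun i => by
    simp [b]
  have hbl : ∀ i, b (Sum.inl i) = e i := fun i => hb _
  have hbr : ∀ i, mat m *ᵥ b (Sum.inr i) = b (Sum.inr i) := fun i => by
    fin_cases i
    · exact (hb (Sum.inr 0)).symm ▸ hmO
    · exact (hb (Sum.inr 1)).symm ▸ hmξ
  have hM : LinearMap.toMatrix b b (Matrix.toLin' (mat m)) =
      Matrix.fromBlocks (Matrix.of fun i j => lorentz (mat m *ᵥ e i) (e j))ᵀ 0 0 1 := by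
    ext i j
    rw [LinearMap.toMatrix_apply, Matrix.toLin'_apply]
    rcases j with j | j
    · rw [hbl]
      have h1 := eq_sum_of_lorentz_eq_zero hξ he heO heξ (w := mat m *ᵥ e j)
        (by conv_lhs => rw [← hmO, lorentz_mat, heO])
        (by conv_lhs => rw [← hmξ, lorentz_mat, heξ])
      rw [h1]
      simp only [← hbl, map_sum, map_smul, Module.Basis.repr_self]
      rcases i with i | i
      · simp [Finsupp.single_apply, hbl]
      · simp
    · rw [hbr, Module.Basis.repr_self]
      rcases i with i | i
      · simp
      · simp [Finsupp.single_apply, Matrix.one_apply, eq_comm]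
  have h2 : (mat m).det = 1 := m.2.2.1
  rw [← LinearMap.det_toLin', ← LinearMap.det_toMatrix b, hM, Matrix.det_fromBlocks_zero₂₁,
    Matrix.det_one, mul_one, Matrix.det_transpose] at h2
  exact h2

theorem det_coframe_mul {u : Fin n → LieAlg n} (hξ : ξ ∈ boundary n)
    (hu : IsHorosphericalFrame ξ u) {m k : SOPlus n} (hm : m ∈ maxCompact n)
    (hmξ : mat m *ᵥ ξ = ξ) (X : Fin n → LieAlg n) :
    (Matrix.of fun i => coframe u (Ad n (m * k) (X i))).det =
      (Matrix.of fun i => coframe u (Ad n k (X i))).det := by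
  have heO := fun i => tangentAt_lorentz_basePt (u i)
  have heξ := fun i => tangentAt_lorentz_of_rootSpace hξ (hu.1 i)
  have hmO : mat m⁻¹ *ᵥ basePt n = basePt n := (maxCompact n).inv_mem hm
  have hmξ' : mat m⁻¹ *ᵥ ξ = ξ := by
    conv_lhs => rw [← hmξ]
    exact mat_inv_mulVec_mulVec _ _
  have h1 : (Matrix.of fun i => coframe u (Ad n (m * k) (X i))) =
      (Matrix.of fun i => coframe u (Ad n k (X i))) *
        Matrix.of fun i j => lorentz (mat m *ᵥ tangentAt (u i)) (tangentAt (u j)) := by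
    ext i j
    rw [Matrix.mul_apply]
    change lorentz (tangentAt (Ad n (m * k) (X i))) (tangentAt (u j)) = ∑ l,
      lorentz (tangentAt (Ad n k (X i))) (tangentAt (u l)) *
        lorentz (mat m *ᵥ tangentAt (u l)) (tangentAt (u j))
    rw [map_mul, Module.End.mul_apply, tangentAt_Ad hm, lorentz_mat_left,
      eq_sum_of_lorentz_eq_zero hξ hu.2 heO heξ (w := mat m⁻¹ *ᵥ tangentAt (u j))
        (by conv_lhs => rw [← hmO, lorentz_mat, heO])
        (by conv_lhs => rw [← hmξ', lorentz_mat, heξ]),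
      lorentz_comm, lorentz_sum_left]
    refine Finset.sum_congr rfl fun l _ => ?_
    rw [lorentz_smul_left, lorentz_comm (tangentAt (u l)), lorentz_mat_left m,
      lorentz_comm (tangentAt (u l)), mul_comm]
  rw [h1, Matrix.det_mul, det_lorentz_mulVec hξ hu.2 heO heξ hm hmξ, mul_one]

/-- `φ_{ξ,s}` with values in the trivial representation is invariant under the isometries that
preserve the horospheres centred at `ξ`. -/
theorem phi_trivial_mul_left {u : Fin n → LieAlg n} (hξ : ξ ∈ boundary n)
    (hu : IsHorosphericalFrame ξ u) (v s : ℝ) {γ : SOPlus n} (hγ : mat γ *ᵥ ξ = ξ) (g : SOPlus n) :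
    phi (Representation.trivial ℝ (SOPlus n) ℝ) ξ u v s (γ * g) =
      phi (Representation.trivial ℝ (SOPlus n) ℝ) ξ u v s g := by
  have hp := isIwasawa_iwasawa hξ hu (γ * g)
  have hq := isIwasawa_iwasawa hξ hu g
  set p := iwasawa ξ (γ * g) with hpdef
  set q := iwasawa ξ g with hqdef
  have hγ' : mat γ⁻¹ *ᵥ ξ = ξ := by
    conv_lhs => rw [← hγ]
    exact mat_inv_mulVec_mulVec _ _
  have hτ : p.2.1 = q.2.1 := by
    have h1 := hp.lorentz_boundary hξ
    rw [mat_mul, ← Matrix.mulVec_mulVec, lorentz_mat_left, hγ', hq.lorentz_boundary hξ] at h1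
    have := Real.exp_injective (neg_injective h1)
    linarith
  have hk : mat p.2.2⁻¹ *ᵥ ξ = mat q.2.2⁻¹ *ᵥ ξ := by
    have h1 := hp.inv_mulVec_boundary hξ
    rw [mul_inv_rev, mat_mul, ← Matrix.mulVec_mulVec, hγ', hq.inv_mulVec_boundary hξ, hτ] at h1
    exact (smul_right_injective _ (Real.exp_pos _).ne' h1).symm
  have hm : mat (p.2.2 * q.2.2⁻¹) *ᵥ ξ = ξ := by
    rw [mat_mul, ← Matrix.mulVec_mulVec, ← hk, mat_mulVec_inv_mulVec]
  have hdet := fun X => det_coframe_mul (k := q.2.2) hξ hu (mul_mem hp.2.1 (inv_mem hq.2.1)) hm X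
  simp only [inv_mul_cancel_right] at hdet
  ext X
  change Real.exp p.2.1 ^ s • ((Matrix.of fun i => coframe u (Ad n p.2.2 (X i))).det • v) =
    Real.exp q.2.1 ^ s • ((Matrix.of fun i => coframe u (Ad n q.2.2 (X i))).det • v)
  rw [hτ, hdet]

/-- The weight of `A_ξ` on the trivial representation is `0 = 2n - s` for `s = 2n`. -/
theorem isAdapted_trivial (ξ : Idx n → ℝ) (v : ℝ) :
    IsAdapted (Representation.trivial ℝ (SOPlus n) ℝ) (fun _ => 1) ξ v (2 * n) where
  smooth := contDiff_const
  eq_inv _ _ := rfl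
  weight τ := by
    rw [sub_self, zero_mul, Real.exp_zero, one_smul]
    rfl

theorem skew_conj (M : Matrix (Idx n) (Idx n) ℝ) (W : LieAlg n) :
    (J n * Mᵀ * J n * toMat W * M)ᵀ * J n = J n * (-(J n * Mᵀ * J n * toMat W * M)) := by
  have hJ : (J n)ᵀ = J n := Matrix.diagonal_transpose _
  have hW := toMat_skew W
  calc (J n * Mᵀ * J n * toMat W * M)ᵀ * J n
      = Mᵀ * ((toMat W)ᵀ * J n) * M * (J n * J n) := by
        simp only [Matrix.transpose_mul, hJ, Matrix.transpose_transpose, Matrix.mul_assoc]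
    _ = J n * J n * (Mᵀ * (J n * -toMat W) * M) := by
        rw [hW, J_mul_J, Matrix.mul_one, Matrix.one_mul]
    _ = _ := by simp only [Matrix.mul_assoc, Matrix.mul_neg, Matrix.neg_mul]

/-- The polynomial map `M ↦ (W ↦ J Mᵀ J W M)`, which extends `g ↦ Ad(g⁻¹)` to operators. -/
noncomputable def adInv (A : Op n) : LieAlg n →L[ℝ] LieAlg n :=
  LinearMap.toContinuousLinearMap
    { toFun := fun W => ofMat (J n * (toOp.symm A)ᵀ * J n * toMat W * toOp.symm A) (skew_conj _ W)
      map_add' := fun W W' => by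
        apply toMat_injective
        change J n * (toOp.symm A)ᵀ * J n * toMat (W + W') * toOp.symm A =
          J n * (toOp.symm A)ᵀ * J n * toMat W * toOp.symm A +
            J n * (toOp.symm A)ᵀ * J n * toMat W' * toOp.symm A
        rw [map_add, Matrix.mul_add, Matrix.add_mul]
      map_smul' := fun c W => by
        apply toMat_injective
        change J n * (toOp.symm A)ᵀ * J n * toMat (c • W) * toOp.symm A =
          c • (J n * (toOp.symm A)ᵀ * J n * toMat W * toOp.symm A)
        rw [map_smul, Matrix.mul_smul, Matrix.smul_mul] }

theorem toMat_adInv (A : Op n) (W : LieAlg n) :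
    toMat (adInv A W) = J n * (toOp.symm A)ᵀ * J n * toMat W * toOp.symm A := rfl

theorem contDiff_adInv : ContDiff ℝ ∞ (adInv (n := n)) := by
  refine contDiff_clm_apply_iff.2 fun W => ?_
  have hinj : Function.Injective (toOpL (n := n)) := fun X Y h =>
    toMat_injective (toOp.injective h)
  obtain ⟨L, hL⟩ := LinearMap.exists_leftInverse_of_injective (toOpL (n := n)).toLinearMap
    (LinearMap.ker_eq_bot.2 hinj)
  let T : Op n →L[ℝ] Op n := LinearMap.toContinuousLinearMap
    (toOp.toLinearMap ∘ₗ (Matrix.transposeLinearEquiv _ _ ℝ ℝ).toLinearMap ∘ₗ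
      toOp.symm.toLinearMap)
  have h1 : (fun A : Op n => adInv A W) = fun A => LinearMap.toContinuousLinearMap L
      (toOp (J n) * T A * toOp (J n * toMat W) * A) := by
    funext A
    have h2 : toOpL (adInv A W) = toOp (J n) * T A * toOp (J n * toMat W) * A := by
      rw [toOpL_apply, toMat_adInv]
      simp only [map_mul, AlgEquiv.apply_symm_apply, mul_assoc]
      rfl
    rw [← h2]
    exact (LinearMap.congr_fun hL _).symm
  rw [h1]
  refine (ContinuousLinearMap.contDiff _).comp ?_
  exact ((contDiff_const.mul T.contDiff).mul contDiff_const).mul contDiff_id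

/-- The weight of `A_ξ` on `𝔤₋₂` is `-2 = 2n - s` for `s = 2n + 2`. -/
theorem isAdapted_Ad {v : LieAlg n} (hv : v ∈ rootSpace ξ (-2)) :
    IsAdapted (Ad n) adInv ξ v (2 * n + 2) where
  smooth := contDiff_adInv
  eq_inv g W := by
    apply toMat_injective
    rw [toMat_adInv, toMat_Ad, inv_inv, mat_inv]
    simp [op]
  weight τ := by
    rw [Ad_expG_translationGen hv]
    ring_nf

/-- `∑ t_a^{2s}` over `Γ_ξ \ Γ` converges where the Poincaré series does at `s`: `t_a^{-2}` is
`-⟨γ O, ξ⟩`. -/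
theorem summable_iwasawa {Γ : Subgroup (SOPlus n)} [DiscreteTopology Γ]
    (h : IsFullRankParabolicFixedPoint Γ ξ) {u : Fin n → LieAlg n}
    (hu : IsHorosphericalFrame ξ u) {s : ℝ} (hs : 0 ≤ s) (hP : PoincareConverges Γ s) :
    Summable fun Q : Cosets Γ ξ => Real.exp (iwasawa ξ ((Q.out : Γ) : SOPlus n)).2.1 ^ (2 * s) := by
  refine (summable_height_rpow h hs hP).congr fun Q => ?_
  rw [(isIwasawa_iwasawa h.1 hu _).lorentz_boundary h.1, neg_neg, ← Real.exp_mul, ← Real.exp_mul]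
  ring_nf

end Frame

end HypEis

theorem corollary4p2 (n : ℕ) (Γ : Subgroup (HypEis.SOPlus n)) [DiscreteTopology Γ]
    (htf : ∀ γ ∈ Γ, IsOfFinOrder γ → γ = 1)
    (ξ : HypEis.Idx n → ℝ) (hξ : HypEis.IsFullRankParabolicFixedPoint Γ ξ)
    (u : Fin n → HypEis.LieAlg n) (hu : HypEis.IsHorosphericalFrame ξ u) :
    (∀ v ∈ HypEis.rootSpace ξ (-2),
      (∀ γ ∈ Γ ⊓ HypEis.parabolicSubgroup ξ, ∀ g,
        HypEis.phi (HypEis.Ad n) ξ u v (2 * n + 2) (γ * g) =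
          HypEis.phi (HypEis.Ad n) ξ u v (2 * n + 2) g) →
      HypEis.IsAbsConvClosedForm Γ (HypEis.Ad n) ξ u v (2 * n + 2)) ∧
    ((HypEis.IsConvergenceType Γ ∨ HypEis.criticalExponent Γ < n) →
      HypEis.IsAbsConvClosedForm Γ (Representation.trivial ℝ (HypEis.SOPlus n) ℝ) ξ u 1 (2 * n)) := by
  refine ⟨fun v hv hinv => ?_, fun hΓ => ?_⟩
  · refine (HypEis.isAdapted_Ad hv).isAbsConvClosedForm hξ.1 hu hinv ?_
    have h := HypEis.summable_iwasawa hξ hu (s := n + 1) (by positivity)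
      (HypEis.poincareConverges_of_lt Γ (lt_add_one _))
    rwa [mul_add, mul_one] at h
  · exact (HypEis.isAdapted_trivial ξ 1).isAbsConvClosedForm hξ.1 hu
      (fun γ hγ g => HypEis.phi_trivial_mul_left hξ.1 hu _ _
        (HypEis.mulVec_eq_of_mem_parabolicSubgroup hξ hγ) g)
      (HypEis.summable_iwasawa hξ hu (Nat.cast_nonneg n)
        (HypEis.poincareConverges_of_convergenceType Γ hΓ))
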